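/- **Conventions.** For a bounded open interval $J$, an integer $n\ge 0$ and $\theta\in(0,1)$, let $|f|_{H^n(J)}=\|D^nf\|_{L^2(J)}$ (weak derivatives) and $$|f|_{H^{n+\theta}(J)}^2=\int_J\int_J\frac{|D^nf(x)-D^nf(y)|^2}{|x-y|^{1+2\theta}}\,dx\,dy .$$ For real $r\ge0$, $\|f\|_{H^r(J)}^2=\sum_{j\le\lfloor r\rfloor}|f|_{H^j(J)}^2$, plus $|f|_{H^r(J)}^2$ if $r\notin\mathbb N$. For an integer $n$, $\|f\|_{W^{n,\infty}(J)}=\max_{j\le n}\|D^jf\|_{L^\infty(J)}$. **Setting.** Let $k\ge1$ be an integer. Let $E\subset\mathbb R^2$ be a bounded open set, $h_E=\operatorname{diam}E$, and let $e\subset\partial E$ be an edge, that is $e=\gamma([a,b])$ where $a<b$ and $\gamma:[a,b]\to\mathbb R^2$ is injective, of class $C^{k+1}$, with $\gamma'\neq0$ on $[a,b]$. Let $\zeta(t)=\int_a^t\|\gamma'(\tau)\|\,d\tau$ be the natural parameter, $\ell_e=\zeta(b)$ the length of $e$, $\zeta^{-1}:[0,\ell_e]\to[a,b]$ the inverse of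 $\zeta$, and $\chi=\gamma\circ\zeta^{-1}$ the arc-length parametrization. For real $r\ge 0$ put $|v|_{r,e}=|v\circ\chi|_{H^r((0,\ell_e))}$ and $\|v\|_{r,e}=\|v\circ\chi\|_{H^r((0,\ell_e))}$; $v\in H^r(e)$ means $\|v\|_{r,e}<\infty$, and for $r>\tfrac12$ such a $v$ is identified with its continuous representative. Let $\widetilde{\mathbb P}_k(e)=\{q\circ\gamma^{-1}: q\in\mathbb P_k([a,b])\}$, which is the space of polynomials of degree at most $k$ on the segment $e$ when $\gamma$ is affine. **Lemma.** Let $s,m$ be real numbers with $1<s\le k+1$ and $0\le m\le s$. Let $v\in H^s(e)$. There is exactly one function $v_I\in\widetilde{\mathbb P}_k(e)$ with $v_I(\gamma(x_j))=v(\gamma(x_j))$ at the $k+1$ nodes $x_j$ of the $(k+1)$-point Gauss–Lobatto quadrature rule on $[a,b]$, and the estimate $$|v-v_I|_{m,e}\le C\,h_E^{\,s-m}\,\|v\|_{s,e}$$ holds in the following two cases. 1. *Straight edge* ($\gamma$ affine). The constant $C$ depends only on $k,s,m$. 2. *Possibly curved edge*. Suppose that for some $\rho>0$ the set $E$ is star-shaped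 with respect to a ball of radius $\ge\rho h_E$. Then $C$ depends only on $k,s,m,\rho$ and on an upper bound $M$ of $\|\zeta\|_{W^{\lceil s\rceil,\infty}((a,b))}$ and $\|\zeta^{-1}\|_{W^{\lceil s\rceil,\infty}((0,\ell_e))}$. In both cases $C$ does not depend on $E$, $e$, $\gamma$, $v$. -/

import Mathlib

open MeasureTheory Set

noncomputable section

namespace CurvedEdge

/-! ## Sobolev spaces on a bounded open interval of the real line -/

/-- `g` is the weak derivative of order `n` of `f` on the open interval `(a, b)`: both are locally
integrable there and `∫ f φ⁽ⁿ⁾ = (-1)ⁿ ∫ g φ` for every test function `φ ∈ C_c^∞((a, b))`. -/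
def IsWeakDeriv (n : ℕ) (a b : ℝ) (f g : ℝ → ℝ) : Prop :=
  LocallyIntegrableOn f (Ioo a b) ∧ LocallyIntegrableOn g (Ioo a b) ∧
    ∀ φ : ℝ → ℝ, ContDiff ℝ ((⊤ : ℕ∞) : WithTop ℕ∞) φ → HasCompactSupport φ →
      tsupport φ ⊆ Ioo a b →
      ∫ x in Ioo a b, f x * iteratedDeriv n φ x = (-1) ^ n * ∫ x in Ioo a b, g x * φ x

/-- The Gagliardo (Slobodeckij) seminorm of order `θ ∈ (0, 1)` on `(a, b)`, with values
in `[0, ∞]`. -/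
def gagliardo (θ a b : ℝ) (g : ℝ → ℝ) : ENNReal :=
  (∫⁻ x in Ioo a b, ∫⁻ y in Ioo a b,
    ENNReal.ofReal (|g x - g y| ^ 2 / |x - y| ^ (1 + 2 * θ))) ^ (1 / 2 : ℝ)

/-- The seminorm `|f|_{H^r((a, b))}` of real order `r ≥ 0`, with values in `[0, ∞]`. With
`n = ⌊r⌋` and `g` the weak derivative of order `n` of `f`, it is the `L²` norm of `g` if `r` is an
integer and the Gagliardo seminorm of `g` of order `r - n` otherwise. As `g` is unique up to a null
set, the infimum is over equal values; it is `∞` if there is no such `g`. -/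
def hSeminorm (r a b : ℝ) (f : ℝ → ℝ) : ENNReal :=
  ⨅ (g : ℝ → ℝ) (_ : IsWeakDeriv ⌊r⌋₊ a b f g),
    if Int.fract r = 0 then eLpNorm g 2 (volume.restrict (Ioo a b))
    else gagliardo (Int.fract r) a b g

/-- The norm `‖f‖_{H^r((a, b))}` of real order `r ≥ 0`, with values in `[0, ∞]`; it is finite
exactly for `f ∈ H^r((a, b))`. -/
def hNorm (r a b : ℝ) (f : ℝ → ℝ) : ENNReal :=
  ((∑ j ∈ Finset.range (⌊r⌋₊ + 1), hSeminorm (j : ℝ) a b f ^ 2) +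
    (if Int.fract r = 0 then 0 else hSeminorm r a b f ^ 2)) ^ (1 / 2 : ℝ)

/-- The norm `‖f‖_{W^{n,∞}((a, b))}` of integer order `n`: the largest of the `L^∞` norms of the
weak derivatives of `f` of order at most `n`, and `∞` if one of these does not exist. -/
def wInftyNorm (n : ℕ) (a b : ℝ) (f : ℝ → ℝ) : ENNReal :=
  (Finset.range (n + 1)).sup fun j =>
    ⨅ (g : ℝ → ℝ) (_ : IsWeakDeriv j a b f g), eLpNorm g ⊤ (volume.restrict (Ioo a b))

/-! ## Parametrized edges in the plane -/

/-- `γ : [a, b] → ℝ²` is a regular and invertible parametrization of class `C^p`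
of the arc `γ([a, b])`. -/
structure IsRegularParam (p : ℕ) (γ : ℝ → EuclideanSpace ℝ (Fin 2)) (a b : ℝ) : Prop where
  lt : a < b
  contDiffOn : ContDiffOn ℝ (p : WithTop ℕ∞) γ (Icc a b)
  injOn : InjOn γ (Icc a b)
  deriv_ne_zero : ∀ t ∈ Icc a b, derivWithin γ (Icc a b) t ≠ 0

/-- `γ` is affine on `[a, b]`, so that `γ([a, b])` is a straight segment and polynomials in the
parameter are polynomials on that segment. -/
def IsAffineParam (γ : ℝ → EuclideanSpace ℝ (Fin 2)) (a b : ℝ) : Prop :=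
  ∃ p d : EuclideanSpace ℝ (Fin 2), ∀ t ∈ Icc a b, γ t = p + t • d

/-- The natural parameter `ζ(t) = ∫_a^t ‖γ'(τ)‖ dτ`. -/
def zeta (γ : ℝ → EuclideanSpace ℝ (Fin 2)) (a b : ℝ) (t : ℝ) : ℝ :=
  ∫ τ in a..t, ‖derivWithin γ (Icc a b) τ‖

/-- The length `ℓ_e = ζ(b)` of the edge. -/
def edgeLength (γ : ℝ → EuclideanSpace ℝ (Fin 2)) (a b : ℝ) : ℝ := zeta γ a b b

/-- The inverse `ζ⁻¹ : [0, ℓ_e] → [a, b]` of the natural parameter. -/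
def zetaInv (γ : ℝ → EuclideanSpace ℝ (Fin 2)) (a b : ℝ) : ℝ → ℝ :=
  Function.invFunOn (zeta γ a b) (Icc a b)

/-- The arc-length parametrization `χ = γ ∘ ζ⁻¹ : [0, ℓ_e] → e`. -/
def chi (γ : ℝ → EuclideanSpace ℝ (Fin 2)) (a b : ℝ) : ℝ → EuclideanSpace ℝ (Fin 2) :=
  γ ∘ zetaInv γ a b

/-- The Sobolev seminorm `|v|_{r,e}` on the edge, that is `|v ∘ χ|_{H^r((0, ℓ_e))}`. -/
def edgeSeminorm (r : ℝ) (γ : ℝ → EuclideanSpace ℝ (Fin 2)) (a b : ℝ)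
    (v : EuclideanSpace ℝ (Fin 2) → ℝ) : ENNReal :=
  hSeminorm r 0 (edgeLength γ a b) (v ∘ chi γ a b)

/-- The Sobolev norm `‖v‖_{r,e}` on the edge, that is `‖v ∘ χ‖_{H^r((0, ℓ_e))}`. -/
def edgeNorm (r : ℝ) (γ : ℝ → EuclideanSpace ℝ (Fin 2)) (a b : ℝ)
    (v : EuclideanSpace ℝ (Fin 2) → ℝ) : ENNReal :=
  hNorm r 0 (edgeLength γ a b) (v ∘ chi γ a b)

/-- `v ∈ H^r(e)`, for `r > 1/2`; the class `v` is represented by its continuous representative, so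
that point values on `e = γ([a, b])` make sense. -/
def MemHEdge (r : ℝ) (γ : ℝ → EuclideanSpace ℝ (Fin 2)) (a b : ℝ)
    (v : EuclideanSpace ℝ (Fin 2) → ℝ) : Prop :=
  ContinuousOn v (γ '' Icc a b) ∧ edgeNorm r γ a b v < ⊤

/-! ## Gauss-Lobatto interpolation -/

/-- The nodes of the `(k+1)`-point Gauss-Lobatto quadrature rule on `[a, b]`, for `k ≥ 1`: the two
endpoints and the zeros of the derivative of the Legendre polynomial of degree `k`
transported to `[a, b]`. -/
def gaussLobattoNodes (k : ℕ) (a b : ℝ) : Set ℝ :=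
  {t | ∃ x : ℝ, t = a + (b - a) * x ∧
    (x = 0 ∨ x = 1 ∨
      (((Polynomial.shiftedLegendre k).map (Int.castRingHom ℝ)).derivative).IsRoot x)}

/-- `w` restricted to `e = γ([a, b])` is of the form `q ∘ γ⁻¹` with `q` a polynomial of degree
at most `k`. -/
def MemPTilde (k : ℕ) (γ : ℝ → EuclideanSpace ℝ (Fin 2)) (a b : ℝ)
    (w : EuclideanSpace ℝ (Fin 2) → ℝ) : Prop :=
  ∃ q : Polynomial ℝ, q.natDegree ≤ k ∧ ∀ t ∈ Icc a b, w (γ t) = q.eval t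

/-- `w` lies in the mapped polynomial space of degree `k` on `e = γ([a, b])` and agrees with `v` at
the images through `γ` of the `k + 1` Gauss-Lobatto nodes. -/
def IsGaussLobattoInterpolant (k : ℕ) (γ : ℝ → EuclideanSpace ℝ (Fin 2)) (a b : ℝ)
    (v w : EuclideanSpace ℝ (Fin 2) → ℝ) : Prop :=
  MemPTilde k γ a b w ∧ ∀ t ∈ gaussLobattoNodes k a b, v (γ t) = w (γ t)

/-- `E` is star-shaped with respect to a ball of radius at least `ρ` times its diameter. -/
def IsStarShapedBall (ρ : ℝ) (E : Set (EuclideanSpace ℝ (Fin 2))) : Prop :=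
  ∃ (c : EuclideanSpace ℝ (Fin 2)) (r : ℝ), ρ * Metric.diam E ≤ r ∧ Metric.ball c r ⊆ E ∧
    ∀ y ∈ Metric.ball c r, StarConvex ℝ y E

end CurvedEdge

end

/-! On an interval of length L, let n be the integer part of s and θ the fractional part. The
interpolant q is compared with a polynomial p that agrees with f at the left endpoint in all
derivatives of order below n, and whose n-th derivative is a constant c: zero if θ = 0, the mean of
the n-th derivative of f otherwise. The fractional Poincaré inequality (trivial if θ = 0) bounds the
L² norm of the n-th derivative of f - p by L^θ |f|_s. Integrating down from the endpoint bounds all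
lower derivatives of f - p, with the right powers of L. As s ≤ k + 1, p has degree at most k, so q -
p is the Lagrange interpolant of f - p, and scaled stability of interpolation bounds its derivatives
by the sup of |f - p|. A fractional target order m is reached through the embedding of H¹ into the
Gagliardo space. This is `exists_interpolation_estimate`; every constant comes from an integral or a
maximum on [0, 1], with no compactness argument.

On a straight edge the arc length is an affine parameter, so Gauss–Lobatto nodes go to nodes and the
interval estimate applies on (0, ℓ_e), where ℓ_e is the distance of two boundary points, at most
h_E.

On a curved edge the function is pulled back to [a, b] by ζ, interpolated there by a true
polynomial, and pulled back to arc length by ζ⁻¹. Composition with a change of variables having ⌈s⌉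
bounded derivatives preserves the Sobolev norms (`exists_hNorm_comp_le`); it mixes the orders, so
full norms appear. There remains b - a ≤ C h_E. The Lipschitz bound of ζ⁻¹ gives b - a ≤ M ℓ_e when
M ≥ 1, and `edgeLength_le` bounds ℓ_e by comparing areas: the cone over the edge with vertex at the
centre of the ball lies in a square of side 2 h_E, and has area at least r ℓ_e / 2 because no
tangent line of the edge meets the ball of radius r. -/

namespace CurvedEdge

/-! ## Absolutely continuous functions on an interval -/

/-- `F` is a primitive on `[a, b]` of the integrable function `f`. -/
def IsPrim (a b : ℝ) (F f : ℝ → ℝ) : Prop :=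
  IntegrableOn f (Ioo a b) ∧ ∀ x ∈ Icc a b, F x = F a + ∫ t in a..x, f t

namespace IsPrim

variable {a b : ℝ} {F G f g : ℝ → ℝ}

theorem intervalIntegrable (hab : a ≤ b) (h : IsPrim a b F f) :
    IntervalIntegrable f volume a b :=
  (intervalIntegrable_iff_integrableOn_Ioo_of_le hab).2 h.1

theorem intervalIntegrable_of_mem (h : IsPrim a b F f) {x y : ℝ}
    (hx : x ∈ Icc a b) (hy : y ∈ Icc a b) : IntervalIntegrable f volume x y := by
  have hab : a ≤ b := hx.1.trans hx.2
  refine (h.intervalIntegrable hab).mono_set ?_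
  rw [uIcc_of_le hab]
  exact (uIcc_subset_Icc hx hy)

theorem sub_eq (h : IsPrim a b F f) {x y : ℝ} (hx : x ∈ Icc a b) (hy : y ∈ Icc a b) :
    F y - F x = ∫ t in x..y, f t := by
  have hab : a ≤ b := hx.1.trans hx.2
  have ha : a ∈ Icc a b := ⟨le_rfl, hab⟩
  rw [h.2 x hx, h.2 y hy, ← intervalIntegral.integral_add_adjacent_intervals
    (h.intervalIntegrable_of_mem ha hx) (h.intervalIntegrable_of_mem hx hy)]
  ring

theorem congr (h : IsPrim a b F f) (hF : EqOn G F (Icc a b))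
    (hf : ∀ᵐ x, x ∈ Ioo a b → g x = f x) : IsPrim a b G g := by
  have hf' : f =ᵐ[volume.restrict (Ioo a b)] g := by
    rw [Filter.EventuallyEq, ae_restrict_iff' measurableSet_Ioo]
    filter_upwards [hf] with x hx hx' using (hx hx').symm
  refine ⟨h.1.congr hf', fun x hx => ?_⟩
  have ha : a ∈ Icc a b := ⟨le_rfl, hx.1.trans hx.2⟩
  rw [hF hx, hF ha, h.2 x hx]
  congr 1
  refine intervalIntegral.integral_congr_ae ?_
  have hb : ∀ᵐ y : ℝ, y ≠ b := by simp [ae_iff]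
  filter_upwards [hf, hb] with y hy hyb hyx
  rw [uIoc_of_le hx.1] at hyx
  exact (hy ⟨hyx.1, lt_of_le_of_ne (hyx.2.trans hx.2) hyb⟩).symm

theorem absolutelyContinuousOnInterval (hab : a ≤ b) (h : IsPrim a b F f) :
    AbsolutelyContinuousOnInterval F a b := by
  have h1 := (h.intervalIntegrable hab).absolutelyContinuousOnInterval_intervalIntegral
    (c := a) left_mem_uIcc
  rw [absolutelyContinuousOnInterval_iff] at h1 ⊢
  intro ε hε
  obtain ⟨δ, hδ, H⟩ := h1 ε hε
  refine ⟨δ, hδ, fun E hE hE' => ?_⟩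
  refine lt_of_eq_of_lt (Finset.sum_congr rfl fun i hi => ?_) (H E hE hE')
  have h2 := hE.1 i hi
  rw [uIcc_of_le hab] at h2
  rw [h.2 _ h2.1, h.2 _ h2.2, dist_add_left]

theorem continuousOn (h : IsPrim a b F f) : ContinuousOn F (Icc a b) := by
  rcases le_or_gt a b with hab | hab
  · have := (h.absolutelyContinuousOnInterval hab).continuousOn
    rwa [uIcc_of_le hab] at this
  · simp [Icc_eq_empty (not_le.2 hab)]

theorem ae_hasDerivAt (h : IsPrim a b F f) :
    ∀ᵐ x, x ∈ Ioo a b → HasDerivAt F (f x) x := by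
  rcases le_or_gt b a with hab | hab
  · simp [Ioo_eq_empty (not_lt.2 hab)]
  filter_upwards [(h.intervalIntegrable hab.le).ae_hasDerivAt_integral] with x hx hx'
  rw [uIcc_of_le hab.le] at hx
  have h1 := (hx (Ioo_subset_Icc_self hx') a ⟨le_rfl, hab.le⟩).const_add (F a)
  refine h1.congr_of_eventuallyEq ?_
  filter_upwards [Icc_mem_nhds hx'.1 hx'.2] with y hy using h.2 y hy

theorem add (hF : IsPrim a b F f) (hG : IsPrim a b G g) :
    IsPrim a b (fun x => F x + G x) (fun x => f x + g x) := by
  refine ⟨hF.1.add hG.1, fun x hx => ?_⟩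
  have ha : a ∈ Icc a b := ⟨le_rfl, hx.1.trans hx.2⟩
  rw [intervalIntegral.integral_add (hF.intervalIntegrable_of_mem ha hx)
    (hG.intervalIntegrable_of_mem ha hx)]
  simp only [hF.2 x hx, hG.2 x hx]
  ring

theorem sub (hF : IsPrim a b F f) (hG : IsPrim a b G g) :
    IsPrim a b (fun x => F x - G x) (fun x => f x - g x) := by
  refine ⟨hF.1.sub hG.1, fun x hx => ?_⟩
  have ha : a ∈ Icc a b := ⟨le_rfl, hx.1.trans hx.2⟩
  rw [intervalIntegral.integral_sub (hF.intervalIntegrable_of_mem ha hx)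
    (hG.intervalIntegrable_of_mem ha hx)]
  simp only [hF.2 x hx, hG.2 x hx]
  ring

/-- Integration by parts for absolutely continuous functions, whose almost everywhere derivatives
are the given densities. -/
theorem mul (hF : IsPrim a b F f) (hG : IsPrim a b G g) :
    IsPrim a b (fun x => F x * G x) (fun x => f x * G x + F x * g x) := by
  rcases le_or_gt b a with hab | hab
  · refine ⟨by simp [Ioo_eq_empty (not_lt.2 hab)], fun x hx => ?_⟩
    have : x = a := le_antisymm (hx.2.trans hab) hx.1
    simp [this]
  have hI : IntervalIntegrable (fun x => f x * G x + F x * g x) volume a b := by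
    have hFc := hF.continuousOn
    have hGc := hG.continuousOn
    rw [← uIcc_of_le hab.le] at hFc hGc
    exact ((hF.intervalIntegrable hab.le).mul_continuousOn hGc).add
      ((hG.intervalIntegrable hab.le).continuousOn_mul hFc)
  refine ⟨(intervalIntegrable_iff_integrableOn_Ioo_of_le hab.le).1 hI, fun x hx => ?_⟩
  have hsub : uIcc a x ⊆ uIcc a b := by
    rw [uIcc_of_le hab.le]; exact uIcc_subset_Icc ⟨le_rfl, hab.le⟩ hx
  have h1 := AbsolutelyContinuousOnInterval.integral_deriv_mul_eq_sub
    ((hF.absolutelyContinuousOnInterval hab.le).mono hsub)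
    ((hG.absolutelyContinuousOnInterval hab.le).mono hsub)
  have h2 : ∫ t in a..x, (f t * G t + F t * g t) =
      ∫ t in a..x, (deriv F t * G t + F t * deriv G t) := by
    refine intervalIntegral.integral_congr_ae ?_
    have hb : ∀ᵐ y : ℝ, y ≠ b := by simp [ae_iff]
    filter_upwards [hF.ae_hasDerivAt, hG.ae_hasDerivAt, hb] with y h3 h4 hyb hy
    rw [uIoc_of_le hx.1] at hy
    have hy' : y ∈ Ioo a b := ⟨hy.1, lt_of_le_of_ne (hy.2.trans hx.2) hyb⟩
    rw [(h3 hy').deriv, (h4 hy').deriv]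
  rw [h2, h1]
  ring

theorem of_hasDerivAt (hF : ∀ x, HasDerivAt F (f x) x) (hf : Continuous f) : IsPrim a b F f := by
  refine ⟨(hf.integrableOn_Icc).mono_set Ioo_subset_Icc_self, fun x _ => ?_⟩
  rw [intervalIntegral.integral_eq_sub_of_hasDerivAt (fun y _ => hF y)
    (hf.intervalIntegrable _ _)]
  ring

theorem const (c : ℝ) : IsPrim a b (fun _ => c) (fun _ => 0) :=
  of_hasDerivAt (fun x => hasDerivAt_const x c) continuous_const

theorem of_integral (hf : IntegrableOn f (Ioo a b)) (c : ℝ) :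
    IsPrim a b (fun x => c + ∫ t in a..x, f t) f :=
  ⟨hf, fun x _ => by simp⟩

theorem integrableOn_left (h : IsPrim a b F f) : IntegrableOn F (Ioo a b) :=
  (h.continuousOn.integrableOn_Icc).mono_set Ioo_subset_Icc_self

end IsPrim

/-! ## Weak derivatives -/

section WeakDeriv

variable {a b : ℝ} {n : ℕ} {f g f' g' F G : ℝ → ℝ}

theorem IsWeakDeriv.congr (h : IsWeakDeriv n a b f g) (hf : ∀ᵐ x, x ∈ Ioo a b → f' x = f x)
    (hg : ∀ᵐ x, x ∈ Ioo a b → g' x = g x) : IsWeakDeriv n a b f' g' := by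
  have key : ∀ {u v : ℝ → ℝ}, (∀ᵐ x, x ∈ Ioo a b → v x = u x) →
      LocallyIntegrableOn u (Ioo a b) → LocallyIntegrableOn v (Ioo a b) := by
    intro u v huv hu
    rw [locallyIntegrableOn_iff isOpen_Ioo.isLocallyClosed] at hu ⊢
    intro K hK hKc
    refine (hu K hK hKc).congr ?_
    rw [Filter.EventuallyEq, ae_restrict_iff' hKc.measurableSet]
    filter_upwards [huv] with x hx hxK using (hx (hK hxK)).symm
  refine ⟨key hf h.1, key hg h.2.1, fun φ h1 h2 h3 => ?_⟩
  have e1 : ∫ x in Ioo a b, f' x * iteratedDeriv n φ x =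
      ∫ x in Ioo a b, f x * iteratedDeriv n φ x := by
    refine setIntegral_congr_ae measurableSet_Ioo ?_
    filter_upwards [hf] with x hx hx' using by rw [hx hx']
  have e2 : ∫ x in Ioo a b, g' x * φ x = ∫ x in Ioo a b, g x * φ x := by
    refine setIntegral_congr_ae measurableSet_Ioo ?_
    filter_upwards [hg] with x hx hx' using by rw [hx hx']
  rw [e1, e2, h.2.2 φ h1 h2 h3]

theorem setIntegral_mul_eq_integral {φ : ℝ → ℝ} (hφ : tsupport φ ⊆ Ioo a b) :
    ∫ x in Ioo a b, g x * φ x = ∫ x, g x * φ x := by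
  refine setIntegral_eq_integral_of_forall_compl_eq_zero fun x hx => ?_
  rw [image_eq_zero_of_notMem_tsupport (fun h => hx (hφ h)), mul_zero]

theorem ae_eq_zero_of_integral_mul_eq_zero (hg : LocallyIntegrableOn g (Ioo a b))
    (h : ∀ φ : ℝ → ℝ, ContDiff ℝ ((⊤ : ℕ∞) : WithTop ℕ∞) φ → HasCompactSupport φ →
      tsupport φ ⊆ Ioo a b → ∫ x in Ioo a b, g x * φ x = 0) :
    ∀ᵐ x, x ∈ Ioo a b → g x = 0 := by
  refine isOpen_Ioo.ae_eq_zero_of_integral_contDiff_smul_eq_zero hg fun φ h1 h2 h3 => ?_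
  have := h φ h1 h2 h3
  rw [setIntegral_mul_eq_integral h3] at this
  simpa [mul_comm] using this

theorem integrable_mul_test {φ : ℝ → ℝ} (hg : LocallyIntegrableOn g (Ioo a b))
    (h1 : Continuous φ) (h2 : HasCompactSupport φ) (h3 : tsupport φ ⊆ Ioo a b) :
    IntegrableOn (fun x => g x * φ x) (Ioo a b) := by
  rw [locallyIntegrableOn_iff isOpen_Ioo.isLocallyClosed] at hg
  have h4 := (hg _ h3 h2).mul_continuousOn h1.continuousOn h2
  refine (integrableOn_iff_integrable_of_support_subset ?_).1 h4 |>.integrableOn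
  intro x hx
  refine subset_tsupport _ ?_
  exact right_ne_zero_of_mul hx

theorem IsWeakDeriv.ae_eq (h : IsWeakDeriv n a b f g) (h' : IsWeakDeriv n a b f g') :
    ∀ᵐ x, x ∈ Ioo a b → g x = g' x := by
  have := ae_eq_zero_of_integral_mul_eq_zero (h.2.1.sub h'.2.1) fun φ h1 h2 h3 => by
    have e1 := h.2.2 φ h1 h2 h3
    have e2 := h'.2.2 φ h1 h2 h3
    have e3 : ∫ x in Ioo a b, g x * φ x = ∫ x in Ioo a b, g' x * φ x :=
      mul_left_cancel₀ (pow_ne_zero n (by norm_num : (-1 : ℝ) ≠ 0)) (e1.symm.trans e2)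
    have e4 := integral_sub (integrable_mul_test h.2.1 h1.continuous h2 h3)
      (integrable_mul_test h'.2.1 h1.continuous h2 h3)
    simp only [Pi.sub_apply, sub_mul]
    rw [e4, e3, sub_self]
  filter_upwards [this] with x hx hx' using sub_eq_zero.1 (hx hx')

theorem isWeakDeriv_zero_iff : IsWeakDeriv 0 a b f g ↔
    LocallyIntegrableOn f (Ioo a b) ∧ ∀ᵐ x, x ∈ Ioo a b → g x = f x := by
  have key : ∀ {f : ℝ → ℝ}, LocallyIntegrableOn f (Ioo a b) → IsWeakDeriv 0 a b f f :=
    fun h => ⟨h, h, fun φ _ _ _ => by simp⟩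
  exact ⟨fun h => ⟨h.1, h.ae_eq (key h.1)⟩,
    fun h => (key h.1).congr (by simp) h.2⟩

theorem tsupport_deriv_subset' {φ : ℝ → ℝ} : tsupport (deriv φ) ⊆ tsupport φ :=
  closure_minimal (support_deriv_subset) (isClosed_tsupport φ)

theorem contDiff_top_deriv {φ : ℝ → ℝ} (h : ContDiff ℝ ((⊤ : ℕ∞) : WithTop ℕ∞) φ) :
    ContDiff ℝ ((⊤ : ℕ∞) : WithTop ℕ∞) (deriv φ) :=
  (contDiff_infty_iff_deriv.1 h).2

theorem contDiff_top_iteratedDeriv {φ : ℝ → ℝ} (h : ContDiff ℝ ((⊤ : ℕ∞) : WithTop ℕ∞) φ) (n : ℕ) :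
    ContDiff ℝ ((⊤ : ℕ∞) : WithTop ℕ∞) (iteratedDeriv n φ) ∧
      tsupport (iteratedDeriv n φ) ⊆ tsupport φ := by
  induction n with
  | zero => exact ⟨by simpa using h, by simp⟩
  | succ n ih =>
    rw [iteratedDeriv_succ]
    exact ⟨contDiff_top_deriv ih.1, tsupport_deriv_subset'.trans ih.2⟩

/-- Consecutive weak derivatives of `f` are weak derivatives of each other. -/
theorem IsWeakDeriv.succ_one (h : IsWeakDeriv n a b f g) (h' : IsWeakDeriv (n + 1) a b f g') :
    IsWeakDeriv 1 a b g g' := by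
  refine ⟨h.2.1, h'.2.1, fun φ h1 h2 h3 => ?_⟩
  have e1 := h'.2.2 φ h1 h2 h3
  have e2 := h.2.2 (deriv φ) (contDiff_top_deriv h1) h2.deriv (tsupport_deriv_subset'.trans h3)
  rw [iteratedDeriv_succ', e2, pow_succ, mul_assoc] at e1
  rw [iteratedDeriv_one, pow_one]
  exact mul_left_cancel₀ (pow_ne_zero n (by norm_num : (-1 : ℝ) ≠ 0)) e1

theorem IsPrim.integral_mul_deriv (h : IsPrim a b F f) {φ : ℝ → ℝ}
    (h1 : ContDiff ℝ ((⊤ : ℕ∞) : WithTop ℕ∞) φ) (h3 : tsupport φ ⊆ Ioo a b) :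
    ∫ x in Ioo a b, F x * deriv φ x = - ∫ x in Ioo a b, f x * φ x := by
  rcases le_or_gt b a with hab | hab
  · simp [Ioo_eq_empty (not_lt.2 hab)]
  have hφ : IsPrim a b φ (deriv φ) := .of_hasDerivAt
    (fun x => (h1.differentiable (by simp) x).hasDerivAt) (h1.continuous_deriv (by simp))
  have h4 := (h.mul hφ).2 b ⟨hab.le, le_rfl⟩
  have h5 : φ b = 0 := image_eq_zero_of_notMem_tsupport fun hb => lt_irrefl _ (h3 hb).2
  have h6 : φ a = 0 := image_eq_zero_of_notMem_tsupport fun hb => lt_irrefl _ (h3 hb).1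
  simp only [h5, h6, mul_zero, zero_add] at h4
  rw [ intervalIntegral.integral_of_le hab.le,
    integral_Ioc_eq_integral_Ioo, integral_add] at h4
  · linarith
  · have hc := hφ.continuousOn
    rw [← uIcc_of_le hab.le] at hc
    exact (intervalIntegrable_iff_integrableOn_Ioo_of_le hab.le).1
      ((h.intervalIntegrable hab.le).mul_continuousOn hc)
  · have hc := h.continuousOn
    rw [← uIcc_of_le hab.le] at hc
    exact (intervalIntegrable_iff_integrableOn_Ioo_of_le hab.le).1
      ((hφ.intervalIntegrable hab.le).continuousOn_mul hc)

/-- One integration by parts moves the outermost derivative of the test function onto `F`; the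
boundary terms vanish because the support is compact in the open interval. -/
theorem IsWeakDeriv.succ_of_isPrim (h : IsWeakDeriv n a b f g) (hF : IsPrim a b F f) :
    IsWeakDeriv (n + 1) a b F g := by
  refine ⟨hF.integrableOn_left.locallyIntegrableOn, h.2.1, fun φ h1 h2 h3 => ?_⟩
  have h4 := contDiff_top_iteratedDeriv h1 n
  rw [iteratedDeriv_succ, hF.integral_mul_deriv h4.1 (h4.2.trans h3), h.2.2 φ h1 h2 h3, pow_succ]
  ring

/-- The lemma of du Bois-Reymond. -/
theorem IsWeakDeriv.eq_const (hab : a < b) (h : IsWeakDeriv 1 a b f 0) :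
    ∃ c, ∀ᵐ x, x ∈ Ioo a b → f x = c := by
  obtain ⟨ψ, hψ1, hψ2, hψ3, hψ4⟩ : ∃ ψ : ℝ → ℝ, ContDiff ℝ ((⊤ : ℕ∞) : WithTop ℕ∞) ψ ∧
      HasCompactSupport ψ ∧ tsupport ψ ⊆ Ioo a b ∧ ∫ x, ψ x = 1 := by
    let ψ : ContDiffBump ((a + b) / 2) :=
      ⟨(b - a) / 8, (b - a) / 4, by linarith, by linarith⟩
    refine ⟨ψ.normed volume, ψ.contDiff_normed, ψ.hasCompactSupport_normed, ?_, ψ.integral_normed⟩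
    rw [ψ.tsupport_normed_eq, Real.closedBall_eq_Icc]
    intro x hx
    have h1 : ψ.rOut = (b - a) / 4 := rfl
    rw [h1] at hx
    constructor <;> [have := hx.1; have := hx.2] <;> linarith
  -- Testing a constant against `ψ`, which has integral one, returns the constant.
  set c := ∫ x in Ioo a b, f x * ψ x with hc
  have hconst : LocallyIntegrableOn (fun _ : ℝ => c) (Ioo a b) :=
    (continuous_const.continuousOn).locallyIntegrableOn measurableSet_Ioo
  refine ⟨c, ?_⟩
  have key := ae_eq_zero_of_integral_mul_eq_zero (h.1.sub hconst) fun φ h1 h2 h3 => by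
    set I := ∫ x, φ x with hI
    -- Removing the mean of `φ` makes the primitive `θ` of `η` a test function: it vanishes to the
    -- left of the supports, and to the right because `η` has integral zero. Testing with `θ` then
    -- gives `∫ f η = 0`.
    let η : ℝ → ℝ := fun x => φ x - I * ψ x
    have hη1 : ContDiff ℝ ((⊤ : ℕ∞) : WithTop ℕ∞) η := h1.sub (contDiff_const.mul hψ1)
    have hη0 : ∀ x, x ∉ tsupport φ ∪ tsupport ψ → η x = 0 := fun x hx => by
      simp only [mem_union, not_or] at hx
      simp [η, image_eq_zero_of_notMem_tsupport hx.1, image_eq_zero_of_notMem_tsupport hx.2]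
    have hK : IsCompact (tsupport φ ∪ tsupport ψ) := h2.isCompact.union hψ2.isCompact
    have hK' : tsupport φ ∪ tsupport ψ ⊆ Ioo a b := union_subset h3 hψ3
    obtain ⟨a', b', hab', hKab, hsub⟩ : ∃ a' b', a' ≤ b' ∧ tsupport φ ∪ tsupport ψ ⊆ Icc a' b' ∧
        Icc a' b' ⊆ Ioo a b := by
      rcases (tsupport φ ∪ tsupport ψ).eq_empty_or_nonempty with h0 | h0
      · refine ⟨(a + b) / 2, (a + b) / 2, le_rfl, by simp [h0], fun x hx => ?_⟩
        constructor <;> [have := hx.1; have := hx.2] <;> linarith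
      · refine ⟨sInf _, sSup _, ?_, fun x hx => ⟨csInf_le hK.bddBelow hx, le_csSup hK.bddAbove hx⟩,
          fun x hx => ⟨(hK' (hK.sInf_mem h0)).1.trans_le hx.1,
            hx.2.trans_lt (hK' (hK.sSup_mem h0)).2⟩⟩
        exact csInf_le_csSup h0 hK.bddBelow hK.bddAbove
    have hηint : ∫ x, η x = 0 := by
      rw [integral_sub (h1.continuous.integrable_of_hasCompactSupport h2)
        ((hψ1.continuous.integrable_of_hasCompactSupport hψ2).const_mul _), integral_const_mul,
        hψ4, ← hI]
      ring
    let θ : ℝ → ℝ := fun x => ∫ t in a..x, η t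
    have hθd : ∀ x, HasDerivAt θ (η x) x := fun x =>
      intervalIntegral.integral_hasDerivAt_right (hη1.continuous.intervalIntegrable _ _)
        (hη1.continuous.stronglyMeasurableAtFilter _ _) hη1.continuous.continuousAt
    have hθ' : deriv θ = η := funext fun x => (hθd x).deriv
    have hθ1 : ContDiff ℝ ((⊤ : ℕ∞) : WithTop ℕ∞) θ :=
      contDiff_infty_iff_deriv.2 ⟨fun x => (hθd x).differentiableAt, by rwa [hθ']⟩
    have hηs : ∀ x, x ∉ Icc a' b' → η x = 0 := fun x hx => hη0 x fun h => hx (hKab h)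
    have haa' : a < a' := (hsub ⟨le_rfl, hab'⟩).1
    have hbb' : b' < b := (hsub ⟨hab', le_rfl⟩).2
    have hθ0 : ∀ x, x ∉ Icc a' b' → θ x = 0 := by
      intro x hx
      rcases lt_or_ge x a' with hxa | hxa
      · refine intervalIntegral.integral_zero_ae (ae_of_all _ fun y hy => hηs y fun hy' => ?_)
        rcases uIoc_subset_uIcc hy with ⟨-, hy2⟩
        exact absurd hy'.1 (not_le.2 (hy2.trans_lt (max_lt haa' hxa)))
      · have hxb : b' < x := lt_of_not_ge fun h => hx ⟨hxa, h⟩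
        change ∫ t in a..x, η t = 0
        rw [intervalIntegral.integral_eq_integral_of_support_subset, hηint]
        intro y hy
        have hy' : y ∈ Icc a' b' := by_contra fun h => hy (hηs y h)
        exact ⟨haa'.trans_le hy'.1, hy'.2.trans hxb.le⟩
    have hθs : tsupport θ ⊆ Icc a' b' :=
      closure_minimal (fun x hx => by_contra fun h => hx (hθ0 x h)) isClosed_Icc
    have e1 := h.2.2 θ hθ1 (isCompact_Icc.of_isClosed_subset (isClosed_tsupport _) hθs)
      (hθs.trans hsub)
    rw [iteratedDeriv_one, hθ'] at e1
    have i1 := integrable_mul_test h.1 h1.continuous h2 h3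
    have i2 := integrable_mul_test h.1 hψ1.continuous hψ2 hψ3
    have e2 : ∫ x in Ioo a b, f x * η x = (∫ x in Ioo a b, f x * φ x) - I * c := by
      rw [hc, ← integral_const_mul, ← integral_sub i1 (i2.const_mul I)]
      refine integral_congr_ae (ae_of_all _ fun x => ?_)
      simp only [η]; ring
    have e3 : ∫ x in Ioo a b, c * φ x = c * I := by
      rw [setIntegral_mul_eq_integral (g := fun _ => c) h3, integral_const_mul]
    have e4 : ∫ x in Ioo a b, (f x - c) * φ x =
        (∫ x in Ioo a b, f x * φ x) - ∫ x in Ioo a b, c * φ x := by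
      rw [← integral_sub i1 (integrable_mul_test hconst h1.continuous h2 h3)]
      refine integral_congr_ae (ae_of_all _ fun x => ?_)
      ring
    simp only [Pi.zero_apply, zero_mul, integral_zero, mul_zero] at e1
    change ∫ x in Ioo a b, (f x - c) * φ x = 0
    rw [e4, e3]
    linarith
  filter_upwards [key] with x hx hx' using sub_eq_zero.1 (hx hx')

/-- The primitive of `g` also has weak derivative `g`, so its difference with `f` has weak
derivative zero. -/
theorem IsWeakDeriv.exists_eq_integral (hab : a < b) (h : IsWeakDeriv 1 a b f g)
    (hg : IntegrableOn g (Ioo a b)) :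
    ∃ c, ∀ᵐ x, x ∈ Ioo a b → f x = c + ∫ t in a..x, g t := by
  have hP := IsPrim.of_integral (a := a) (b := b) hg 0
  have h0 : IsWeakDeriv 1 a b (fun x => 0 + ∫ t in a..x, g t) g :=
    IsWeakDeriv.succ_of_isPrim (n := 0) (isWeakDeriv_zero_iff.2 ⟨h.2.1, by simp⟩) hP
  have h1 : IsWeakDeriv 1 a b (fun x => f x - (0 + ∫ t in a..x, g t)) 0 := by
    refine ⟨h.1.sub h0.1, locallyIntegrableOn_zero, fun φ h1 h2 h3 => ?_⟩
    have h4 := contDiff_top_iteratedDeriv h1 1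
    have h5 : HasCompactSupport (iteratedDeriv 1 φ) :=
      h2.isCompact.of_isClosed_subset (isClosed_tsupport _) h4.2
    simp only [sub_mul]
    rw [integral_sub (integrable_mul_test h.1 h4.1.continuous h5 (h4.2.trans h3))
      (integrable_mul_test h0.1 h4.1.continuous h5 (h4.2.trans h3)),
      h.2.2 φ h1 h2 h3, h0.2.2 φ h1 h2 h3]
    simp
  obtain ⟨c, hc⟩ := h1.eq_const hab
  refine ⟨c, ?_⟩
  filter_upwards [hc] with x hx hx'
  have := hx hx'
  linarith

/-- The continuous representatives of the weak derivatives of `f`: a function with integrable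
weak derivatives up to order `n` is an iterated primitive. -/
theorem exists_isPrim_chain (hab : a < b) (hf : ContinuousOn f (Icc a b)) (D : ℕ → ℝ → ℝ)
    (hD : ∀ j ≤ n, IsWeakDeriv j a b f (D j)) (hDi : ∀ j ≤ n, IntegrableOn (D j) (Ioo a b)) :
    ∃ F : ℕ → ℝ → ℝ, EqOn (F 0) f (Icc a b) ∧ (∀ j < n, IsPrim a b (F j) (F (j + 1))) ∧
      ∀ j ≤ n, IsWeakDeriv j a b f (F j) := by
  have h1 : ∀ j, ∃ c, j < n → ∀ᵐ x, x ∈ Ioo a b → D j x = c + ∫ t in a..x, D (j + 1) t := by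
    intro j
    by_cases hj : j < n
    · obtain ⟨c, hc⟩ := ((hD j hj.le).succ_one (hD (j + 1) hj)).exists_eq_integral hab
        (hDi (j + 1) hj)
      exact ⟨c, fun _ => hc⟩
    · exact ⟨0, fun h => absurd h hj⟩
  choose c hc using h1
  -- The function `f` is kept, since its point values are interpolated. Intermediate derivatives are
  -- replaced by their absolutely continuous representatives; the top one need not have a continuous
  -- representative and is kept as well.
  let F : ℕ → ℝ → ℝ := fun j => if j = 0 then f else
    if j < n then fun x => c j + ∫ t in a..x, D (j + 1) t else D j
  have hF : ∀ j ≤ n, ∀ᵐ x, x ∈ Ioo a b → F j x = D j x := by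
    intro j hj
    rcases eq_or_ne j 0 with rfl | h0
    · filter_upwards [(isWeakDeriv_zero_iff.1 (hD 0 hj)).2] with x hx hx'
      simp [F, hx hx']
    · rcases lt_or_eq_of_le hj with h | h
      · filter_upwards [hc j h] with x hx hx'
        simp [F, h0, h, hx hx']
      · subst h
        simp [F, h0]
  refine ⟨F, fun x _ => by simp [F], fun j hj => ?_, fun j hj =>
    (hD j hj).congr (by simp) (hF j hj)⟩
  have hP := IsPrim.of_integral (hDi (j + 1) hj) (c j)
  refine hP.congr ?_ (hF (j + 1) hj)
  rcases eq_or_ne j 0 with rfl | h0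
  · have hae : ∀ᵐ x, x ∈ Ioo a b → F 0 x = c 0 + ∫ t in a..x, D (0 + 1) t := by
      filter_upwards [hF 0 hj.le, hc 0 hj] with x h1 h2 h3 using (h1 h3).trans (h2 h3)
    -- Both sides are continuous, so equality almost everywhere is equality on the closed interval,
    -- endpoints included.
    have h2 : EqOn (F 0) (fun x => c 0 + ∫ t in a..x, D (0 + 1) t) (Icc a b) := by
      refine Measure.eqOn_Icc_of_ae_eq volume hab.ne ?_ (by simpa [F] using hf) hP.continuousOn
      rw [Filter.EventuallyEq, ae_restrict_iff' measurableSet_Icc]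
      have ha : ∀ᵐ y : ℝ, y ≠ a := by simp [ae_iff]
      have hb : ∀ᵐ y : ℝ, y ≠ b := by simp [ae_iff]
      filter_upwards [hae, ha, hb] with x h1 h2 h3 h4
      exact h1 ⟨lt_of_le_of_ne h4.1 h2.symm, lt_of_le_of_ne h4.2 h3⟩
    exact h2
  · intro x _
    simp [F, h0, hj]

end WeakDeriv

/-! ## The Gagliardo seminorm -/

section Gagliardo

variable {a b θ : ℝ} {f g F : ℝ → ℝ}

theorem setLIntegral_rpow_Ioc {p : ℝ} (hp : -1 < p) {L : ℝ} (hL : 0 ≤ L) :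
    ∫⁻ x in Ioc 0 L, ENNReal.ofReal (x ^ p) = ENNReal.ofReal (L ^ (p + 1) / (p + 1)) := by
  have h1 : IntegrableOn (fun x : ℝ => x ^ p) (Ioc 0 L) :=
    (intervalIntegrable_iff_integrableOn_Ioc_of_le hL).1 (intervalIntegral.intervalIntegrable_rpow' hp)
  rw [← ofReal_integral_eq_lintegral_ofReal h1, ← intervalIntegral.integral_of_le hL,
    integral_rpow (Or.inl hp), Real.zero_rpow (by linarith), sub_zero]
  filter_upwards [ae_restrict_mem measurableSet_Ioc] with x hx using Real.rpow_nonneg hx.1.le _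

/-- Splitting at `t` leaves two power integrals over lengths at most `b - a`. Uniformity in `t` is
what the double integrals below need after Tonelli. -/
theorem setLIntegral_abs_sub_rpow_le {p t : ℝ} (hp : -1 < p) (ht : t ∈ Icc a b) :
    ∫⁻ x in Ioo a b, ENNReal.ofReal (|x - t| ^ p) ≤
      ENNReal.ofReal (2 * (b - a) ^ (p + 1) / (p + 1)) := by
  have hp1 : 0 < p + 1 := by linarith
  have key : ∀ c ≤ b - a, 0 ≤ c → ENNReal.ofReal (c ^ (p + 1) / (p + 1)) ≤
      ENNReal.ofReal ((b - a) ^ (p + 1) / (p + 1)) := fun c hc hc0 =>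
    ENNReal.ofReal_le_ofReal (by gcongr)
  have h1 : ∫⁻ x in Ico a t, ENNReal.ofReal (|x - t| ^ p) ≤
      ENNReal.ofReal ((b - a) ^ (p + 1) / (p + 1)) := by
    refine le_trans (le_of_eq ?_) (key (t - a) (by linarith [ht.2]) (by linarith [ht.1]))
    rw [← setLIntegral_rpow_Ioc hp (by linarith [ht.1]), ← lintegral_indicator measurableSet_Ico,
      ← lintegral_indicator measurableSet_Ioc,
      ← lintegral_sub_left_eq_self _ t]
    congr 1
    ext x
    by_cases hx : t - x ∈ Ico a t
    · have hx0 : 0 < x := by linarith [hx.2]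
      rw [indicator_of_mem hx, indicator_of_mem (by constructor <;> linarith [hx.1, hx.2]),
        abs_sub_comm, sub_sub_cancel, abs_of_pos hx0]
    · rw [indicator_of_notMem hx, indicator_of_notMem]
      intro hx'
      exact hx ⟨by linarith [hx'.2], by linarith [hx'.1]⟩
  have h2 : ∫⁻ x in Ioc t b, ENNReal.ofReal (|x - t| ^ p) ≤
      ENNReal.ofReal ((b - a) ^ (p + 1) / (p + 1)) := by
    refine le_trans (le_of_eq ?_) (key (b - t) (by linarith [ht.1]) (by linarith [ht.2]))
    rw [← setLIntegral_rpow_Ioc hp (by linarith [ht.2]), ← lintegral_indicator measurableSet_Ioc,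
      ← lintegral_indicator measurableSet_Ioc,
      ← lintegral_add_right_eq_self _ t]
    congr 1
    ext x
    by_cases hx : x + t ∈ Ioc t b
    · have hx0 : 0 < x := by linarith [hx.1]
      rw [indicator_of_mem hx, indicator_of_mem (by constructor <;> linarith [hx.1, hx.2]),
        add_sub_cancel_right, abs_of_pos hx0]
    · rw [indicator_of_notMem hx, indicator_of_notMem]
      intro hx'
      exact hx ⟨by linarith [hx'.1], by linarith [hx'.2]⟩
  calc ∫⁻ x in Ioo a b, ENNReal.ofReal (|x - t| ^ p)
      ≤ ∫⁻ x in Ico a t ∪ Ioc t b, ENNReal.ofReal (|x - t| ^ p) := by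
        refine lintegral_mono' ?_ le_rfl
        have : Ioo a b ≤ᵐ[volume] (Ico a t ∪ Ioc t b : Set ℝ) := by
          have h : ∀ᵐ y : ℝ, y ≠ t := by simp [ae_iff]
          filter_upwards [h] with x hx hx'
          rcases lt_or_gt_of_ne hx with h | h
          · exact Or.inl ⟨(hx' : x ∈ Ioo a b).1.le, h⟩
          · exact Or.inr ⟨h, (hx' : x ∈ Ioo a b).2.le⟩
        exact Measure.restrict_mono_ae this
    _ ≤ _ := lintegral_union_le _ _ _
    _ ≤ ENNReal.ofReal ((b - a) ^ (p + 1) / (p + 1)) +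
        ENNReal.ofReal ((b - a) ^ (p + 1) / (p + 1)) := add_le_add h1 h2
    _ = _ := by
        have : a ≤ b := ht.1.trans ht.2
        rw [← ENNReal.ofReal_add] <;> [congr 1; skip; skip]
        · ring
        all_goals exact div_nonneg (Real.rpow_nonneg (by linarith) _) hp1.le

/-- The difference quotient whose `L²` norm is the Gagliardo seminorm. -/
noncomputable def diffQuot (θ : ℝ) (g : ℝ → ℝ) (z : ℝ × ℝ) : ℝ :=
  (g z.1 - g z.2) / |z.1 - z.2| ^ (1 / 2 + θ)

theorem enorm_diffQuot_sq (θ : ℝ) (g : ℝ → ℝ) (z : ℝ × ℝ) :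
    ‖diffQuot θ g z‖ₑ ^ (2 : ℝ) =
      ENNReal.ofReal (|g z.1 - g z.2| ^ 2 / |z.1 - z.2| ^ (1 + 2 * θ)) := by
  rw [← ofReal_norm, ENNReal.ofReal_rpow_of_nonneg (norm_nonneg _) (by norm_num)]
  congr 1
  rw [diffQuot, norm_div, Real.norm_eq_abs, Real.norm_eq_abs,
    abs_of_nonneg (Real.rpow_nonneg (abs_nonneg _) _), Real.div_rpow (abs_nonneg _)
      (Real.rpow_nonneg (abs_nonneg _) _), Real.rpow_two, ← Real.rpow_mul (abs_nonneg _)]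
  congr 2
  ring

theorem eLpNorm_two_eq {α : Type*} [MeasurableSpace α] (μ : Measure α) (h : α → ℝ) :
    eLpNorm h 2 μ = (∫⁻ x, ‖h x‖ₑ ^ (2 : ℝ) ∂μ) ^ (1 / 2 : ℝ) := by
  rw [eLpNorm_eq_lintegral_rpow_enorm_toReal (by norm_num) (by norm_num)]
  simp

theorem aemeasurable_diffQuot {μ : Measure ℝ} [SFinite μ] (hg : AEMeasurable g μ) :
    AEMeasurable (diffQuot θ g) (μ.prod μ) := by
  refine (hg.comp_fst.sub hg.comp_snd).div ?_
  exact Measurable.aemeasurable (by fun_prop)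

/-- Written as an `L²` norm on the square, the seminorm inherits the triangle inequality and
pointwise domination. -/
theorem gagliardo_eq_eLpNorm (hg : AEMeasurable g (volume.restrict (Ioo a b))) :
    gagliardo θ a b g = eLpNorm (diffQuot θ g) 2
      ((volume.restrict (Ioo a b)).prod (volume.restrict (Ioo a b))) := by
  rw [eLpNorm_two_eq, lintegral_prod _ ((aemeasurable_diffQuot hg).enorm.pow_const _)]
  simp only [enorm_diffQuot_sq]
  rfl

theorem gagliardo_congr (h : ∀ᵐ x, x ∈ Ioo a b → f x = g x) :
    gagliardo θ a b f = gagliardo θ a b g := by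
  have h' := (ae_restrict_iff' measurableSet_Ioo).2 h
  unfold gagliardo
  congr 1
  refine lintegral_congr_ae ?_
  filter_upwards [h'] with x hx
  refine lintegral_congr_ae ?_
  filter_upwards [h'] with y hy
  rw [hx, hy]

theorem ae_mem_prod_Ioo : ∀ᵐ z ∂((volume.restrict (Ioo a b)).prod (volume.restrict (Ioo a b))),
    z.1 ∈ Ioo a b ∧ z.2 ∈ Ioo a b := by
  rw [Measure.prod_restrict]
  exact ae_restrict_mem (measurableSet_Ioo.prod measurableSet_Ioo)

theorem gagliardo_add_le (hf : AEMeasurable f (volume.restrict (Ioo a b)))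
    (hg : AEMeasurable g (volume.restrict (Ioo a b))) :
    gagliardo θ a b (fun x => f x + g x) ≤ gagliardo θ a b f + gagliardo θ a b g := by
  rw [gagliardo_eq_eLpNorm hf, gagliardo_eq_eLpNorm hg,
    gagliardo_eq_eLpNorm (g := fun x => f x + g x) (hf.add hg)]
  refine le_trans (le_of_eq ?_) (eLpNorm_add_le (aemeasurable_diffQuot hf).aestronglyMeasurable
    (aemeasurable_diffQuot hg).aestronglyMeasurable (by norm_num))
  congr 1
  ext z
  simp only [diffQuot, Pi.add_apply]
  ring

theorem gagliardo_sub_le (hf : AEMeasurable f (volume.restrict (Ioo a b)))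
    (hg : AEMeasurable g (volume.restrict (Ioo a b))) :
    gagliardo θ a b (fun x => f x - g x) ≤ gagliardo θ a b f + gagliardo θ a b g := by
  rw [gagliardo_eq_eLpNorm hf, gagliardo_eq_eLpNorm hg,
    gagliardo_eq_eLpNorm (g := fun x => f x - g x) (hf.sub hg)]
  refine le_trans (le_of_eq ?_) (eLpNorm_sub_le (aemeasurable_diffQuot hf).aestronglyMeasurable
    (aemeasurable_diffQuot hg).aestronglyMeasurable (by norm_num))
  congr 1
  ext z
  simp only [diffQuot, Pi.sub_apply]
  ring

theorem gagliardo_sub_const (c : ℝ) :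
    gagliardo θ a b (fun x => g x - c) = gagliardo θ a b g := by
  simp [gagliardo]

/-- Distances in the interval are at most `b - a`, so the excess power `θ - θ'` of `|x - y|` can be
traded for that of `b - a`. -/
theorem gagliardo_le_of_le {θ' : ℝ} (h : θ' ≤ θ) (hg : AEMeasurable g (volume.restrict (Ioo a b))) :
    gagliardo θ' a b g ≤ ENNReal.ofReal ((b - a) ^ (θ - θ')) * gagliardo θ a b g := by
  rw [gagliardo_eq_eLpNorm hg, gagliardo_eq_eLpNorm hg]
  refine eLpNorm_le_mul_eLpNorm_of_ae_le_mul ?_ _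
  filter_upwards [ae_mem_prod_Ioo] with z hz
  rcases eq_or_ne z.1 z.2 with h0 | h0
  · simp [diffQuot, h0]
  have hpos : 0 < |z.1 - z.2| := abs_pos.2 (sub_ne_zero.2 h0)
  have hle : |z.1 - z.2| ≤ b - a := by
    rw [abs_le]; constructor <;> linarith [hz.1.1, hz.1.2, hz.2.1, hz.2.2]
  simp only [diffQuot, norm_div, Real.norm_eq_abs, abs_of_nonneg (Real.rpow_nonneg (abs_nonneg _) _)]
  have e : |z.1 - z.2| ^ (1 / 2 + θ) = |z.1 - z.2| ^ (1 / 2 + θ') * |z.1 - z.2| ^ (θ - θ') := by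
    rw [← Real.rpow_add hpos]; congr 1; ring
  have h1 : |z.1 - z.2| ^ (θ - θ') ≤ (b - a) ^ (θ - θ') :=
    Real.rpow_le_rpow hpos.le hle (by linarith)
  have h2 := Real.rpow_pos_of_pos hpos (θ - θ')
  have h3 := Real.rpow_pos_of_pos hpos (1 / 2 + θ')
  rw [e, mul_div_assoc', div_le_div_iff₀ h3 (by positivity)]
  calc |g z.1 - g z.2| * (|z.1 - z.2| ^ (1 / 2 + θ') * |z.1 - z.2| ^ (θ - θ'))
      ≤ |g z.1 - g z.2| * (|z.1 - z.2| ^ (1 / 2 + θ') * (b - a) ^ (θ - θ')) := by gcongr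
    _ = _ := by ring

/-- The inequality of Cauchy and Schwarz for the integral over `(x, y)`. -/
theorem enorm_intervalIntegral_sq_le {x y : ℝ} (hxy : x ≤ y)
    (hf : AEStronglyMeasurable f (volume.restrict (Ioo x y))) :
    ‖∫ t in x..y, f t‖ₑ ^ (2 : ℝ) ≤
      ENNReal.ofReal (y - x) * ∫⁻ t in Ioo x y, ‖f t‖ₑ ^ (2 : ℝ) := by
  rw [intervalIntegral.integral_of_le hxy, integral_Ioc_eq_integral_Ioo]
  have h1 : ‖∫ t in Ioo x y, f t‖ₑ ≤ eLpNorm f 1 (volume.restrict (Ioo x y)) := by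
    rw [eLpNorm_one_eq_lintegral_enorm]
    exact enorm_integral_le_lintegral_enorm _
  have h2 := eLpNorm_le_eLpNorm_mul_rpow_measure_univ (p := 1) (q := 2) (by norm_num) hf
  have h3 := ENNReal.rpow_le_rpow (h1.trans h2) (by norm_num : (0 : ℝ) ≤ 2)
  refine h3.trans (le_of_eq ?_)
  rw [ENNReal.mul_rpow_of_nonneg _ _ (by norm_num), eLpNorm_two_eq, ← ENNReal.rpow_mul,
    ← ENNReal.rpow_mul, Measure.restrict_apply_univ, Real.volume_Ioo, mul_comm]
  norm_num

/-- A constant for the embedding of `H¹` into the space with the Gagliardo seminorm. -/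
noncomputable def embConst (θ : ℝ) : ℝ := 2 / (1 - θ)

theorem embConst_pos (h : θ < 1) : 0 < embConst θ := div_pos (by norm_num) (by linarith)

/-- Cauchy–Schwarz bounds `|F x - F y|²` by `|x - y|` times the integral of `|f|²` between `x` and
`y`, which leaves the kernel `|x - y|^(-2θ)`. For `t` between `x` and `y` this is at most `|x -
t|^(-θ) |y - t|^(-θ)`. The kernel now factors, and Tonelli integrates out `y` and `x` separately;
both integrals converge since `θ < 1`. -/
theorem gagliardo_le_eLpNorm_deriv (hθ : 0 < θ) (hθ1 : θ < 1) (h : IsPrim a b F f) :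
    gagliardo θ a b F ≤ ENNReal.ofReal (embConst θ * (b - a) ^ (1 - θ)) *
      eLpNorm f 2 (volume.restrict (Ioo a b)) := by
  set μ := volume.restrict (Ioo a b) with hμ
  have hfm : AEMeasurable f μ := h.1.aemeasurable
  set k : ℝ → ℝ → ENNReal := fun t x => ENNReal.ofReal (|x - t| ^ (-θ)) with hk
  have hkm : ∀ p : ℝ × ℝ → ℝ, ∀ q : ℝ × ℝ → ℝ, Measurable p → Measurable q →
      Measurable fun z => k (p z) (q z) := fun p q hp hq => by
    simp only [hk]; fun_prop
  have hkm1 : ∀ t, Measurable (k t) := fun t => by simp only [hk]; fun_prop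
  have hkm2 : ∀ x, Measurable fun t => k t x := fun t => by simp only [hk]; fun_prop
  have hmf : AEMeasurable (fun t => ‖f t‖ₑ ^ (2 : ℝ)) μ := hfm.enorm.pow_const _
  have hpt : ∀ x ∈ Ioo a b, ∀ y ∈ Ioo a b,
      ENNReal.ofReal (|F x - F y| ^ 2 / |x - y| ^ (1 + 2 * θ)) ≤
        ∫⁻ t, k t x * (k t y * ‖f t‖ₑ ^ (2 : ℝ)) ∂μ := by
    have main : ∀ x ∈ Ioo a b, ∀ y ∈ Ioo a b, x < y →
        ENNReal.ofReal (|F x - F y| ^ 2 / |x - y| ^ (1 + 2 * θ)) ≤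
          ∫⁻ t, k t x * (k t y * ‖f t‖ₑ ^ (2 : ℝ)) ∂μ := by
      intro x hx y hy hxy
      have hyx : 0 < y - x := by linarith
      have hsub : Ioo x y ⊆ Ioo a b := Ioo_subset_Ioo hx.1.le hy.2.le
      have h1 := enorm_intervalIntegral_sq_le (f := f) hxy.le
        (h.1.mono_set hsub).aestronglyMeasurable
      rw [← h.sub_eq (Ioo_subset_Icc_self hx) (Ioo_subset_Icc_self hy)] at h1
      have e1 : ENNReal.ofReal (|F x - F y| ^ 2 / |x - y| ^ (1 + 2 * θ)) =
          ENNReal.ofReal ((y - x) ^ (-(1 + 2 * θ))) * ‖F y - F x‖ₑ ^ (2 : ℝ) := by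
        rw [← ofReal_norm, ENNReal.ofReal_rpow_of_nonneg (norm_nonneg _) (by norm_num),
          ← ENNReal.ofReal_mul (Real.rpow_nonneg hyx.le _), Real.rpow_neg hyx.le, abs_sub_comm (F x),
          abs_sub_comm x, abs_of_pos hyx, Real.rpow_two, Real.norm_eq_abs, div_eq_mul_inv, mul_comm]
      have e2 : ENNReal.ofReal ((y - x) ^ (-(1 + 2 * θ))) * ENNReal.ofReal (y - x) =
          ENNReal.ofReal ((y - x) ^ (-(2 * θ))) := by
        rw [← ENNReal.ofReal_mul (Real.rpow_nonneg hyx.le _)]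
        congr 1
        nth_rewrite 2 [← Real.rpow_one (y - x)]
        rw [← Real.rpow_add hyx]; congr 1; ring
      rw [e1]
      calc _ ≤ ENNReal.ofReal ((y - x) ^ (-(1 + 2 * θ))) *
            (ENNReal.ofReal (y - x) * ∫⁻ t in Ioo x y, ‖f t‖ₑ ^ (2 : ℝ)) := by gcongr
        _ = ENNReal.ofReal ((y - x) ^ (-(2 * θ))) * ∫⁻ t in Ioo x y, ‖f t‖ₑ ^ (2 : ℝ) := by
            rw [← mul_assoc, e2]
        _ = ∫⁻ t in Ioo x y, ENNReal.ofReal ((y - x) ^ (-(2 * θ))) * ‖f t‖ₑ ^ (2 : ℝ) := by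
            rw [lintegral_const_mul' _ _ ENNReal.ofReal_ne_top]
        _ ≤ ∫⁻ t in Ioo x y, k t x * (k t y * ‖f t‖ₑ ^ (2 : ℝ)) := by
            refine setLIntegral_mono' measurableSet_Ioo fun t ht => ?_
            rw [← mul_assoc]
            gcongr
            simp only [hk]
            rw [← ENNReal.ofReal_mul (Real.rpow_nonneg (abs_nonneg _) _)]
            refine ENNReal.ofReal_le_ofReal ?_
            have hy1 : 0 < |y - t| := abs_pos.2 (by linarith [ht.2])
            have hx1 : 0 < |x - t| := abs_pos.2 (by linarith [ht.1])
            rw [show -(2 * θ) = -θ + -θ by ring, Real.rpow_add hyx]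
            have hx2 : |x - t| ≤ y - x := by
              rw [abs_le]; constructor <;> linarith [ht.1, ht.2]
            have hy2 : |y - t| ≤ y - x := by
              rw [abs_le]; constructor <;> linarith [ht.1, ht.2]
            exact mul_le_mul (Real.rpow_le_rpow_of_nonpos hx1 hx2 (by linarith))
              (Real.rpow_le_rpow_of_nonpos hy1 hy2 (by linarith)) (by positivity) (by positivity)
        _ ≤ _ := lintegral_mono_set hsub
    intro x hx y hy
    rcases lt_trichotomy x y with hxy | rfl | hxy
    · exact main x hx y hy hxy
    · simp
    · have := main y hy x hx hxy
      rw [abs_sub_comm (F y), abs_sub_comm y] at this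
      refine this.trans (le_of_eq (lintegral_congr fun t => ?_))
      ring
  set c := ENNReal.ofReal (embConst θ * (b - a) ^ (1 - θ)) with hc
  have hkint : ∀ t ∈ Ioo a b, ∫⁻ x, k t x ∂μ ≤ c := by
    intro t ht
    refine (setLIntegral_abs_sub_rpow_le (by linarith) (Ioo_subset_Icc_self ht)).trans
      (le_of_eq ?_)
    rw [hc, embConst, show -θ + 1 = 1 - θ by ring]
    congr 1
    ring
  have hm2 : ∀ x, AEMeasurable (Function.uncurry fun y t => k t x * (k t y * ‖f t‖ₑ ^ (2 : ℝ)))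
      (μ.prod μ) := fun x => by
    refine AEMeasurable.mul ((hkm2 x).comp measurable_snd).aemeasurable (AEMeasurable.mul ?_ ?_)
    · exact (hkm _ _ measurable_snd measurable_fst).aemeasurable
    · exact hmf.comp_snd
  have h2 : ∀ x, ∫⁻ y, ∫⁻ t, k t x * (k t y * ‖f t‖ₑ ^ (2 : ℝ)) ∂μ ∂μ ≤
      ∫⁻ t, k t x * (c * ‖f t‖ₑ ^ (2 : ℝ)) ∂μ := by
    intro x
    rw [lintegral_lintegral_swap (hm2 x)]
    refine setLIntegral_mono' measurableSet_Ioo fun t ht => ?_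
    rw [lintegral_const_mul _ (by fun_prop), lintegral_mul_const _ (hkm1 t)]
    gcongr
    exact hkint t ht
  have h3 : ∫⁻ x, ∫⁻ t, k t x * (c * ‖f t‖ₑ ^ (2 : ℝ)) ∂μ ∂μ ≤
      ∫⁻ t, c * (c * ‖f t‖ₑ ^ (2 : ℝ)) ∂μ := by
    rw [lintegral_lintegral_swap]
    · refine setLIntegral_mono' measurableSet_Ioo fun t ht => ?_
      rw [lintegral_mul_const _ (hkm1 t)]
      gcongr
      exact hkint t ht
    · exact AEMeasurable.mul (hkm _ _ measurable_snd measurable_fst).aemeasurable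
        ((hmf.const_mul c).comp_snd)
  have h4 : ∫⁻ x in Ioo a b, ∫⁻ y in Ioo a b,
      ENNReal.ofReal (|F x - F y| ^ 2 / |x - y| ^ (1 + 2 * θ)) ≤
      c ^ (2 : ℝ) * ∫⁻ t, ‖f t‖ₑ ^ (2 : ℝ) ∂μ := by
    refine (setLIntegral_mono' measurableSet_Ioo fun x hx => ?_).trans (h3.trans (le_of_eq ?_))
    · exact (setLIntegral_mono' measurableSet_Ioo fun y hy => hpt x hx y hy).trans (h2 x)
    · rw [lintegral_const_mul' _ _ ENNReal.ofReal_ne_top,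
        lintegral_const_mul' _ _ ENNReal.ofReal_ne_top, ← mul_assoc, ENNReal.rpow_two, sq]
  refine (ENNReal.rpow_le_rpow h4 (by norm_num : (0 : ℝ) ≤ 1 / 2)).trans (le_of_eq ?_)
  rw [ENNReal.mul_rpow_of_nonneg _ _ (by norm_num), eLpNorm_two_eq, ← ENNReal.rpow_mul]
  norm_num

end Gagliardo

/-! ### Products, changes of variables and the fractional Poincaré inequality. -/

section GagliardoMore

variable {a b c d θ : ℝ} {f g F P φ φ' : ℝ → ℝ}

/-- A constant in the product rule for the Gagliardo seminorm. -/
noncomputable def mulConst (θ : ℝ) : ℝ := (2 / (2 - 2 * θ)) ^ (1 / 2 : ℝ)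

/-- The difference of products is `(f x - f y) P x + f y (P x - P y)`. The first term uses the bound
of `P`; in the second the Lipschitz bound leaves the kernel `|x - y|^(1 - 2θ)`, integrable since `θ
< 1`. -/
theorem gagliardo_mul_le (hθ1 : θ < 1) {K : ℝ} (hK : 0 ≤ K)
    (hf : AEMeasurable f (volume.restrict (Ioo a b)))
    (hP : AEMeasurable P (volume.restrict (Ioo a b)))
    (hPK : ∀ x ∈ Ioo a b, |P x| ≤ K)
    (hPL : ∀ x ∈ Ioo a b, ∀ y ∈ Ioo a b, |P x - P y| ≤ K * |x - y|) :
    gagliardo θ a b (fun x => f x * P x) ≤ ENNReal.ofReal K * gagliardo θ a b f +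
      ENNReal.ofReal (K * mulConst θ * (b - a) ^ (1 - θ)) *
        eLpNorm f 2 (volume.restrict (Ioo a b)) := by
  rcases le_or_gt b a with hab | hab
  · simp [gagliardo, Ioo_eq_empty (not_lt.2 hab)]
  set μ := volume.restrict (Ioo a b) with hμ
  rw [gagliardo_eq_eLpNorm hf, gagliardo_eq_eLpNorm (g := fun x => f x * P x) (hf.mul hP)]
  have hm1 : AEMeasurable (fun z : ℝ × ℝ => diffQuot θ f z * P z.1) (μ.prod μ) :=
    (aemeasurable_diffQuot hf).mul hP.comp_fst
  have hm2 : AEMeasurable (fun z : ℝ × ℝ => f z.2 * diffQuot θ P z) (μ.prod μ) :=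
    hf.comp_snd.mul (aemeasurable_diffQuot hP)
  have e : diffQuot θ (fun x => f x * P x) =
      (fun z => diffQuot θ f z * P z.1) + fun z => f z.2 * diffQuot θ P z := by
    ext z
    simp only [diffQuot, Pi.add_apply]
    ring
  rw [e]
  refine (eLpNorm_add_le hm1.aestronglyMeasurable hm2.aestronglyMeasurable (by norm_num)).trans
    (add_le_add ?_ ?_)
  · refine eLpNorm_le_mul_eLpNorm_of_ae_le_mul ?_ _
    filter_upwards [ae_mem_prod_Ioo] with z hz
    rw [norm_mul, mul_comm]
    exact mul_le_mul_of_nonneg_right (hPK _ hz.1) (norm_nonneg _)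
  · have h1 : eLpNorm (fun z : ℝ × ℝ => f z.2 * diffQuot θ P z) 2 (μ.prod μ) ≤
        ENNReal.ofReal K * eLpNorm (fun z : ℝ × ℝ => |z.1 - z.2| ^ (1 / 2 - θ) * f z.2) 2
          (μ.prod μ) := by
      refine eLpNorm_le_mul_eLpNorm_of_ae_le_mul ?_ _
      filter_upwards [ae_mem_prod_Ioo] with z hz
      rcases eq_or_ne z.1 z.2 with h0 | h0
      · simp only [diffQuot, h0, sub_self, zero_div, mul_zero, norm_zero]
        positivity
      have hpos : 0 < |z.1 - z.2| := abs_pos.2 (sub_ne_zero.2 h0)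
      have e2 : |z.1 - z.2| ^ (1 / 2 - θ) = |z.1 - z.2| / |z.1 - z.2| ^ (1 / 2 + θ) := by
        rw [eq_div_iff (by positivity), ← Real.rpow_add hpos]
        norm_num
      rw [norm_mul, norm_mul, Real.norm_eq_abs, Real.norm_eq_abs, Real.norm_eq_abs, diffQuot,
        abs_div, abs_of_nonneg (Real.rpow_nonneg (abs_nonneg (z.1 - z.2)) (1 / 2 + θ)),
        abs_of_nonneg (Real.rpow_nonneg (abs_nonneg (z.1 - z.2)) (1 / 2 - θ)), e2]
      calc |f z.2| * (|P z.1 - P z.2| / |z.1 - z.2| ^ (1 / 2 + θ))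
          ≤ |f z.2| * ((K * |z.1 - z.2|) / |z.1 - z.2| ^ (1 / 2 + θ)) := by
            gcongr
            exact hPL _ hz.1 _ hz.2
        _ = _ := by ring
    refine h1.trans ?_
    rw [mul_assoc, ENNReal.ofReal_mul hK, mul_assoc]
    gcongr
    rw [eLpNorm_two_eq, eLpNorm_two_eq]
    have h2 : AEMeasurable (fun z : ℝ × ℝ => |z.1 - z.2| ^ (1 / 2 - θ) * f z.2) (μ.prod μ) :=
      AEMeasurable.mul (Measurable.aemeasurable (by fun_prop)) hf.comp_snd
    rw [lintegral_prod_symm _ (h2.enorm.pow_const _)]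
    have h3 : ∫⁻ y, ∫⁻ x, ‖|x - y| ^ (1 / 2 - θ) * f y‖ₑ ^ (2 : ℝ) ∂μ ∂μ ≤
        ENNReal.ofReal (2 * (b - a) ^ (1 - 2 * θ + 1) / (1 - 2 * θ + 1)) *
          ∫⁻ y, ‖f y‖ₑ ^ (2 : ℝ) ∂μ := by
      rw [← lintegral_const_mul' _ _ ENNReal.ofReal_ne_top]
      refine setLIntegral_mono' measurableSet_Ioo fun y hy => ?_
      have h4 : ∀ x, ‖|x - y| ^ (1 / 2 - θ) * f y‖ₑ ^ (2 : ℝ) =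
          ENNReal.ofReal (|x - y| ^ (1 - 2 * θ)) * ‖f y‖ₑ ^ (2 : ℝ) := by
        intro x
        rw [enorm_mul, ENNReal.mul_rpow_of_nonneg _ _ (by norm_num), Real.enorm_of_nonneg
          (by positivity), ENNReal.ofReal_rpow_of_nonneg (by positivity) (by norm_num),
          ← Real.rpow_mul (abs_nonneg _)]
        congr 3
        ring
      simp_rw [h4]
      rw [lintegral_mul_const _ (by fun_prop)]
      gcongr
      exact setLIntegral_abs_sub_rpow_le (by linarith) (Ioo_subset_Icc_self hy)
    refine (ENNReal.rpow_le_rpow h3 (by norm_num)).trans (le_of_eq ?_)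
    have hba : 0 < b - a := by linarith
    have h22 : 0 < 2 - 2 * θ := by linarith
    rw [ENNReal.mul_rpow_of_nonneg _ _ (by norm_num), ENNReal.ofReal_rpow_of_nonneg
      (div_nonneg (by positivity) (by linarith)) (by norm_num)]
    congr 2
    rw [mulConst, show 1 - 2 * θ + 1 = 2 - 2 * θ by ring, mul_div_right_comm,
      Real.mul_rpow (by positivity) (by positivity), ← Real.rpow_mul hba.le]
    congr 2
    ring

/-- Inserting the factor `M |φ'| ≥ 1` prepares the one-dimensional change of variables. No
measurability of `G` is needed, so it applies to inner integrals. -/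
theorem setLIntegral_comp_le {M : ℝ} (hφ : ∀ x ∈ Ioo c d, HasDerivAt φ (φ' x) x)
    (hM : ∀ x ∈ Ioo c d, 1 ≤ M * |φ' x|) (hinj : InjOn φ (Ioo c d))
    (hmaps : MapsTo φ (Ioo c d) (Ioo a b)) (G : ℝ → ENNReal) :
    ∫⁻ x in Ioo c d, G (φ x) ≤ ENNReal.ofReal M * ∫⁻ y in Ioo a b, G y := by
  calc ∫⁻ x in Ioo c d, G (φ x)
      ≤ ∫⁻ x in Ioo c d, ENNReal.ofReal M * (ENNReal.ofReal |φ' x| * G (φ x)) := by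
        refine setLIntegral_mono' measurableSet_Ioo fun x hx => ?_
        rw [← mul_assoc]
        refine le_mul_of_one_le_left' ?_
        rw [← ENNReal.ofReal_mul' (abs_nonneg _)]
        exact ENNReal.one_le_ofReal.2 (hM x hx)
    _ = ENNReal.ofReal M * ∫⁻ y in φ '' Ioo c d, G y := by
        rw [lintegral_const_mul' _ _ ENNReal.ofReal_ne_top,
          lintegral_image_eq_lintegral_abs_deriv_mul measurableSet_Ioo
            (fun x hx => (hφ x hx).hasDerivWithinAt) hinj]
    _ ≤ _ := by
        gcongr
        exact hmaps.image_subset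

/-- The point is that `φ` pulls null sets back to null sets, which follows from the change of
variables bound for the indicator of a measurable null set. -/
theorem aemeasurable_comp {M : ℝ} (hφ : ∀ x ∈ Ioo c d, HasDerivAt φ (φ' x) x)
    (hM : ∀ x ∈ Ioo c d, 1 ≤ M * |φ' x|) (hinj : InjOn φ (Ioo c d))
    (hmaps : MapsTo φ (Ioo c d) (Ioo a b)) (hf : AEMeasurable f (volume.restrict (Ioo a b))) :
    AEMeasurable (fun x => f (φ x)) (volume.restrict (Ioo c d)) := by
  have hφm : AEMeasurable φ (volume.restrict (Ioo c d)) :=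
    ContinuousOn.aemeasurable (fun x hx => (hφ x hx).continuousAt.continuousWithinAt)
      measurableSet_Ioo
  refine ⟨fun x => hf.mk f (hφm.mk φ x), hf.measurable_mk.comp hφm.measurable_mk, ?_⟩
  have h1 : ∀ᵐ x ∂(volume.restrict (Ioo c d)), f (φ x) = hf.mk f (φ x) := by
    have h2 := setLIntegral_comp_le hφ hM hinj hmaps
      ((toMeasurable (volume.restrict (Ioo a b)) {y | f y ≠ hf.mk f y}).indicator 1)
    rw [lintegral_indicator (measurableSet_toMeasurable _ _)] at h2
    have h3 : volume.restrict (Ioo a b) {y | f y ≠ hf.mk f y} = 0 := ae_iff.1 hf.ae_eq_mk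
    simp only [Pi.one_apply, lintegral_const, Measure.restrict_apply_univ,
      measure_toMeasurable, h3, mul_zero, nonpos_iff_eq_zero] at h2
    set T := toMeasurable (volume.restrict (Ioo a b)) {y | f y ≠ hf.mk f y} with hT
    have h4 : ∫⁻ x in Ioo c d, T.indicator 1 (hφm.mk φ x) = 0 := by
      rw [← h2]
      refine lintegral_congr_ae ?_
      filter_upwards [hφm.ae_eq_mk] with x hx
      rw [hx]
    have h5 : Measurable fun x => T.indicator (1 : ℝ → ENNReal) (hφm.mk φ x) :=
      (measurable_one.indicator (measurableSet_toMeasurable _ _)).comp hφm.measurable_mk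
    rw [lintegral_eq_zero_iff h5] at h4
    filter_upwards [h4, hφm.ae_eq_mk] with x hx hx'
    by_contra hne
    have : φ x ∈ T := subset_toMeasurable _ _ hne
    rw [← hx', indicator_of_mem this] at hx
    exact one_ne_zero hx
  filter_upwards [h1, hφm.ae_eq_mk] with x hx hx'
  rw [hx, hx']

theorem eLpNorm_comp_le {M : ℝ} (hφ : ∀ x ∈ Ioo c d, HasDerivAt φ (φ' x) x)
    (hM : ∀ x ∈ Ioo c d, 1 ≤ M * |φ' x|) (hM0 : 1 ≤ M) (hinj : InjOn φ (Ioo c d))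
    (hmaps : MapsTo φ (Ioo c d) (Ioo a b)) (f : ℝ → ℝ) :
    eLpNorm (fun x => f (φ x)) 2 (volume.restrict (Ioo c d)) ≤
      ENNReal.ofReal M * eLpNorm f 2 (volume.restrict (Ioo a b)) := by
  rw [eLpNorm_two_eq, eLpNorm_two_eq]
  have h1 := setLIntegral_comp_le hφ hM hinj hmaps (fun y => ‖f y‖ₑ ^ (2 : ℝ))
  refine (ENNReal.rpow_le_rpow h1 (by norm_num)).trans ?_
  rw [ENNReal.mul_rpow_of_nonneg _ _ (by norm_num)]
  gcongr
  -- The factor `M^(1/2)` of the change of variables is weakened to `M`.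
  exact (ENNReal.rpow_le_rpow_of_exponent_le (ENNReal.one_le_ofReal.2 hM0)
    (by norm_num : (1 / 2 : ℝ) ≤ 1)).trans (ENNReal.rpow_one _).le

/-- The Lipschitz bound replaces `|x - y|` by `|φ x - φ y|` in the kernel at the cost `M^(1 + 2θ)`,
and each of the two changes of variables costs `M`. The product is at most `M^6`, hence `M^3` after
the square root. -/
theorem gagliardo_comp_le {M : ℝ} (hθ : 0 < θ) (hθ1 : θ < 1)
    (hφ : ∀ x ∈ Ioo c d, HasDerivAt φ (φ' x) x)
    (hM : ∀ x ∈ Ioo c d, 1 ≤ M * |φ' x|) (hM0 : 1 ≤ M) (hinj : InjOn φ (Ioo c d))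
    (hmaps : MapsTo φ (Ioo c d) (Ioo a b))
    (hlip : ∀ x ∈ Ioo c d, ∀ y ∈ Ioo c d, |φ x - φ y| ≤ M * |x - y|) (f : ℝ → ℝ) :
    gagliardo θ c d (fun x => f (φ x)) ≤ ENNReal.ofReal (M ^ 3) * gagliardo θ a b f := by
  have hM' : (1 : ENNReal) ≤ ENNReal.ofReal M := ENNReal.one_le_ofReal.2 hM0
  set K : ℝ → ℝ → ENNReal := fun u v =>
    ENNReal.ofReal (|f u - f v| ^ 2 / |u - v| ^ (1 + 2 * θ)) with hK
  have h1 : ∀ x ∈ Ioo c d, ∀ y ∈ Ioo c d,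
      ENNReal.ofReal (|f (φ x) - f (φ y)| ^ 2 / |x - y| ^ (1 + 2 * θ)) ≤
        ENNReal.ofReal (M ^ (1 + 2 * θ)) * K (φ x) (φ y) := by
    intro x hx y hy
    rw [hK, ← ENNReal.ofReal_mul (by positivity)]
    refine ENNReal.ofReal_le_ofReal ?_
    rcases eq_or_ne x y with rfl | hxy
    · simp
    have hpos : 0 < |x - y| := abs_pos.2 (sub_ne_zero.2 hxy)
    have hpos' : 0 < |φ x - φ y| := abs_pos.2 (sub_ne_zero.2 fun h => hxy (hinj hx hy h))
    have h2 : |φ x - φ y| ^ (1 + 2 * θ) ≤ M ^ (1 + 2 * θ) * |x - y| ^ (1 + 2 * θ) := by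
      rw [← Real.mul_rpow (by linarith) hpos.le]
      exact Real.rpow_le_rpow hpos'.le (hlip x hx y hy) (by linarith)
    rw [mul_div_assoc', div_le_div_iff₀ (by positivity) (by positivity)]
    calc |f (φ x) - f (φ y)| ^ 2 * |φ x - φ y| ^ (1 + 2 * θ)
        ≤ |f (φ x) - f (φ y)| ^ 2 * (M ^ (1 + 2 * θ) * |x - y| ^ (1 + 2 * θ)) := by gcongr
      _ = _ := by ring
  have h2 : ∫⁻ x in Ioo c d, ∫⁻ y in Ioo c d,
      ENNReal.ofReal (|f (φ x) - f (φ y)| ^ 2 / |x - y| ^ (1 + 2 * θ)) ≤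
      ENNReal.ofReal (M ^ 3) ^ (2 : ℝ) * ∫⁻ u in Ioo a b, ∫⁻ v in Ioo a b, K u v := by
    calc _ ≤ ∫⁻ x in Ioo c d, ∫⁻ y in Ioo c d,
          ENNReal.ofReal (M ^ (1 + 2 * θ)) * K (φ x) (φ y) :=
          setLIntegral_mono' measurableSet_Ioo fun x hx =>
            setLIntegral_mono' measurableSet_Ioo fun y hy => h1 x hx y hy
      _ = ENNReal.ofReal (M ^ (1 + 2 * θ)) *
          ∫⁻ x in Ioo c d, ∫⁻ y in Ioo c d, K (φ x) (φ y) := by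
          simp_rw [lintegral_const_mul' _ _ ENNReal.ofReal_ne_top]
      _ ≤ ENNReal.ofReal (M ^ (1 + 2 * θ)) *
          ∫⁻ x in Ioo c d, ENNReal.ofReal M * ∫⁻ v in Ioo a b, K (φ x) v := by
          gcongr with x
          exact setLIntegral_comp_le hφ hM hinj hmaps _
      _ ≤ ENNReal.ofReal (M ^ (1 + 2 * θ)) * (ENNReal.ofReal M *
          (ENNReal.ofReal M * ∫⁻ u in Ioo a b, ∫⁻ v in Ioo a b, K u v)) := by
          rw [lintegral_const_mul' _ _ ENNReal.ofReal_ne_top]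
          gcongr
          exact setLIntegral_comp_le hφ hM hinj hmaps (fun u => ∫⁻ v in Ioo a b, K u v)
      _ ≤ _ := by
          rw [← mul_assoc, ← mul_assoc]
          gcongr
          rw [← ENNReal.ofReal_mul (by positivity), ← ENNReal.ofReal_mul (by positivity),
            ENNReal.ofReal_rpow_of_nonneg (by positivity) (by norm_num)]
          refine ENNReal.ofReal_le_ofReal ?_
          have h3 : M ^ (1 + 2 * θ) ≤ M ^ (3 : ℝ) :=
            Real.rpow_le_rpow_of_exponent_le hM0 (by linarith)
          have h4 : M ^ (3 : ℝ) = M ^ 3 := by norm_cast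
          rw [h4] at h3
          rw [Real.rpow_two]
          calc M ^ (1 + 2 * θ) * M * M ≤ M ^ 3 * M * M := by gcongr
            _ ≤ M ^ 3 * M * M * M := le_mul_of_one_le_right (by positivity) hM0
            _ = _ := by ring
  refine (ENNReal.rpow_le_rpow h2 (by norm_num : (0 : ℝ) ≤ 1 / 2)).trans (le_of_eq ?_)
  rw [ENNReal.mul_rpow_of_nonneg _ _ (by norm_num), ← ENNReal.rpow_mul]
  norm_num
  rfl

/-- The inequality of Poincaré in the fractional case. -/
theorem eLpNorm_sub_average_le (hab : a < b) (hθ : 0 < θ)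
    (hf : IntegrableOn f (Ioo a b)) :
    eLpNorm (fun x => f x - (b - a)⁻¹ * ∫ t in Ioo a b, f t) 2 (volume.restrict (Ioo a b)) ≤
      ENNReal.ofReal ((b - a) ^ θ) * gagliardo θ a b f := by
  have hL : 0 < b - a := by linarith
  set μ := volume.restrict (Ioo a b) with hμ
  have hμu : μ univ = ENNReal.ofReal (b - a) := by
    rw [hμ, Measure.restrict_apply_univ, Real.volume_Ioo]
  have hfin : IsFiniteMeasure μ := ⟨by rw [hμu]; exact ENNReal.ofReal_lt_top⟩
  have h1 : ∀ x, ‖f x - (b - a)⁻¹ * ∫ t, f t ∂μ‖ₑ ^ (2 : ℝ) ≤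
      ENNReal.ofReal ((b - a)⁻¹) * ∫⁻ y, ‖f x - f y‖ₑ ^ (2 : ℝ) ∂μ := by
    intro x
    -- Subtracting the mean is averaging the differences `f x - f t`, to which Cauchy–Schwarz
    -- applies.
    have e1 : f x - (b - a)⁻¹ * ∫ t, f t ∂μ = (b - a)⁻¹ * ∫ t, (f x - f t) ∂μ := by
      rw [integral_sub (integrable_const _) hf, integral_const, measureReal_def, hμu,
        ENNReal.toReal_ofReal hL.le, smul_eq_mul]
      field_simp
      rfl
    have h2 := enorm_intervalIntegral_sq_le (f := fun t => f x - f t) hab.le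
      (aestronglyMeasurable_const.sub hf.aestronglyMeasurable)
    rw [intervalIntegral.integral_of_le hab.le, integral_Ioc_eq_integral_Ioo] at h2
    rw [e1, enorm_mul, ENNReal.mul_rpow_of_nonneg _ _ (by norm_num),
      Real.enorm_of_nonneg (by positivity)]
    calc _ ≤ ENNReal.ofReal ((b - a)⁻¹) ^ (2 : ℝ) *
          (ENNReal.ofReal (b - a) * ∫⁻ t in Ioo a b, ‖f x - f t‖ₑ ^ (2 : ℝ)) := by gcongr
      _ = _ := by
        rw [← mul_assoc, ENNReal.ofReal_rpow_of_nonneg (by positivity) (by norm_num),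
          ← ENNReal.ofReal_mul (by positivity)]
        congr 2
        rw [Real.rpow_two]
        field_simp
  have h3 : ∫⁻ x, ‖f x - (b - a)⁻¹ * ∫ t, f t ∂μ‖ₑ ^ (2 : ℝ) ∂μ ≤
      ENNReal.ofReal ((b - a) ^ θ) ^ (2 : ℝ) * ∫⁻ x, ∫⁻ y,
        ENNReal.ofReal (|f x - f y| ^ 2 / |x - y| ^ (1 + 2 * θ)) ∂μ ∂μ := by
    rw [← lintegral_const_mul' _ _ (by simp)]
    refine setLIntegral_mono' measurableSet_Ioo fun x hx => (h1 x).trans ?_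
    rw [← lintegral_const_mul' _ _ ENNReal.ofReal_ne_top,
      ← lintegral_const_mul' _ _ (by simp)]
    refine setLIntegral_mono' measurableSet_Ioo fun y hy => ?_
    rcases eq_or_ne x y with rfl | hxy
    · simp
    have hpos : 0 < |x - y| := abs_pos.2 (sub_ne_zero.2 hxy)
    have hle : |x - y| ≤ b - a := by
      rw [abs_le]; constructor <;> linarith [hx.1, hx.2, hy.1, hy.2]
    rw [← ofReal_norm, ENNReal.ofReal_rpow_of_nonneg (norm_nonneg _) (by norm_num),
      ENNReal.ofReal_rpow_of_nonneg (by positivity) (by norm_num),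
      ← ENNReal.ofReal_mul (by positivity), ← ENNReal.ofReal_mul (by positivity)]
    refine ENNReal.ofReal_le_ofReal ?_
    rw [Real.rpow_two, Real.norm_eq_abs, ← Real.rpow_mul hL.le, mul_div_assoc', inv_mul_eq_div,
      div_le_div_iff₀ hL (by positivity)]
    -- Since `|x - y| ≤ b - a`, the Gagliardo kernel can be inserted; one power of `b - a` cancels
    -- the averaging factor.
    have h4 : |x - y| ^ (1 + 2 * θ) ≤ (b - a) ^ (θ * 2) * (b - a) := by
      calc |x - y| ^ (1 + 2 * θ) ≤ (b - a) ^ (1 + 2 * θ) :=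
            Real.rpow_le_rpow hpos.le hle (by linarith)
        _ = _ := by
            rw [← Real.rpow_add_one hL.ne']; congr 1; ring
    calc |f x - f y| ^ 2 * |x - y| ^ (1 + 2 * θ)
        ≤ |f x - f y| ^ 2 * ((b - a) ^ (θ * 2) * (b - a)) := by gcongr
      _ = _ := by ring
  rw [eLpNorm_two_eq]
  refine (ENNReal.rpow_le_rpow h3 (by norm_num)).trans (le_of_eq ?_)
  rw [ENNReal.mul_rpow_of_nonneg _ _ (by norm_num), ← ENNReal.rpow_mul,
    show (2 : ℝ) * (1 / 2) = 1 by norm_num, ENNReal.rpow_one]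
  rfl

end GagliardoMore

/-! ## Sobolev seminorms in terms of weak derivatives -/

section Seminorm

variable {a b r : ℝ} {f f' g : ℝ → ℝ}

theorem hSeminorm_eq (h : IsWeakDeriv ⌊r⌋₊ a b f g) :
    hSeminorm r a b f = if Int.fract r = 0 then eLpNorm g 2 (volume.restrict (Ioo a b))
      else gagliardo (Int.fract r) a b g := by
  refine le_antisymm (iInf₂_le g h) (le_iInf₂ fun g' h' => le_of_eq ?_)
  have h1 := h.ae_eq h'
  split_ifs
  · exact eLpNorm_congr_ae ((ae_restrict_iff' measurableSet_Ioo).2 h1)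
  · exact gagliardo_congr h1

theorem hSeminorm_natCast_eq {j : ℕ} (h : IsWeakDeriv j a b f g) :
    hSeminorm (j : ℝ) a b f = eLpNorm g 2 (volume.restrict (Ioo a b)) := by
  rw [hSeminorm_eq (g := g) (by rwa [Nat.floor_natCast])]
  simp

theorem hSeminorm_congr (h : ∀ x ∈ Ioo a b, f' x = f x) :
    hSeminorm r a b f' = hSeminorm r a b f := by
  have : ∀ g, IsWeakDeriv ⌊r⌋₊ a b f' g ↔ IsWeakDeriv ⌊r⌋₊ a b f g := fun g =>
    ⟨fun H => H.congr (ae_of_all _ fun x hx => (h x hx).symm) (by simp),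
      fun H => H.congr (ae_of_all _ h) (by simp)⟩
  simp only [hSeminorm, this]

theorem hNorm_congr (h : ∀ x ∈ Ioo a b, f' x = f x) : hNorm r a b f' = hNorm r a b f := by
  simp only [hNorm, hSeminorm_congr h]

theorem le_hNorm_of_sq_le {x : ENNReal} (h : x ^ 2 ≤
    (∑ j ∈ Finset.range (⌊r⌋₊ + 1), hSeminorm (j : ℝ) a b f ^ 2) +
    (if Int.fract r = 0 then 0 else hSeminorm r a b f ^ 2)) : x ≤ hNorm r a b f := by
  have := ENNReal.rpow_le_rpow h (by norm_num : (0 : ℝ) ≤ 1 / 2)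
  rw [← ENNReal.rpow_natCast, ← ENNReal.rpow_mul] at this
  norm_num at this
  simpa [hNorm] using this

theorem hSeminorm_natCast_le_hNorm {j : ℕ} (hj : j ≤ ⌊r⌋₊) :
    hSeminorm (j : ℝ) a b f ≤ hNorm r a b f := by
  refine le_hNorm_of_sq_le (le_add_right ?_)
  exact Finset.single_le_sum (f := fun j : ℕ => hSeminorm (j : ℝ) a b f ^ 2)
    (fun _ _ => zero_le) (Finset.mem_range.2 (Nat.lt_succ_of_le hj))

theorem hSeminorm_le_hNorm (hr : 0 ≤ r) : hSeminorm r a b f ≤ hNorm r a b f := by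
  by_cases h : Int.fract r = 0
  · have h1 : ((⌊r⌋₊ : ℕ) : ℝ) = r := by
      rw [natCast_floor_eq_intCast_floor hr]
      have := Int.self_sub_floor r
      linarith
    have := hSeminorm_natCast_le_hNorm (a := a) (b := b) (f := f) (r := r) (j := ⌊r⌋₊) le_rfl
    rwa [h1] at this
  · refine le_hNorm_of_sq_le (le_add_left ?_)
    rw [if_neg h]

/-- At most `⌊r⌋₊ + 2` squares are summed; the square root of this number would do, and the number
itself is larger. -/
theorem hNorm_le {S : ENNReal} (h1 : ∀ j ≤ ⌊r⌋₊, hSeminorm (j : ℝ) a b f ≤ S)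
    (h2 : Int.fract r ≠ 0 → hSeminorm r a b f ≤ S) :
    hNorm r a b f ≤ ENNReal.ofReal (⌊r⌋₊ + 2) * S := by
  have h3 : (∑ j ∈ Finset.range (⌊r⌋₊ + 1), hSeminorm (j : ℝ) a b f ^ 2) +
      (if Int.fract r = 0 then 0 else hSeminorm r a b f ^ 2) ≤
      (ENNReal.ofReal (⌊r⌋₊ + 2) * S) ^ (2 : ℝ) := by
    have e1 : ∑ j ∈ Finset.range (⌊r⌋₊ + 1), hSeminorm (j : ℝ) a b f ^ 2 ≤
        ((⌊r⌋₊ + 1 : ℕ) : ENNReal) * S ^ 2 := by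
      refine (Finset.sum_le_card_nsmul _ _ (S ^ 2) fun j hj => ?_).trans (by simp)
      gcongr
      exact h1 j (Nat.le_of_lt_succ (Finset.mem_range.1 hj))
    have e2 : (if Int.fract r = 0 then 0 else hSeminorm r a b f ^ 2) ≤ S ^ 2 := by
      split_ifs with h
      · exact zero_le
      · gcongr
        exact h2 h
    refine (add_le_add e1 e2).trans ?_
    have e3 : ENNReal.ofReal (⌊r⌋₊ + 2) = ((⌊r⌋₊ + 2 : ℕ) : ENNReal) := by
      rw [← ENNReal.ofReal_natCast]; congr 1; push_cast; rfl
    rw [e3, ENNReal.mul_rpow_of_nonneg _ _ (by norm_num), ENNReal.rpow_two, ENNReal.rpow_two]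
    calc ((⌊r⌋₊ + 1 : ℕ) : ENNReal) * S ^ 2 + S ^ 2 = ((⌊r⌋₊ + 2 : ℕ) : ENNReal) * S ^ 2 := by
          push_cast; ring
      _ ≤ _ := by
          gcongr
          norm_cast
          nlinarith
  refine (ENNReal.rpow_le_rpow h3 (by norm_num : (0 : ℝ) ≤ 1 / 2)).trans (le_of_eq ?_)
  rw [← ENNReal.rpow_mul]
  norm_num

/-- A continuous function of finite Sobolev norm is an iterated primitive. -/
theorem exists_chain_of_hNorm_lt_top (hab : a < b) (hf : ContinuousOn f (Icc a b))
    (h : hNorm r a b f < ⊤) :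
    ∃ F : ℕ → ℝ → ℝ, EqOn (F 0) f (Icc a b) ∧ (∀ j < ⌊r⌋₊, IsPrim a b (F j) (F (j + 1))) ∧
      ∀ j ≤ ⌊r⌋₊, IsWeakDeriv j a b f (F j) ∧ MemLp (F j) 2 (volume.restrict (Ioo a b)) := by
  have h1 : ∀ j, ∃ D, j ≤ ⌊r⌋₊ → IsWeakDeriv j a b f D := by
    intro j
    by_cases hj : j ≤ ⌊r⌋₊
    · have h2 := (hSeminorm_natCast_le_hNorm (a := a) (b := b) (f := f) hj).trans_lt h
      simp only [hSeminorm, iInf_lt_top, Nat.floor_natCast] at h2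
      obtain ⟨D, hD, -⟩ := h2
      exact ⟨D, fun _ => hD⟩
    · exact ⟨0, fun h => absurd h hj⟩
  choose D hD using h1
  have hm : ∀ j ≤ ⌊r⌋₊, ∀ g, IsWeakDeriv j a b f g →
      MemLp g 2 (volume.restrict (Ioo a b)) := fun j hj g hg => by
    refine ⟨hg.2.1.aestronglyMeasurable, ?_⟩
    rw [← hSeminorm_natCast_eq hg]
    exact (hSeminorm_natCast_le_hNorm hj).trans_lt h
  obtain ⟨F, h1, h2, h3⟩ := exists_isPrim_chain hab hf D hD fun j hj =>
    (hm j hj _ (hD j hj)).integrable (by norm_num)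
  exact ⟨F, h1, h2, fun j hj => ⟨h3 j hj, hm j hj _ (h3 j hj)⟩⟩

theorem isWeakDeriv_of_chain {n : ℕ} {F : ℕ → ℝ → ℝ}
    (h : ∀ j < n, IsPrim a b (F j) (F (j + 1))) (hn : LocallyIntegrableOn (F n) (Ioo a b)) :
    ∀ j ≤ n, IsWeakDeriv j a b (F 0) (F j) := by
  -- Each step adds a derivative at the outer end of the chain, so the starting index `i` stays free
  -- in the induction.
  suffices H : ∀ j i, i + j ≤ n → IsWeakDeriv j a b (F i) (F (i + j)) by
    intro j hj
    simpa using H j 0 (by simpa using hj)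
  intro j
  induction j with
  | zero =>
    intro i hi
    refine isWeakDeriv_zero_iff.2 ⟨?_, by simp⟩
    rcases lt_or_eq_of_le hi with hlt | rfl
    · exact (h i hlt).integrableOn_left.locallyIntegrableOn
    · exact hn
  | succ j ih =>
    intro i hi
    have := (ih (i + 1) (by omega)).succ_of_isPrim (h i (by omega))
    rwa [show i + 1 + j = i + (j + 1) by ring] at this

end Seminorm

/-! ## Gauss-Lobatto nodes -/

section Nodes

open Polynomial

/-- Rolle's theorem for a finite set of zeros of a polynomial. -/
theorem exists_roots_derivative_of_roots (p : ℝ[X]) {r : ℕ} (S : Finset ℝ) (hS : S.card = r + 1)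
    (hS0 : ∀ x ∈ S, x ∈ Icc (0 : ℝ) 1) (hp : ∀ x ∈ S, p.eval x = 0) :
    ∃ T : Finset ℝ, T.card = r ∧ (∀ x ∈ T, x ∈ Ioo (0 : ℝ) 1) ∧
      ∀ x ∈ T, p.derivative.eval x = 0 := by
  let x := S.orderEmbOfFin hS
  have hx : ∀ i, x i ∈ S := fun i => S.orderEmbOfFin_mem hS i
  have h1 : ∀ i : Fin r, ∃ y ∈ Ioo (x i.castSucc) (x i.succ), p.derivative.eval y = 0 := by
    intro i
    obtain ⟨y, hy, hy'⟩ := exists_deriv_eq_zero (f := fun t => p.eval t)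
      (x.strictMono (Fin.castSucc_lt_succ (i := i))) p.continuous.continuousOn
      (by rw [hp _ (hx _), hp _ (hx _)])
    exact ⟨y, hy, by rwa [Polynomial.deriv] at hy'⟩
  choose y hy hy' using h1
  have hmono : StrictMono y := by
    intro i j hij
    refine (hy i).2.trans_le (le_trans ?_ (hy j).1.le)
    exact x.monotone (Fin.succ_le_castSucc_iff.2 hij)
  refine ⟨Finset.univ.image y, ?_, ?_, ?_⟩
  · rw [Finset.card_image_of_injective _ hmono.injective, Finset.card_fin]
  · intro t ht
    obtain ⟨i, -, rfl⟩ := Finset.mem_image.1 ht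
    exact ⟨(hS0 _ (hx _)).1.trans_lt (hy i).1, (hy i).2.trans_le (hS0 _ (hx _)).2⟩
  · intro t ht
    obtain ⟨i, -, rfl⟩ := Finset.mem_image.1 ht
    exact hy' i

theorem eval_iterate_derivative_eq_zero {k j : ℕ} (hj : j < k) {x : ℝ} (hx : x = 0 ∨ x = 1) :
    (derivative^[j] (X ^ k * (1 - X) ^ k : ℝ[X])).eval x = 0 := by
  have h1 : (X - C x) ^ k ∣ (X ^ k * (1 - X) ^ k : ℝ[X]) := by
    rcases hx with rfl | rfl
    · simp
    · refine Dvd.dvd.mul_left ?_ _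
      rw [show (1 - X : ℝ[X]) = -(X - C 1) by simp, neg_pow]
      exact dvd_mul_left _ _
  have h2 := pow_sub_dvd_iterate_derivative_of_pow_dvd j h1
  have h3 : (X - C x) ∣ derivative^[j] (X ^ k * (1 - X) ^ k : ℝ[X]) :=
    (dvd_pow_self _ (by omega)).trans h2
  exact dvd_iff_isRoot.1 h3

/-- Below order `k` the derivatives of `X^k (1 - X)^k` still vanish at 0 and 1. With the `j`
interior zeros these make `j + 2` zeros, and Rolle's theorem gives `j + 1` interior zeros of the
next derivative. -/
theorem exists_roots_iterate_derivative (k j : ℕ) (hj : j ≤ k) :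
    ∃ S : Finset ℝ, S.card = j ∧ (∀ x ∈ S, x ∈ Ioo (0 : ℝ) 1) ∧
      ∀ x ∈ S, (derivative^[j] (X ^ k * (1 - X) ^ k : ℝ[X])).eval x = 0 := by
  induction j with
  | zero => exact ⟨∅, by simp⟩
  | succ j ih =>
    obtain ⟨S, h1, h2, h3⟩ := ih (by omega)
    have h1' : (1 : ℝ) ∉ S := fun h => lt_irrefl _ (h2 1 h).2
    have h0' : (0 : ℝ) ∉ insert 1 S := by
      simp only [Finset.mem_insert, not_or]
      exact ⟨by norm_num, fun h => lt_irrefl _ (h2 0 h).1⟩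
    rw [Function.iterate_succ_apply']
    refine exists_roots_derivative_of_roots _ (insert 0 (insert 1 S)) ?_ ?_ ?_
    · rw [Finset.card_insert_of_notMem h0', Finset.card_insert_of_notMem h1', h1]
    · intro x hx
      simp only [Finset.mem_insert] at hx
      rcases hx with rfl | rfl | hx
      · simp
      · simp
      · exact Ioo_subset_Icc_self (h2 x hx)
    · intro x hx
      simp only [Finset.mem_insert] at hx
      rcases hx with rfl | rfl | hx
      · exact eval_iterate_derivative_eq_zero (by omega) (Or.inl rfl)
      · exact eval_iterate_derivative_eq_zero (by omega) (Or.inr rfl)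
      · exact h3 x hx

/-- By Rodrigues' formula the shifted Legendre polynomial is the `k`-th derivative of `X^k (1 -
X)^k` up to the factor `k!`, so it has `k` zeros in (0, 1). Rolle's theorem gives `k - 1` interior
zeros of its derivative, and the degree allows no others; the endpoints complete the `k + 1` nodes.
-/
theorem exists_gaussLobatto_reference (k : ℕ) (hk : 1 ≤ k) :
    ∃ N : Finset ℝ, N.card = k + 1 ∧ (∀ x ∈ N, x ∈ Icc (0 : ℝ) 1) ∧
      ∀ a b : ℝ, gaussLobattoNodes k a b = {t | ∃ x ∈ N, t = a + (b - a) * x} := by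
  set P : ℝ[X] := (shiftedLegendre k).map (Int.castRingHom ℝ) with hP
  obtain ⟨k', rfl⟩ : ∃ k', k = k' + 1 := ⟨k - 1, by omega⟩
  set k := k' + 1
  have hrod : (k.factorial : ℝ[X]) * P = derivative^[k] (X ^ k * (1 - X) ^ k : ℝ[X]) := by
    have := congr_arg (Polynomial.map (Int.castRingHom ℝ)) (factorial_mul_shiftedLegendre_eq k)
    rw [← Polynomial.iterate_derivative_map] at this
    simpa using this
  have hdeg : P.natDegree = k := by
    rw [hP, natDegree_map_eq_of_injective (Int.castRingHom ℝ).injective_int,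
      natDegree_shiftedLegendre]
  obtain ⟨S, h1, h2, h3⟩ := exists_roots_iterate_derivative k k le_rfl
  obtain ⟨T, h4, h5, h6⟩ := exists_roots_derivative_of_roots _ (r := k') S h1
    (fun x hx => Ioo_subset_Icc_self (h2 x hx)) h3
  have h6' : ∀ x ∈ T, P.derivative.eval x = 0 := by
    intro x hx
    have := h6 x hx
    rw [← hrod, ← C_eq_natCast, derivative_C_mul, eval_C_mul] at this
    exact (mul_eq_zero.1 this).resolve_left (by positivity)
  have hne : P.derivative ≠ 0 := by
    intro h
    have := derivative_eq_zero.1 h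
    omega
  have hT : P.derivative.roots.toFinset = T := by
    symm
    refine Finset.eq_of_subset_of_card_le (fun x hx => ?_) ?_
    · rw [Multiset.mem_toFinset, mem_roots hne]
      exact h6' x hx
    · rw [h4]
      refine (Multiset.toFinset_card_le _).trans ((card_roots' _).trans ?_)
      have := natDegree_derivative_le P
      omega
  have h1' : (1 : ℝ) ∉ T := fun h => lt_irrefl _ (h5 1 h).2
  have h0' : (0 : ℝ) ∉ insert 1 T := by
    simp only [Finset.mem_insert, not_or]
    exact ⟨by norm_num, fun h => lt_irrefl _ (h5 0 h).1⟩
  refine ⟨insert 0 (insert 1 T), ?_, ?_, ?_⟩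
  · rw [Finset.card_insert_of_notMem h0', Finset.card_insert_of_notMem h1', h4]
  · intro x hx
    simp only [Finset.mem_insert] at hx
    rcases hx with rfl | rfl | hx
    · simp
    · simp
    · exact Ioo_subset_Icc_self (h5 x hx)
  · intro a b
    ext t
    simp only [gaussLobattoNodes, Finset.mem_insert, mem_ofPred_eq, ← hT, Multiset.mem_toFinset,
      mem_roots hne]
    exact ⟨fun ⟨x, h, h'⟩ => ⟨x, h', h⟩, fun ⟨x, h, h'⟩ => ⟨x, h', h⟩⟩

end Nodes

/-! ## Interpolation on an interval -/

section PolynomialLemmas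

open Polynomial

theorem exists_antiderivative (p : ℝ[X]) (d : ℕ) (hp : p.degree < (d : WithBot ℕ)) (a v : ℝ) :
    ∃ P : ℝ[X], P.degree < ((d + 1 : ℕ) : WithBot ℕ) ∧ derivative P = p ∧ P.eval a = v := by
  let Q : ℝ[X] := ∑ i ∈ Finset.range d, C (p.coeff i / (i + 1)) * X ^ (i + 1)
  have hQ : derivative Q = p := by
    have h1 : derivative Q = ∑ i ∈ Finset.range d, C (p.coeff i) * X ^ i := by
      simp only [Q, derivative_sum]
      refine Finset.sum_congr rfl fun i _ => ?_
      rw [derivative_C_mul_X_pow]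
      congr 2
      push_cast
      field_simp
    rw [h1]
    ext j
    simp only [finsetSum_coeff, coeff_C_mul_X_pow]
    rw [Finset.sum_ite_eq]
    split_ifs with h
    · rfl
    · rw [Finset.mem_range, not_lt] at h
      exact (coeff_eq_zero_of_degree_lt (hp.trans_le (by exact_mod_cast h))).symm
  refine ⟨Q + C (v - Q.eval a), ?_, by simp [hQ], by simp⟩
  refine (degree_add_le _ _).trans_lt (max_lt ?_ ?_)
  · refine (degree_sum_le _ _).trans_lt ?_
    rw [Finset.sup_lt_iff (by exact WithBot.bot_lt_coe _)]
    intro i hi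
    refine (degree_C_mul_X_pow_le _ _).trans_lt ?_
    rw [Finset.mem_range] at hi
    exact_mod_cast Nat.succ_lt_succ hi
  · exact degree_C_le.trans_lt (by exact_mod_cast Nat.succ_pos d)

/-- Polynomials with prescribed derivatives at a point. -/
theorem exists_taylor (n d : ℕ) (v : ℕ → ℝ) (c a : ℝ) (hc : (C c).degree < (d : WithBot ℕ)) :
    ∃ p : ℝ[X], p.degree < ((d + n : ℕ) : WithBot ℕ) ∧
      (∀ j < n, (derivative^[j] p).eval a = v j) ∧ derivative^[n] p = C c := by
  induction n generalizing v with
  | zero => exact ⟨C c, by simpa using hc, by simp, rfl⟩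
  | succ n ih =>
    obtain ⟨p', h1, h2, h3⟩ := ih fun j => v (j + 1)
    obtain ⟨p, h4, h5, h6⟩ := exists_antiderivative p' _ h1 a (v 0)
    refine ⟨p, by rwa [← add_assoc], fun j hj => ?_, ?_⟩
    · cases j with
      | zero => exact h6
      | succ j =>
        rw [Function.iterate_succ_apply, h5]
        exact h2 j (by omega)
    · rw [Function.iterate_succ_apply, h5, h3]

theorem iterate_derivative_comp_linear (p : ℝ[X]) (a L : ℝ) (j : ℕ) :
    derivative^[j] (p.comp (C a + C L * X)) = C (L ^ j) * (derivative^[j] p).comp (C a + C L * X) := by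
  induction j with
  | zero => simp
  | succ j ih =>
    rw [Function.iterate_succ_apply', ih, Function.iterate_succ_apply', derivative_C_mul,
      derivative_comp]
    simp only [derivative_add, derivative_C, derivative_mul, derivative_X, pow_succ, C_mul]
    ring

/-- Stability of Lagrange interpolation, in all derivatives, after scaling to an interval. -/
theorem exists_interpolation_stability (N : Finset ℝ) :
    ∃ K : ℝ, 0 < K ∧ ∀ (a b : ℝ), a < b → ∀ (p : ℝ[X]) (B : ℝ), 0 ≤ B →
      p.degree < (N.card : WithBot ℕ) → (∀ x ∈ N, |p.eval (a + (b - a) * x)| ≤ B) →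
      ∀ j, ∀ t ∈ Icc a b, |(derivative^[j] p).eval t| ≤ K * B / (b - a) ^ j := by
  have h1 : ∀ (j : ℕ) (i : ℝ), ∃ M : ℝ, 0 ≤ M ∧ ∀ x ∈ Icc (0 : ℝ) 1,
      |(derivative^[j] (Lagrange.basis N id i)).eval x| ≤ M := by
    intro j i
    obtain ⟨M, hM⟩ := isCompact_Icc.exists_bound_of_continuousOn
      (s := Icc (0 : ℝ) 1) (derivative^[j] (Lagrange.basis N id i)).continuous.continuousOn
    exact ⟨M, (norm_nonneg _).trans (hM 0 (by simp)), hM⟩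
  choose M hM0 hM using h1
  have hK0 : 0 ≤ ∑ j ∈ Finset.range N.card, ∑ i ∈ N, M j i :=
    Finset.sum_nonneg fun j _ => Finset.sum_nonneg fun i _ => hM0 j i
  -- Only orders below `N.card` count, as higher derivatives of `p` vanish; hence one constant for
  -- all `j`. The summand 1 makes it positive even if `N` is empty.
  refine ⟨∑ j ∈ Finset.range N.card, ∑ i ∈ N, M j i + 1, by linarith, ?_⟩
  intro a b hab p B hB hp hpB j t ht
  have hL : 0 < b - a := by linarith
  rcases lt_or_ge j N.card with hj | hj
  swap
  · rcases eq_or_ne p 0 with rfl | h0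
    · simp only [iterate_derivative_zero, eval_zero, abs_zero]
      positivity
    rw [iterate_derivative_eq_zero]
    · simp only [eval_zero, abs_zero]
      positivity
    · have := (natDegree_lt_iff_degree_lt h0).2 hp
      omega
  -- Pulled back to [0, 1], `p` equals its Lagrange interpolant on the fixed nodes `N`; the chain
  -- rule produces the power `(b - a)^j`.
  have hdeg : (p.comp (C a + C (b - a) * X)).degree < (N.card : WithBot ℕ) := by
    rcases eq_or_ne p 0 with rfl | h0
    · simp
    have h2 := (natDegree_lt_iff_degree_lt h0).2 hp
    refine (degree_le_natDegree).trans_lt ?_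
    rw [Nat.cast_lt, natDegree_comp, add_comm (C a)]
    refine (Nat.mul_le_mul_left _ natDegree_linear_le).trans_lt ?_
    omega
  have h2 := Lagrange.eq_interpolate (v := id) (s := N) (injOn_id _) hdeg
  set x := (t - a) / (b - a) with hx
  have hxm : x ∈ Icc (0 : ℝ) 1 :=
    ⟨div_nonneg (by linarith [ht.1]) hL.le, by rw [hx, div_le_one hL]; linarith [ht.2]⟩
  have hxt : a + (b - a) * x = t := by rw [hx]; field_simp; ring
  have h3 := congr_arg (fun r => (derivative^[j] r).eval x) h2
  simp only [iterate_derivative_comp_linear, Lagrange.interpolate_apply, iterate_derivative_sum,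
    iterate_derivative_C_mul, eval_mul, eval_C, eval_comp, eval_add, eval_X, eval_finsetSum, id,
    hxt] at h3
  rw [le_div_iff₀ (by positivity), ← abs_of_pos (show 0 < (b - a) ^ j by positivity), ← abs_mul,
    mul_comm, h3]
  calc |∑ i ∈ N, p.eval (a + (b - a) * i) * (derivative^[j] (Lagrange.basis N id i)).eval x|
      ≤ ∑ i ∈ N, |p.eval (a + (b - a) * i) * (derivative^[j] (Lagrange.basis N id i)).eval x| :=
        Finset.abs_sum_le_sum_abs _ _
    _ ≤ ∑ i ∈ N, B * M j i := by
        refine Finset.sum_le_sum fun i hi => ?_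
        rw [abs_mul]
        exact mul_le_mul (hpB i hi) (hM j i x hxm) (abs_nonneg _) hB
    _ = (∑ i ∈ N, M j i) * B := by rw [← Finset.mul_sum, mul_comm]
    _ ≤ _ := by
        gcongr
        have := Finset.single_le_sum (f := fun j => ∑ i ∈ N, M j i)
          (fun j _ => Finset.sum_nonneg fun i _ => hM0 j i) (Finset.mem_range.2 hj)
        linarith

theorem isPrim_eval (p : ℝ[X]) (a b : ℝ) :
    IsPrim a b (fun x => p.eval x) (fun x => (derivative p).eval x) :=
  .of_hasDerivAt (fun x => p.hasDerivAt x) (derivative p).continuous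

end PolynomialLemmas

/-! ### Pointwise bounds for iterated primitives. -/

section Bounds

variable {a b : ℝ}

theorem eLpNorm_two_le_of_bound (hab : a ≤ b) {g : ℝ → ℝ} {B : ℝ} (h : ∀ x ∈ Ioo a b, |g x| ≤ B) :
    eLpNorm g 2 (volume.restrict (Ioo a b)) ≤ ENNReal.ofReal (Real.sqrt (b - a) * B) := by
  have h1 : ∀ᵐ x ∂(volume.restrict (Ioo a b)), ‖g x‖ ≤ B := by
    filter_upwards [ae_restrict_mem measurableSet_Ioo] with x hx using h x hx
  refine (eLpNorm_le_of_ae_bound h1).trans (le_of_eq ?_)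
  rw [Measure.restrict_apply_univ, Real.volume_Ioo, ENNReal.ofReal_mul (Real.sqrt_nonneg _),
    Real.sqrt_eq_rpow, ENNReal.ofReal_rpow_of_nonneg (by linarith) (by norm_num)]
  norm_num

theorem abs_le_of_isPrim {F f : ℝ → ℝ} (h : IsPrim a b F f) (ha : F a = 0)
    (hf : MemLp f 2 (volume.restrict (Ioo a b))) {x : ℝ} (hx : x ∈ Icc a b) :
    |F x| ≤ Real.sqrt (b - a) * (eLpNorm f 2 (volume.restrict (Ioo a b))).toReal := by
  have h1 := enorm_intervalIntegral_sq_le (f := f) hx.1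
    (hf.1.mono_measure (Measure.restrict_mono (Ioo_subset_Ioo_right hx.2) le_rfl))
  rw [← zero_add (∫ t in a..x, f t), ← ha, ← h.2 x hx] at h1
  have hba : 0 ≤ b - a := by linarith [hx.1, hx.2]
  have h2 : ‖F x‖ₑ ^ (2 : ℝ) ≤ ENNReal.ofReal (b - a) *
      ∫⁻ t in Ioo a b, ‖f t‖ₑ ^ (2 : ℝ) := by
    refine h1.trans ?_
    gcongr <;> exact hx.2
  have h3 := ENNReal.rpow_le_rpow h2 (by norm_num : (0 : ℝ) ≤ 1 / 2)
  rw [← ENNReal.rpow_mul, ENNReal.mul_rpow_of_nonneg _ _ (by norm_num), ← eLpNorm_two_eq,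
    ENNReal.ofReal_rpow_of_nonneg hba (by norm_num), ← Real.sqrt_eq_rpow,
    show (2 : ℝ) * (1 / 2) = 1 by norm_num, ENNReal.rpow_one] at h3
  have h4 := ENNReal.toReal_mono (ENNReal.mul_ne_top ENNReal.ofReal_ne_top hf.2.ne) h3
  rwa [ENNReal.toReal_mul, ENNReal.toReal_ofReal (Real.sqrt_nonneg _), toReal_enorm] at h4

theorem abs_le_mul_of_isPrim {F f : ℝ → ℝ} (h : IsPrim a b F f) (ha : F a = 0) {B : ℝ}
    (hf : ∀ x ∈ Icc a b, |f x| ≤ B) {x : ℝ} (hx : x ∈ Icc a b) : |F x| ≤ (b - a) * B := by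
  have hB : 0 ≤ B := (abs_nonneg _).trans (hf x hx)
  rw [h.2 x hx, ha, zero_add, ← Real.norm_eq_abs]
  refine (intervalIntegral.norm_integral_le_of_norm_le_const (C := B) fun y hy => ?_).trans ?_
  · rw [uIoc_of_le hx.1] at hy
    exact hf y ⟨hy.1.le, hy.2.trans hx.2⟩
  · rw [mul_comm, abs_of_nonneg (by linarith [hx.1])]
    gcongr
    exact hx.2

/-- Only an `L²` bound of the top derivative is available, so the first integration costs the square
root of `b - a`, by Cauchy–Schwarz; each later one costs `b - a`. -/
theorem abs_chain_le {n : ℕ} {Z : ℕ → ℝ → ℝ} (hn : 1 ≤ n)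
    (hZ : ∀ j < n, IsPrim a b (Z j) (Z (j + 1))) (ha : ∀ j < n, Z j a = 0)
    (hm : MemLp (Z n) 2 (volume.restrict (Ioo a b))) :
    ∀ j < n, ∀ x ∈ Icc a b, |Z j x| ≤ (b - a) ^ (n - 1 - j) *
      (Real.sqrt (b - a) * (eLpNorm (Z n) 2 (volume.restrict (Ioo a b))).toReal) := by
  suffices H : ∀ i j, i + j + 1 = n → ∀ x ∈ Icc a b, |Z j x| ≤ (b - a) ^ i *
      (Real.sqrt (b - a) * (eLpNorm (Z n) 2 (volume.restrict (Ioo a b))).toReal) by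
    intro j hj
    exact H (n - 1 - j) j (by omega)
  intro i
  induction i with
  | zero =>
    intro j hj x hx
    rw [zero_add] at hj
    subst hj
    rw [pow_zero, one_mul]
    exact abs_le_of_isPrim (hZ j (by omega)) (ha j (by omega)) hm hx
  | succ i ih =>
    intro j hj x hx
    rw [pow_succ', mul_assoc]
    exact abs_le_mul_of_isPrim (hZ j (by omega)) (ha j (by omega)) (ih (j + 1) (by omega)) hx

theorem natFloor_add_fract {r : ℝ} (hr : 0 ≤ r) : (⌊r⌋₊ : ℝ) + Int.fract r = r := by
  rw [natCast_floor_eq_intCast_floor hr, Int.floor_add_fract]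

end Bounds

/-! ### The interpolation error on an interval. -/

section Core

open Polynomial

/-- The error of the Gauss-Lobatto interpolation on an interval. -/
theorem exists_interpolation_estimate (k : ℕ) (hk : 1 ≤ k) (s m : ℝ) (hs : 1 < s)
    (hsk : s ≤ k + 1) (hm : 0 ≤ m) (hms : m ≤ s) :
    ∃ C : ℝ, 0 < C ∧ ∀ (a b : ℝ), a < b → ∀ f : ℝ → ℝ, ContinuousOn f (Icc a b) →
      hNorm s a b f < ⊤ → ∀ q : ℝ[X], q.natDegree ≤ k →
      (∀ t ∈ gaussLobattoNodes k a b, f t = q.eval t) →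
      hSeminorm m a b (fun x => f x - q.eval x) ≤
        ENNReal.ofReal (C * (b - a) ^ (s - m)) * hSeminorm s a b f := by
  obtain ⟨N, hN1, hN2, hN3⟩ := exists_gaussLobatto_reference k hk
  obtain ⟨K, hK, hstab⟩ := exists_interpolation_stability N
  rw [hN1] at hstab
  set μ := Int.fract m with hμ
  set θ := Int.fract s with hθ
  set n := ⌊s⌋₊ with hn
  set j := ⌊m⌋₊ with hj
  have hμ0 : 0 ≤ μ := Int.fract_nonneg m
  have hμ1 : μ < 1 := Int.fract_lt_one m
  have hθ0 : 0 ≤ θ := Int.fract_nonneg s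
  have hθ1 : θ < 1 := Int.fract_lt_one s
  have hns : (n : ℝ) + θ = s := natFloor_add_fract (by linarith)
  have hjm : (j : ℝ) + μ = m := natFloor_add_fract hm
  have hn1 : 1 ≤ n := (Nat.one_le_floor_iff _).2 hs.le
  have hjn : j ≤ n := Nat.floor_mono hms
  have hemb := embConst_pos hμ1
  -- In the first factor, 1 accounts for `f - p` and `K` for `q - p`; the second covers the passage
  -- to a fractional order.
  refine ⟨(1 + K) * (1 + embConst μ), by positivity, ?_⟩
  intro a b hab f hf hfs q hq hqf
  have hL : 0 < b - a := by linarith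
  set L := b - a with hLdef
  set ν := volume.restrict (Ioo a b) with hν
  obtain ⟨F, hF0, hF1, hF2⟩ := exists_chain_of_hNorm_lt_top hab hf hfs
  rw [← hn] at hF1 hF2
  have hSF := hSeminorm_eq (hF2 n le_rfl).1
  rw [← hθ] at hSF
  set S := hSeminorm s a b f with hS
  have hFi : IntegrableOn (F n) (Ioo a b) := (hF2 n le_rfl).2.integrable (by norm_num)
  have hfinν : IsFiniteMeasure ν := ⟨by
    rw [hν, Measure.restrict_apply_univ, Real.volume_Ioo]; exact ENNReal.ofReal_lt_top⟩
  -- The prescribed `n`-th derivative of `p`. If `θ = 0` it is zero and `p` has degree below `n ≤ k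
  -- + 1`. If `θ > 0` it is the mean of `F n`, and `s ≤ k + 1` forces `n ≤ k`, so degree `n` is
  -- admissible.
  obtain ⟨c, d, hcd, hdn, hcS⟩ : ∃ (c : ℝ) (d : ℕ), (C c).degree < (d : WithBot ℕ) ∧
      d + n ≤ k + 1 ∧ eLpNorm (fun x => F n x - c) 2 ν ≤ ENNReal.ofReal (L ^ θ) * S := by
    by_cases h0 : θ = 0
    · refine ⟨0, 0, by simp, ?_, ?_⟩
      · rw [h0, add_zero] at hns
        rw [← hns] at hsk
        rw [zero_add]
        exact_mod_cast hsk
      · rw [hSF, if_pos h0, h0]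
        simp
        exact le_rfl
    · refine ⟨L⁻¹ * ∫ t in Ioo a b, F n t, 1, (degree_C_le).trans_lt (by norm_num), ?_, ?_⟩
      · have h1 : (n : ℝ) < k + 1 := by
          have := lt_of_le_of_ne hθ0 (Ne.symm h0)
          linarith
        have h2 : n < k + 1 := by exact_mod_cast h1
        omega
      · rw [hSF, if_neg h0]
        exact eLpNorm_sub_average_le hab (lt_of_le_of_ne hθ0 (Ne.symm h0)) hFi
  obtain ⟨p, hp1, hp2, hp3⟩ := exists_taylor n d (fun i => F i a) c a hcd
  have hpk : p.degree < ((k + 1 : ℕ) : WithBot ℕ) := hp1.trans_le (by exact_mod_cast hdn)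
  have hqk : q.degree < ((k + 1 : ℕ) : WithBot ℕ) :=
    degree_le_natDegree.trans_lt (by exact_mod_cast Nat.lt_succ_of_le hq)
  have hρk : (q - p).degree < ((k + 1 : ℕ) : WithBot ℕ) :=
    (degree_sub_le _ _).trans_lt (max_lt hqk hpk)
  have hDP : ∀ (r : ℝ[X]) (i : ℕ), IsPrim a b (fun x => (derivative^[i] r).eval x)
      (fun x => (derivative^[i + 1] r).eval x) := fun r i => by
    rw [Function.iterate_succ_apply']
    exact isPrim_eval _ a b
  set Z : ℕ → ℝ → ℝ := fun i x => F i x - (derivative^[i] p).eval x with hZ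
  set W : ℕ → ℝ → ℝ := fun i x => F i x - (derivative^[i] q).eval x with hW
  have hZP : ∀ i < n, IsPrim a b (Z i) (Z (i + 1)) := fun i hi => (hF1 i hi).sub (hDP p i)
  have hWP : ∀ i < n, IsPrim a b (W i) (W (i + 1)) := fun i hi => (hF1 i hi).sub (hDP q i)
  have hpolyL : ∀ (r : ℝ[X]), MemLp (fun x => r.eval x) 2 ν := fun r => by
    obtain ⟨B, hB⟩ := isCompact_Icc.exists_bound_of_continuousOn
      (s := Icc a b) r.continuous.continuousOn
    refine MemLp.of_bound r.continuous.aestronglyMeasurable B ?_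
    filter_upwards [ae_restrict_mem measurableSet_Ioo] with x hx
    exact hB x (Ioo_subset_Icc_self hx)
  have hZL : MemLp (Z n) 2 ν := (hF2 n le_rfl).2.sub (hpolyL _)
  have hWL : MemLp (W n) 2 ν := (hF2 n le_rfl).2.sub (hpolyL _)
  have hZn : Z n = fun x => F n x - c := by
    ext x
    simp only [hZ, hp3, eval_C]
  set A := (eLpNorm (Z n) 2 ν).toReal with hA
  have hA0 : 0 ≤ A := ENNReal.toReal_nonneg
  have hAof : ENNReal.ofReal A = eLpNorm (Z n) 2 ν := ENNReal.ofReal_toReal hZL.2.ne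
  have hAS : ENNReal.ofReal A ≤ ENNReal.ofReal (L ^ θ) * S := by
    rw [hAof, hZn]; exact hcS
  have hZb := abs_chain_le hn1 hZP (fun i hi => by simp [hZ, hp2 i hi]) hZL
  rw [← hLdef, ← hν, ← hA] at hZb
  have hsq : Real.sqrt L * Real.sqrt L = L := Real.mul_self_sqrt hL.le
  -- The sup bound of `f - p`. At the nodes `q` equals `f`, so `B` also bounds `q - p` there.
  set B := L ^ (n - 1) * (Real.sqrt L * A) with hB
  have hB0 : 0 ≤ B := by positivity
  have hρb := hstab a b hab (q - p) B hB0 hρk (by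
    intro x hx
    have hxI : a + (b - a) * x ∈ Icc a b := by
      have := hN2 x hx
      constructor <;> nlinarith [this.1, this.2]
    have h1 : f (a + (b - a) * x) = q.eval (a + (b - a) * x) :=
      hqf _ (by rw [hN3]; exact ⟨x, hx, rfl⟩)
    have h2 := hZb 0 (by omega) _ hxI
    simpa [hZ, hF0 hxI, h1] using h2)
  have hWZ : ∀ i x, W i x = Z i x - (derivative^[i] (q - p)).eval x := fun i x => by
    simp only [hW, hZ, iterate_derivative_sub, eval_sub]; ring
  -- After multiplication by the square root of `L`, from the `L²` norm of a bounded function, the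
  -- derivatives of `q - p` scale exactly like those of `f - p`.
  have hBi : ∀ i : ℕ, Real.sqrt L * (K * B / L ^ i) = K * (L ^ ((n : ℝ) - i) * A) := fun i => by
    have e1 : L ^ ((n : ℝ) - i) = L ^ (n - 1) * L / L ^ i := by
      rw [Real.rpow_sub hL, Real.rpow_natCast, Real.rpow_natCast, ← pow_succ,
        Nat.sub_add_cancel hn1]
    rw [e1, hB]
    calc _ = K * (L ^ (n - 1) * (Real.sqrt L * Real.sqrt L) / L ^ i * A) := by ring
      _ = _ := by rw [hsq]
  have hρL : ∀ i, eLpNorm (fun x => (derivative^[i] (q - p)).eval x) 2 ν ≤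
      ENNReal.ofReal (K * (L ^ ((n : ℝ) - i) * A)) := fun i => by
    rw [← hBi]
    exact eLpNorm_two_le_of_bound hab.le fun x hx => hρb i x (Ioo_subset_Icc_self hx)
  have hZL' : ∀ i ≤ n, eLpNorm (Z i) 2 ν ≤ ENNReal.ofReal (L ^ ((n : ℝ) - i) * A) := by
    intro i hi
    rcases lt_or_eq_of_le hi with hi | rfl
    · have e1 : L ^ ((n : ℝ) - i) * A = Real.sqrt L * (L ^ (n - 1 - i) * (Real.sqrt L * A)) := by
        have : (n : ℝ) - i = ((n - 1 - i : ℕ) : ℝ) + 1 := by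
          rw [Nat.cast_sub (by omega), Nat.cast_sub hn1]; push_cast; ring
        rw [this, Real.rpow_add_one hL.ne', Real.rpow_natCast]
        calc _ = L ^ (n - 1 - i) * (Real.sqrt L * Real.sqrt L) * A := by rw [hsq]
          _ = _ := by ring
      rw [e1]
      exact eLpNorm_two_le_of_bound hab.le fun x hx => hZb i hi x (Ioo_subset_Icc_self hx)
    · rw [sub_self, Real.rpow_zero, one_mul, hAof]
  have hZm : ∀ i ≤ n, AEStronglyMeasurable (Z i) ν := fun i hi =>
    ((hF2 i hi).2.sub (hpolyL _)).1
  have hWL' : ∀ i ≤ n, eLpNorm (W i) 2 ν ≤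
      ENNReal.ofReal ((1 + K) * (L ^ ((n : ℝ) - i) * A)) := by
    intro i hi
    have e : W i = Z i - fun x => (derivative^[i] (q - p)).eval x := funext (hWZ i)
    rw [e]
    refine (eLpNorm_sub_le (hZm i hi) (hpolyL _).1 (by norm_num)).trans
      ((add_le_add (hZL' i hi) (hρL i)).trans (le_of_eq ?_))
    rw [← ENNReal.ofReal_add (by positivity) (by positivity)]
    congr 1; ring
  -- Bookkeeping: `A` contributes a further power `θ` of `L`, so a bound in terms of `A` must carry
  -- the power `s - m - θ`.
  have hfin : ∀ (κ e : ℝ), 0 ≤ κ → κ ≤ (1 + K) * (1 + embConst μ) → e + θ = s - m →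
      ENNReal.ofReal (κ * (L ^ e * A)) ≤
        ENNReal.ofReal ((1 + K) * (1 + embConst μ) * L ^ (s - m)) * S := by
    intro κ e hκ0 hκ he
    rw [ENNReal.ofReal_mul hκ0, ENNReal.ofReal_mul (by positivity)]
    calc ENNReal.ofReal κ * (ENNReal.ofReal (L ^ e) * ENNReal.ofReal A)
        ≤ ENNReal.ofReal ((1 + K) * (1 + embConst μ)) *
          (ENNReal.ofReal (L ^ e) * (ENNReal.ofReal (L ^ θ) * S)) := by gcongr
      _ = _ := by
        rw [← he, Real.rpow_add hL, ENNReal.ofReal_mul (p := (1 + K) * (1 + embConst μ))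
          (by positivity), ENNReal.ofReal_mul (p := L ^ e) (by positivity)]
        simp only [mul_assoc]
  have hweak := isWeakDeriv_of_chain hWP
    (show IntegrableOn (W n) (Ioo a b) volume from
      hWL.integrable (by norm_num)).locallyIntegrableOn
  have hsem : hSeminorm m a b (fun x => f x - q.eval x) =
      if μ = 0 then eLpNorm (W j) 2 ν else gagliardo μ a b (W j) := by
    refine hSeminorm_eq ((hweak j hjn).congr (ae_of_all _ fun x hx => ?_) (by simp))
    simp [hW, hF0 (Ioo_subset_Icc_self hx)]
  rw [hsem]
  split_ifs with hμz
  · exact (hWL' j hjn).trans (hfin _ _ (by positivity) (by nlinarith) (by linarith))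
  have hμpos : 0 < μ := lt_of_le_of_ne hμ0 (Ne.symm hμz)
  rcases lt_or_eq_of_le hjn with hlt | heq
  -- Here the error has one more derivative in `L²`, and the embedding applies to it as a whole.
  · refine (gagliardo_le_eLpNorm_deriv hμpos hμ1 (hWP j hlt)).trans ?_
    refine (mul_le_mul_right (hWL' (j + 1) hlt) _).trans ?_
    rw [← ENNReal.ofReal_mul (by positivity)]
    refine le_trans (le_of_eq ?_) (hfin (embConst μ * (1 + K)) ((n : ℝ) - j - μ) (by positivity)
      (by nlinarith) (by linarith))
    congr 1
    have : L ^ ((n : ℝ) - j - μ) = L ^ (1 - μ) * L ^ ((n : ℝ) - ((j + 1 : ℕ) : ℝ)) := by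
      rw [← Real.rpow_add hL]; congr 1; push_cast; ring
    rw [this, ← hLdef]
    ring
  -- With `j = n` there is no further derivative of `f` to use. Instead `m ≤ s` gives `μ ≤ θ`: the
  -- constant `c` drops out of the seminorm of `Z n`, which is compared with that of order `θ`, and
  -- the embedding is applied to the polynomial `q - p` alone.
  · have hμθ : μ ≤ θ := by
      have : (j : ℝ) = n := by exact_mod_cast heq
      linarith
    have hθz : θ ≠ 0 := (hμpos.trans_le hμθ).ne'
    rw [if_neg hθz] at hSF
    have hjnR : (j : ℝ) = n := by exact_mod_cast heq
    rw [heq]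
    have e : W n = fun x => Z n x - (derivative^[n] (q - p)).eval x := funext (hWZ n)
    rw [e]
    refine (gagliardo_sub_le (hZm n le_rfl).aemeasurable (hpolyL _).1.aemeasurable).trans ?_
    have g1 : gagliardo μ a b (Z n) ≤ ENNReal.ofReal (L ^ (s - m)) * S := by
      rw [hZn, gagliardo_sub_const, hSF]
      refine (gagliardo_le_of_le hμθ (hF2 n le_rfl).2.1.aemeasurable).trans (le_of_eq ?_)
      rw [show θ - μ = s - m by linarith]
    have g2 : gagliardo μ a b (fun x => (derivative^[n] (q - p)).eval x) ≤
        ENNReal.ofReal (embConst μ * K * L ^ (s - m)) * S := by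
      refine (gagliardo_le_eLpNorm_deriv hμpos hμ1 (hDP (q - p) n)).trans ?_
      refine (mul_le_mul_right (hρL (n + 1)) _).trans ?_
      rw [← ENNReal.ofReal_mul (by positivity)]
      have e2 : embConst μ * (b - a) ^ (1 - μ) * (K * (L ^ ((n : ℝ) - ((n + 1 : ℕ) : ℝ)) * A)) =
          embConst μ * K * L ^ (-μ) * A := by
        have : L ^ (-μ) = L ^ (1 - μ) * L ^ ((n : ℝ) - ((n + 1 : ℕ) : ℝ)) := by
          rw [← Real.rpow_add hL]; congr 1; push_cast; ring
        rw [this, ← hLdef]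
        ring
      rw [e2, ENNReal.ofReal_mul (by positivity)]
      refine (mul_le_mul_right hAS _).trans (le_of_eq ?_)
      rw [← mul_assoc, ← ENNReal.ofReal_mul (by positivity), mul_assoc (embConst μ * K),
        ← Real.rpow_add hL, show -μ + θ = s - m by linarith]
    refine (add_le_add g1 g2).trans ?_
    rw [← add_mul, ← ENNReal.ofReal_add (by positivity) (by positivity)]
    gcongr
    have : 0 ≤ L ^ (s - m) := by positivity
    nlinarith [mul_pos hK hemb]

end Core

/-! ## Composition with a change of variables -/

/-- `P` and its weak derivatives on `(c, d)` up to order `n` are bounded by `K`. -/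
def BddDerivs (c d K : ℝ) : ℕ → (ℝ → ℝ) → Prop
  | 0, P => AEMeasurable P (volume.restrict (Ioo c d)) ∧ ∀ᵐ x, x ∈ Ioo c d → |P x| ≤ K
  | n + 1, P => (∀ x ∈ Ioo c d, |P x| ≤ K) ∧ ∃ P', IsPrim c d P P' ∧ BddDerivs c d K n P'

/-- The `L²` norms of `f` and of its weak derivatives on `(a, b)` up to order `n`, and the
Gagliardo seminorm of order `θ ≠ 0` of the derivative of order `n`, are bounded by `S`. -/
def SobBound (θ a b : ℝ) (S : ENNReal) : ℕ → (ℝ → ℝ) → Prop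
  | 0, f => AEMeasurable f (volume.restrict (Ioo a b)) ∧
      eLpNorm f 2 (volume.restrict (Ioo a b)) ≤ S ∧ (θ ≠ 0 → gagliardo θ a b f ≤ S)
  | n + 1, f => eLpNorm f 2 (volume.restrict (Ioo a b)) ≤ S ∧
      ∃ f', IsPrim a b f f' ∧ SobBound θ a b S n f'

section BddDerivs

variable {c d K : ℝ} {n : ℕ} {P Q : ℝ → ℝ}

theorem BddDerivs.aemeasurable (h : BddDerivs c d K n P) :
    AEMeasurable P (volume.restrict (Ioo c d)) := by
  cases n with
  | zero => exact h.1
  | succ n =>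
    obtain ⟨-, P', hP, -⟩ := h
    exact hP.integrableOn_left.aemeasurable

theorem BddDerivs.ae_le (h : BddDerivs c d K n P) : ∀ᵐ x, x ∈ Ioo c d → |P x| ≤ K := by
  cases n with
  | zero => exact h.2
  | succ n => exact ae_of_all _ h.1

theorem BddDerivs.pred (h : BddDerivs c d K (n + 1) P) : BddDerivs c d K n P := by
  induction n generalizing P with
  | zero => exact ⟨h.aemeasurable, h.ae_le⟩
  | succ n ih =>
    obtain ⟨h1, P', hP, h2⟩ := h
    exact ⟨h1, P', hP, ih h2⟩

theorem BddDerivs.of_le {m : ℕ} (h : BddDerivs c d K n P) (hm : m ≤ n) :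
    BddDerivs c d K m P := by
  induction n, hm using Nat.le_induction with
  | base => exact h
  | succ n _ ih => exact ih h.pred

theorem BddDerivs.add (h : BddDerivs c d K n P) (h' : BddDerivs c d K' n Q) :
    BddDerivs c d (K + K') n (fun x => P x + Q x) := by
  induction n generalizing P Q with
  | zero =>
    refine ⟨h.1.add h'.1, ?_⟩
    filter_upwards [h.2, h'.2] with x h1 h2 hx
    exact (abs_add_le _ _).trans (add_le_add (h1 hx) (h2 hx))
  | succ n ih =>
    obtain ⟨h1, P', hP, h2⟩ := h
    obtain ⟨h1', Q', hQ, h2'⟩ := h'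
    exact ⟨fun x hx => (abs_add_le _ _).trans (add_le_add (h1 x hx) (h1' x hx)), _,
      hP.add hQ, ih h2 h2'⟩

/-- Each differentiation splits the product in two, which doubles the constant. -/
theorem BddDerivs.mul (hK : 0 ≤ K) (hK' : 0 ≤ K') (h : BddDerivs c d K n P)
    (h' : BddDerivs c d K' n Q) :
    BddDerivs c d (2 ^ n * (K * K')) n (fun x => P x * Q x) := by
  induction n generalizing P Q with
  | zero =>
    refine ⟨h.1.mul h'.1, ?_⟩
    filter_upwards [h.2, h'.2] with x h1 h2 hx
    rw [abs_mul, pow_zero, one_mul]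
    exact mul_le_mul (h1 hx) (h2 hx) (abs_nonneg _) hK
  | succ n ih =>
    have hp := h.pred
    have hq := h'.pred
    obtain ⟨h1, P', hP, h2⟩ := h
    obtain ⟨h1', Q', hQ, h2'⟩ := h'
    refine ⟨fun x hx => ?_, _, hP.mul hQ, ?_⟩
    · rw [abs_mul]
      refine (mul_le_mul (h1 x hx) (h1' x hx) (abs_nonneg _) hK).trans ?_
      exact le_mul_of_one_le_left (by positivity) (one_le_pow₀ (by norm_num))
    · rw [show (2 : ℝ) ^ (n + 1) * (K * K') = 2 ^ n * (K * K') + 2 ^ n * (K * K') by ring]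
      exact (ih h2 hq).add (ih hp h2')

theorem BddDerivs.abs_sub_le (h : BddDerivs c d K (n + 1) P) {x y : ℝ} (hx : x ∈ Ioo c d)
    (hy : y ∈ Ioo c d) : |P x - P y| ≤ K * |x - y| := by
  obtain ⟨-, P', hP, h2⟩ := h
  rw [hP.sub_eq (Ioo_subset_Icc_self hy) (Ioo_subset_Icc_self hx), ← Real.norm_eq_abs]
  refine intervalIntegral.norm_integral_le_of_norm_le_const_ae ?_
  filter_upwards [h2.ae_le] with t ht ht'
  refine ht ?_
  have := uIoc_subset_uIcc ht'
  exact (convex_Ioo c d).ordConnected.uIcc_subset hy hx this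

theorem bddDerivs_const (n : ℕ) (r : ℝ) : BddDerivs c d |r| n (fun _ => r) := by
  -- The derivative is the constant 0, so the induction must range over all constants of absolute
  -- value at most `|r|`.
  suffices H : ∀ n, ∀ s r : ℝ, |s| ≤ |r| → BddDerivs c d |r| n (fun _ => s) from H n r r le_rfl
  intro n
  induction n with
  | zero => exact fun s r h => ⟨aemeasurable_const, ae_of_all _ fun _ _ => h⟩
  | succ n ih =>
    exact fun s r h => ⟨fun _ _ => h, _, IsPrim.const s, ih 0 r (by simp)⟩

end BddDerivs

/-! ### Sobolev bounds along chains of primitives. -/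

section SobBound

variable {a b θ : ℝ} {S S' : ENNReal} {n : ℕ} {f g : ℝ → ℝ}

theorem SobBound.aemeasurable (h : SobBound θ a b S n f) :
    AEMeasurable f (volume.restrict (Ioo a b)) := by
  cases n with
  | zero => exact h.1
  | succ n =>
    obtain ⟨-, f', hf, -⟩ := h
    exact hf.integrableOn_left.aemeasurable

theorem SobBound.eLpNorm_le (h : SobBound θ a b S n f) :
    eLpNorm f 2 (volume.restrict (Ioo a b)) ≤ S := by
  cases n with
  | zero => exact h.2.1
  | succ n => exact h.1

theorem SobBound.mono (h : SobBound θ a b S n f) (hS : S ≤ S') : SobBound θ a b S' n f := by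
  induction n generalizing f with
  | zero => exact ⟨h.1, h.2.1.trans hS, fun h0 => (h.2.2 h0).trans hS⟩
  | succ n ih =>
    obtain ⟨h1, f', hf, h2⟩ := h
    exact ⟨h1.trans hS, f', hf, ih h2⟩

theorem SobBound.add (h : SobBound θ a b S n f) (h' : SobBound θ a b S' n g) :
    SobBound θ a b (S + S') n (fun x => f x + g x) := by
  have h3 : eLpNorm (fun x => f x + g x) 2 (volume.restrict (Ioo a b)) ≤ S + S' :=
    (eLpNorm_add_le h.aemeasurable.aestronglyMeasurable h'.aemeasurable.aestronglyMeasurable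
      (by norm_num)).trans (add_le_add h.eLpNorm_le h'.eLpNorm_le)
  induction n generalizing f g with
  | zero =>
    exact ⟨h.1.add h'.1, h3, fun h0 =>
      (gagliardo_add_le h.1 h'.1).trans (add_le_add (h.2.2 h0) (h'.2.2 h0))⟩
  | succ n ih =>
    obtain ⟨h1, f', hf, h2⟩ := h
    obtain ⟨h1', g', hg, h2'⟩ := h'
    exact ⟨h3, _, hf.add hg, ih h2 h2' ((eLpNorm_add_le h2.aemeasurable.aestronglyMeasurable
      h2'.aemeasurable.aestronglyMeasurable (by norm_num)).trans
      (add_le_add h2.eLpNorm_le h2'.eLpNorm_le))⟩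

/-- At the lower order the Gagliardo seminorm falls on a function whose derivative is in `L²`, so
the embedding bounds it. -/
theorem SobBound.pred {Λ : ℝ} (hθ0 : 0 ≤ θ) (hθ1 : θ < 1) (hab : a ≤ b) (hΛ : b - a ≤ Λ)
    (h : SobBound θ a b S (n + 1) f) :
    SobBound θ a b (ENNReal.ofReal (1 + embConst θ * Λ ^ (1 - θ)) * S) n f := by
  have hemb := embConst_pos hθ1
  have hΛ0 : 0 ≤ Λ := le_trans (by linarith) hΛ
  have hE : 0 ≤ embConst θ * Λ ^ (1 - θ) := mul_nonneg hemb.le (Real.rpow_nonneg hΛ0 _)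
  have hS : S ≤ ENNReal.ofReal (1 + embConst θ * Λ ^ (1 - θ)) * S :=
    le_mul_of_one_le_left' (ENNReal.one_le_ofReal.2 (by linarith))
  induction n generalizing f with
  | zero =>
    obtain ⟨h1, f', hf, h2⟩ := h
    refine ⟨hf.integrableOn_left.aemeasurable, h1.trans hS, fun h0 => ?_⟩
    refine (gagliardo_le_eLpNorm_deriv (lt_of_le_of_ne hθ0 (Ne.symm h0)) hθ1 hf).trans ?_
    refine mul_le_mul' (ENNReal.ofReal_le_ofReal ?_) h2.2.1
    have : (b - a) ^ (1 - θ) ≤ Λ ^ (1 - θ) :=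
      Real.rpow_le_rpow (by linarith) hΛ (by linarith)
    nlinarith
  | succ n ih =>
    obtain ⟨h1, f', hf, h2⟩ := h
    exact ⟨h1.trans hS, f', hf, ih h2⟩

theorem SobBound.exists_isWeakDeriv (hS : S ≠ ⊤) (h : SobBound θ a b S n f) :
    ∀ j ≤ n, ∃ g, IsWeakDeriv j a b f g ∧ eLpNorm g 2 (volume.restrict (Ioo a b)) ≤ S ∧
      (j = n → θ ≠ 0 → gagliardo θ a b g ≤ S) := by
  have hfint : LocallyIntegrableOn f (Ioo a b) := by
    have : MemLp f 2 (volume.restrict (Ioo a b)) :=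
      ⟨h.aemeasurable.aestronglyMeasurable, h.eLpNorm_le.trans_lt (lt_top_iff_ne_top.2 hS)⟩
    exact IntegrableOn.locallyIntegrableOn (this.integrable (by norm_num))
  induction n generalizing f with
  | zero =>
    intro j hj
    obtain rfl : j = 0 := by omega
    exact ⟨f, isWeakDeriv_zero_iff.2 ⟨hfint, by simp⟩, h.2.1, fun _ => h.2.2⟩
  | succ n ih =>
    intro j hj
    cases j with
    | zero => exact ⟨f, isWeakDeriv_zero_iff.2 ⟨hfint, by simp⟩, h.1, fun h => by omega⟩
    | succ j =>
      obtain ⟨h1, f', hf, h2⟩ := h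
      obtain ⟨g, hg1, hg2, hg3⟩ := ih h2 hf.1.locallyIntegrableOn j (by omega)
      exact ⟨g, hg1.succ_of_isPrim hf, hg2, fun h0 => hg3 (by omega)⟩

theorem SobBound.hNorm_le {r : ℝ} (hS : S ≠ ⊤) (h : SobBound (Int.fract r) a b S ⌊r⌋₊ f) :
    hNorm r a b f ≤ ENNReal.ofReal (⌊r⌋₊ + 2) * S := by
  have H := h.exists_isWeakDeriv hS
  refine CurvedEdge.hNorm_le (fun j hj => ?_) fun h0 => ?_
  · obtain ⟨g, hg1, hg2, -⟩ := H j hj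
    rwa [hSeminorm_natCast_eq hg1]
  · obtain ⟨g, hg1, -, hg3⟩ := H _ le_rfl
    rw [hSeminorm_eq hg1, if_neg h0]
    exact hg3 rfl h0

theorem sobBound_of_chain {r : ℝ} (hr : 0 ≤ r) {F : ℕ → ℝ → ℝ}
    (h1 : ∀ j < ⌊r⌋₊, IsPrim a b (F j) (F (j + 1)))
    (h2 : ∀ j ≤ ⌊r⌋₊, IsWeakDeriv j a b f (F j)) :
    SobBound (Int.fract r) a b (hNorm r a b f) ⌊r⌋₊ (F 0) := by
  have hL : ∀ j ≤ ⌊r⌋₊, eLpNorm (F j) 2 (volume.restrict (Ioo a b)) ≤ hNorm r a b f :=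
    fun j hj => by
      rw [← hSeminorm_natCast_eq (h2 j hj)]
      exact hSeminorm_natCast_le_hNorm hj
  suffices H : ∀ i j, i + j = ⌊r⌋₊ → SobBound (Int.fract r) a b (hNorm r a b f) i (F j) from
    H _ 0 (by simp)
  intro i
  induction i with
  | zero =>
    intro j hj
    rw [zero_add] at hj
    subst hj
    refine ⟨(h2 _ le_rfl).2.1.aestronglyMeasurable.aemeasurable, hL _ le_rfl, fun h0 => ?_⟩
    have := hSeminorm_eq (h2 _ le_rfl)
    rw [if_neg h0] at this
    rw [← this]
    exact hSeminorm_le_hNorm hr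
  | succ i ih =>
    intro j hj
    exact ⟨hL j (by omega), F (j + 1), h1 j (by omega), ih (j + 1) (by omega)⟩

end SobBound

/-- An increasing change of variables `φ : [c, d] → [a, b]` with derivative `φ'` between `1 / M`
and `M`. -/
structure IsChange (M a b c d : ℝ) (φ φ' : ℝ → ℝ) : Prop where
  lt : c < d
  one_le : 1 ≤ M
  left : φ c = a
  right : φ d = b
  continuousOn : ContinuousOn φ (Icc c d)
  hasDerivAt : ∀ x ∈ Ioo c d, HasDerivAt φ (φ' x) x
  one_le_mul : ∀ x ∈ Ioo c d, 1 ≤ M * φ' x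
  le : ∀ x ∈ Ioo c d, φ' x ≤ M

namespace IsChange

variable {M a b c d : ℝ} {φ φ' f f' : ℝ → ℝ}

theorem deriv_pos (h : IsChange M a b c d φ φ') {x : ℝ} (hx : x ∈ Ioo c d) : 0 < φ' x := by
  have h1 := h.one_le_mul x hx
  have h2 := h.one_le
  by_contra h3
  nlinarith

theorem strictMonoOn (h : IsChange M a b c d φ φ') : StrictMonoOn φ (Icc c d) := by
  refine strictMonoOn_of_deriv_pos (convex_Icc c d) h.continuousOn fun x hx => ?_
  rw [interior_Icc] at hx
  rw [(h.hasDerivAt x hx).deriv]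
  exact h.deriv_pos hx

theorem injOn (h : IsChange M a b c d φ φ') : InjOn φ (Ioo c d) :=
  h.strictMonoOn.injOn.mono Ioo_subset_Icc_self

theorem mapsTo (h : IsChange M a b c d φ φ') : MapsTo φ (Ioo c d) (Ioo a b) := by
  intro x hx
  rw [← h.left, ← h.right]
  exact ⟨h.strictMonoOn ⟨le_rfl, h.lt.le⟩ (Ioo_subset_Icc_self hx) hx.1,
    h.strictMonoOn (Ioo_subset_Icc_self hx) ⟨h.lt.le, le_rfl⟩ hx.2⟩

theorem mapsTo_Icc (h : IsChange M a b c d φ φ') : MapsTo φ (Icc c d) (Icc a b) := by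
  intro x hx
  rw [← h.left, ← h.right]
  exact ⟨h.strictMonoOn.monotoneOn ⟨le_rfl, h.lt.le⟩ hx hx.1,
    h.strictMonoOn.monotoneOn hx ⟨h.lt.le, le_rfl⟩ hx.2⟩

theorem one_le_mul_abs (h : IsChange M a b c d φ φ') : ∀ x ∈ Ioo c d, 1 ≤ M * |φ' x| :=
  fun x hx => by rw [abs_of_pos (h.deriv_pos hx)]; exact h.one_le_mul x hx

theorem abs_sub_le (h : IsChange M a b c d φ φ') :
    ∀ x ∈ Ioo c d, ∀ y ∈ Ioo c d, |φ x - φ y| ≤ M * |x - y| := fun x hx y hy =>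
  (convex_Ioo c d).norm_image_sub_le_of_norm_hasDerivWithin_le
    (fun t ht => (h.hasDerivAt t ht).hasDerivWithinAt)
    (fun t ht => by rw [Real.norm_eq_abs, abs_of_pos (h.deriv_pos ht)]; exact h.le t ht) hy hx

/-- Substitution along a monotone map needs only integrability of `f'`, not continuity. -/
theorem isPrim_comp (h : IsChange M a b c d φ φ') (hf : IsPrim a b f f') :
    IsPrim c d (fun x => f (φ x)) (fun x => f' (φ x) * φ' x) := by
  have hcd := h.lt.le
  have key : ∀ x ∈ Icc c d, ContinuousOn φ (uIcc c x) ∧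
      (∀ y ∈ Ioo (min c x) (max c x), HasDerivAt φ (φ' y) y) ∧
      ∀ y ∈ Ioo (min c x) (max c x), 0 ≤ φ' y := by
    intro x hx
    have h0 : ∀ y ∈ Ioo (min c x) (max c x), y ∈ Ioo c d := fun y hy => by
      rw [min_eq_left hx.1, max_eq_right hx.1] at hy
      exact ⟨hy.1, hy.2.trans_le hx.2⟩
    refine ⟨h.continuousOn.mono ?_, fun y hy => h.hasDerivAt y (h0 y hy),
      fun y hy => (h.deriv_pos (h0 y hy)).le⟩
    rw [uIcc_of_le hx.1]
    exact Icc_subset_Icc_right hx.2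
  constructor
  · obtain ⟨k1, k2, k3⟩ := key d ⟨hcd, le_rfl⟩
    have := (intervalIntegral.integrable_deriv_smul_comp_iff_of_deriv_nonneg (g := f') k1 k2 k3).2
      (by rw [h.left, h.right]
          refine hf.intervalIntegrable ?_
          rw [← h.left, ← h.right]
          exact h.strictMonoOn.monotoneOn ⟨le_rfl, hcd⟩ ⟨hcd, le_rfl⟩ hcd)
    refine ((intervalIntegrable_iff_integrableOn_Ioo_of_le hcd).1 this).congr ?_
    exact ae_of_all _ fun x => by simp [mul_comm]
  · intro x hx
    obtain ⟨k1, k2, k3⟩ := key x hx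
    have h1 := intervalIntegral.integral_deriv_smul_comp_of_deriv_nonneg (g := f') k1 k2 k3
    have h2 := hf.2 (φ x) (h.mapsTo_Icc hx)
    rw [h.left] at h1
    simp only [h2, h.left]
    rw [← h1]
    congr 1
    refine intervalIntegral.integral_congr fun t _ => ?_
    simp [mul_comm]

end IsChange

/-- The weight `P` closes the induction: the derivative of `(f ∘ φ) P` is `(f' ∘ φ)(φ' P) + (f ∘ φ)
P'`, two terms of the same form at order `n`, where in the second `f` is taken at that order by
`SobBound.pred`. For `θ ≠ 0` the weight has one more bounded derivative, because the fractional
product rule asks for a Lipschitz factor. The equation for `R` says, without truncated subtraction,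
that `φ'` has one bounded derivative fewer than `P`. -/
theorem exists_sobBound_comp_mul (θ M Λ : ℝ) (hθ0 : 0 ≤ θ) (hθ1 : θ < 1) (n : ℕ) :
    ∀ K : ℝ, 0 ≤ K → ∃ C : ℝ, 0 ≤ C ∧ ∀ (a b c d : ℝ) (φ φ' f P : ℝ → ℝ) (S : ENNReal),
      IsChange M a b c d φ φ' → b - a ≤ Λ → d - c ≤ Λ →
      (∀ R, R + 1 = n + (if θ = 0 then 0 else 1) → BddDerivs c d M R φ') →
      SobBound θ a b S n f → BddDerivs c d K (n + (if θ = 0 then 0 else 1)) P →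
      SobBound θ c d (ENNReal.ofReal C * S) n (fun x => f (φ x) * P x) := by
  have hL2 : ∀ (K : ℝ) (n m : ℕ) (a b c d : ℝ) (φ φ' f P : ℝ → ℝ) (S : ENNReal), 0 ≤ K →
      IsChange M a b c d φ φ' → SobBound θ a b S n f → BddDerivs c d K m P →
      eLpNorm (fun x => f (φ x) * P x) 2 (volume.restrict (Ioo c d)) ≤
        ENNReal.ofReal (K * M) * S := by
    intro K n m a b c d φ φ' f P S hK hφ hf hP
    have h1 : eLpNorm (fun x => f (φ x) * P x) 2 (volume.restrict (Ioo c d)) ≤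
        ENNReal.ofReal K * eLpNorm (fun x => f (φ x)) 2 (volume.restrict (Ioo c d)) := by
      refine eLpNorm_le_mul_eLpNorm_of_ae_le_mul ?_ _
      rw [ae_restrict_iff' measurableSet_Ioo]
      filter_upwards [hP.ae_le] with x hx hx'
      rw [norm_mul, mul_comm]
      exact mul_le_mul_of_nonneg_right (hx hx') (norm_nonneg _)
    refine h1.trans ?_
    rw [ENNReal.ofReal_mul hK, mul_assoc]
    gcongr
    exact (eLpNorm_comp_le hφ.hasDerivAt hφ.one_le_mul_abs hφ.one_le hφ.injOn hφ.mapsTo f).trans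
      (mul_le_mul_right hf.eLpNorm_le _)
  induction n with
  | zero =>
    intro K hK
    -- Signs of `M` and `Λ` are known only once a change of variables is given; absolute values keep
    -- the constant nonnegative before that.
    refine ⟨|K * M| + |K * M ^ 3 + K * mulConst θ * Λ ^ (1 - θ) * M|, by positivity, ?_⟩
    intro a b c d φ φ' f P S hφ hΛ hΛ' _ hf hP
    have hM0 : 0 ≤ M := by linarith [hφ.one_le]
    have hfφ := aemeasurable_comp hφ.hasDerivAt hφ.one_le_mul_abs hφ.injOn hφ.mapsTo hf.1
    refine ⟨hfφ.mul hP.aemeasurable, ?_, fun h0 => ?_⟩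
    · refine (hL2 K 0 _ a b c d φ φ' f P S hK hφ hf hP).trans ?_
      gcongr
      exact (le_abs_self _).trans (le_add_of_nonneg_right (abs_nonneg _))
    · rw [if_neg h0] at hP
      have hdc : 0 ≤ d - c := by linarith [hφ.lt]
      have hmc : 0 ≤ mulConst θ := Real.rpow_nonneg (div_nonneg (by norm_num) (by linarith)) _
      have hpw : (d - c) ^ (1 - θ) ≤ Λ ^ (1 - θ) := Real.rpow_le_rpow hdc hΛ' (by linarith)
      have hpw0 : 0 ≤ (d - c) ^ (1 - θ) := Real.rpow_nonneg hdc _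
      have hθp : 0 < θ := lt_of_le_of_ne hθ0 (Ne.symm h0)
      refine (gagliardo_mul_le hθ1 hK hfφ hP.aemeasurable hP.1
        (fun x hx y hy => hP.abs_sub_le hx hy)).trans ?_
      have g1 := (gagliardo_comp_le hθp hθ1 hφ.hasDerivAt hφ.one_le_mul_abs hφ.one_le hφ.injOn
        hφ.mapsTo hφ.abs_sub_le f).trans (mul_le_mul_right (hf.2.2 h0) _)
      have g2 := (eLpNorm_comp_le hφ.hasDerivAt hφ.one_le_mul_abs hφ.one_le hφ.injOn
        hφ.mapsTo f).trans (mul_le_mul_right hf.2.1 _)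
      calc _ ≤ ENNReal.ofReal K * (ENNReal.ofReal (M ^ 3) * S) +
            ENNReal.ofReal (K * mulConst θ * Λ ^ (1 - θ)) * (ENNReal.ofReal M * S) := by
              gcongr
        _ = ENNReal.ofReal (K * M ^ 3 + K * mulConst θ * Λ ^ (1 - θ) * M) * S := by
            have hΛp : 0 ≤ Λ ^ (1 - θ) := hpw0.trans hpw
            rw [ENNReal.ofReal_add (by positivity) (by positivity), add_mul,
              ENNReal.ofReal_mul hK, ENNReal.ofReal_mul (q := M) (by positivity)]
            simp only [mul_assoc]
        _ ≤ _ := by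
            refine mul_le_mul_left (ENNReal.ofReal_le_ofReal ?_) _
            have := le_abs_self (K * M ^ 3 + K * mulConst θ * Λ ^ (1 - θ) * M)
            linarith [abs_nonneg (K * M)]
  | succ n ih =>
    intro K hK
    set e := if θ = 0 then 0 else 1 with he
    obtain ⟨C1, hC1, H1⟩ := ih K hK
    -- The bound of the new weight `φ' P`, by the product rule.
    obtain ⟨C2, hC2, H2⟩ := ih (2 ^ (n + e) * (|M| * K)) (by positivity)
    set Q := 1 + embConst θ * Λ ^ (1 - θ) with hQ
    refine ⟨C2 + C1 * |Q| + |K * M|, by positivity, ?_⟩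
    intro a b c d φ φ' f P S hφ hΛ hΛ' hφ' hf hP
    have hM0 : 0 ≤ M := by linarith [hφ.one_le]
    have hab : a ≤ b := by
      rw [← hφ.left, ← hφ.right]
      exact hφ.strictMonoOn.monotoneOn ⟨le_rfl, hφ.lt.le⟩ ⟨hφ.lt.le, le_rfl⟩ hφ.lt.le
    have hφ'n : BddDerivs c d M (n + e) φ' := hφ' (n + e) (by omega)
    have hφ'r : ∀ R, R + 1 = n + e → BddDerivs c d M R φ' :=
      fun R hR => hφ'n.of_le (by omega)
    have hfp := hf.pred hθ0 hθ1 hab hΛ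
    have hP0 := hP
    rw [show n + 1 + e = n + e + 1 by ring] at hP
    have hPp := hP.pred
    have hf0 := hf
    obtain ⟨-, f', hf1, hf2⟩ := hf
    obtain ⟨-, P', hP1, hP2⟩ := hP
    refine ⟨(hL2 K _ _ a b c d φ φ' f P S hK hφ hf0 hP0).trans ?_, _,
      (hφ.isPrim_comp hf1).mul hP1, ?_⟩
    · gcongr
      have := le_abs_self (K * M)
      have : 0 ≤ C1 * |Q| := by positivity
      linarith
    · have hm := BddDerivs.mul hM0 hK hφ'n hPp
      rw [← abs_of_nonneg hM0] at hm
      have s2 := H2 a b c d φ φ' f' _ S hφ hΛ hΛ' hφ'r hf2 hm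
      have s1 := H1 a b c d φ φ' f P' _ hφ hΛ hΛ' hφ'r hfp hP2
      have s3 := (s2.add s1).mono (S' := ENNReal.ofReal (C2 + C1 * |Q| + |K * M|) * S) (by
        rw [← mul_assoc, ← ENNReal.ofReal_mul hC1, ← add_mul]
        gcongr
        refine (add_le_add_right (ENNReal.ofReal_le_ofReal
          (mul_le_mul_of_nonneg_left (le_abs_self Q) hC1)) _).trans ?_
        rw [← ENNReal.ofReal_add hC2 (by positivity)]
        refine ENNReal.ofReal_le_ofReal ?_
        linarith [abs_nonneg (K * M)])
      simpa only [mul_assoc] using s3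

/-- A continuous function with finite `W^{n,∞}` norm, `n ≥ 1`, is a primitive of a function with
bounded derivatives. -/
theorem exists_bddDerivs_of_wInftyNorm_le {n : ℕ} {c d M : ℝ} {φ : ℝ → ℝ} (hcd : c < d)
    (hM : 0 ≤ M) (hφ : ContinuousOn φ (Icc c d))
    (h : wInftyNorm (n + 1) c d φ ≤ ENNReal.ofReal M) :
    (∀ x ∈ Icc c d, |φ x| ≤ M) ∧ ∃ φ', IsPrim c d φ φ' ∧ BddDerivs c d M n φ' := by
  have h1 : ∀ j ≤ n + 1, (⨅ (g : ℝ → ℝ) (_ : IsWeakDeriv j c d φ g),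
      eLpNorm g ⊤ (volume.restrict (Ioo c d))) ≤ ENNReal.ofReal M := fun j hj =>
    (Finset.le_sup (f := fun j => ⨅ (g : ℝ → ℝ) (_ : IsWeakDeriv j c d φ g),
      eLpNorm g ⊤ (volume.restrict (Ioo c d))) (Finset.mem_range.2 (Nat.lt_succ_of_le hj))).trans h
  have h2 : ∀ j, ∃ D, j ≤ n + 1 → IsWeakDeriv j c d φ D := by
    intro j
    by_cases hj : j ≤ n + 1
    · have h3 := (h1 j hj).trans_lt ENNReal.ofReal_lt_top
      simp only [iInf_lt_top] at h3
      obtain ⟨D, hD, -⟩ := h3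
      exact ⟨D, fun _ => hD⟩
    · exact ⟨0, fun h => absurd h hj⟩
  choose D hD using h2
  have hb : ∀ j ≤ n + 1, ∀ g, IsWeakDeriv j c d φ g →
      ∀ᵐ x, x ∈ Ioo c d → |g x| ≤ M := by
    intro j hj g hg
    have h3 : eLpNorm g ⊤ (volume.restrict (Ioo c d)) ≤ ENNReal.ofReal M := by
      refine le_trans (le_iInf₂ fun g' hg' => le_of_eq ?_) (h1 j hj)
      exact eLpNorm_congr_ae ((ae_restrict_iff' measurableSet_Ioo).2 (hg.ae_eq hg'))
    rw [eLpNorm_exponent_top] at h3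
    rw [← ae_restrict_iff' measurableSet_Ioo]
    filter_upwards [ae_le_eLpNormEssSup (f := g) (μ := volume.restrict (Ioo c d))] with x hx
    have h4 := hx.trans h3
    rw [← ofReal_norm] at h4
    exact (ENNReal.ofReal_le_ofReal_iff hM).1 h4
  have hfint : ∀ j ≤ n + 1, IntegrableOn (D j) (Ioo c d) := by
    intro j hj
    refine IntegrableOn.of_bound (by simp) (hD j hj).2.1.aestronglyMeasurable M ?_
    exact (ae_restrict_iff' measurableSet_Ioo).2 (hb j hj _ (hD j hj))
  obtain ⟨F, hF0, hF1, hF2⟩ := exists_isPrim_chain hcd hφ D hD hfint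
  have hcont : ∀ {g : ℝ → ℝ}, ContinuousOn g (Icc c d) → (∀ᵐ x, x ∈ Ioo c d → |g x| ≤ M) →
      ∀ x ∈ Icc c d, |g x| ≤ M := by
    intro g hg hgb
    -- For a continuous `g` the almost everywhere bound holds everywhere: the maximum with `M` is
    -- continuous and equals `M` almost everywhere.
    have h3 : EqOn (fun x => max |g x| M) (fun _ => M) (Icc c d) := by
      refine Measure.eqOn_Icc_of_ae_eq volume hcd.ne ?_ (hg.abs.sup continuousOn_const)
        continuousOn_const
      rw [← Measure.restrict_congr_set Ioo_ae_eq_Icc]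
      rw [Filter.EventuallyEq, ae_restrict_iff' measurableSet_Ioo]
      filter_upwards [hgb] with x hx hx' using max_eq_right (hx hx')
    exact fun x hx => max_eq_right_iff.1 (h3 hx)
  have hFb := fun j hj => hb j hj _ (hF2 j hj)
  refine ⟨fun x hx => ?_, F 1, (hF1 0 (by omega)).congr hF0.symm (by simp), ?_⟩
  · rw [← hF0 hx]
    exact hcont (hF1 0 (by omega)).continuousOn (hFb 0 (by omega)) x hx
  · suffices H : ∀ i j, i + j = n + 1 → BddDerivs c d M i (F j) from H n 1 rfl
    intro i
    induction i with
    | zero =>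
      intro j hj
      exact ⟨(hF2 j (by omega)).2.1.aestronglyMeasurable.aemeasurable, hFb j (by omega)⟩
    | succ i ih =>
      intro j hj
      exact ⟨fun x hx => hcont (hF1 j (by omega)).continuousOn (hFb j (by omega)) x
        (Ioo_subset_Icc_self hx), F (j + 1), hF1 j (by omega), ih (j + 1) (by omega)⟩

/-- A continuous function with finite `W^{n,∞}` norm, `n ≥ 2`, that is bounded below by a
multiple of the identity is a change of variables. -/
theorem exists_isChange {n : ℕ} {c d M : ℝ} {φ : ℝ → ℝ} (hcd : c < d)
    (hM : 1 ≤ M) (hφ : ContinuousOn φ (Icc c d))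
    (h : wInftyNorm (n + 2) c d φ ≤ ENNReal.ofReal M)
    (hlow : ∀ x ∈ Icc c d, ∀ y ∈ Icc c d, x ≤ y → y - x ≤ M * (φ y - φ x)) :
    ∃ φ', IsChange M (φ c) (φ d) c d φ φ' ∧ BddDerivs c d M (n + 1) φ' := by
  obtain ⟨-, φ', h1, h2⟩ := exists_bddDerivs_of_wInftyNorm_le hcd (by linarith) hφ h
  have hcont : ContinuousOn φ' (Icc c d) := by
    obtain ⟨-, φ'', h3, -⟩ := h2
    exact h3.continuousOn
  have hder : ∀ x ∈ Ioo c d, HasDerivAt φ (φ' x) x := by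
    intro x hx
    have hI := h1.intervalIntegrable_of_mem ⟨le_rfl, hcd.le⟩ (Ioo_subset_Icc_self hx)
    have h3 := intervalIntegral.integral_hasDerivAt_right hI
      ((hcont.mono Ioo_subset_Icc_self).stronglyMeasurableAtFilter isOpen_Ioo x hx) (hcont.continuousAt (Icc_mem_nhds hx.1 hx.2))
    refine (h3.const_add (φ c)).congr_of_eventuallyEq ?_
    filter_upwards [Icc_mem_nhds hx.1 hx.2] with y hy using h1.2 y hy
  refine ⟨φ', ⟨hcd, hM, rfl, rfl, hφ, hder, fun x hx => ?_, fun x hx => ?_⟩, h2⟩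
  -- By `hlow` this function is monotone, so its derivative is nonnegative.
  · have h3 : HasDerivWithinAt (fun t => M * φ t - t) (M * φ' x - 1) (Ioo c d) x :=
      ((hder x hx).const_mul M |>.sub (hasDerivAt_id x)).hasDerivWithinAt
    have h4 := h3.nonneg_of_monotoneOn ?_ (fun y hy z hz hyz => by
      have := hlow y (Ioo_subset_Icc_self hy) z (Ioo_subset_Icc_self hz) hyz
      simp only
      linarith)
    · linarith
    · exact isOpen_Ioo.preperfect x hx
  · exact (le_abs_self _).trans (h2.1 x hx)

/-- Changes of variables preserve the Sobolev spaces. -/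
theorem exists_hNorm_comp_le (r : ℝ) (hr : 0 ≤ r) (n : ℕ) (hn : ⌈r⌉₊ ≤ n + 2) (M : ℝ)
    (hM : 1 ≤ M) :
    ∃ C : ℝ, 0 ≤ C ∧ ∀ (a b c d : ℝ) (φ f : ℝ → ℝ), c < d → φ c = a → φ d = b →
      b - a ≤ 2 * M → d - c ≤ 2 * M → ContinuousOn φ (Icc c d) →
      wInftyNorm (n + 2) c d φ ≤ ENNReal.ofReal M →
      (∀ x ∈ Icc c d, ∀ y ∈ Icc c d, x ≤ y → y - x ≤ M * (φ y - φ x)) →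
      ContinuousOn f (Icc a b) → hNorm r a b f < ⊤ →
      hNorm r c d (fun x => f (φ x)) ≤ ENNReal.ofReal C * hNorm r a b f := by
  obtain ⟨C, hC, H⟩ := exists_sobBound_comp_mul (Int.fract r) M (2 * M) (Int.fract_nonneg r)
    (Int.fract_lt_one r) ⌊r⌋₊ 1 (by norm_num)
  refine ⟨(⌊r⌋₊ + 2) * C, by positivity, ?_⟩
  intro a b c d φ f hcd hc hd hba hdc hφ hφM hlow hf hfr
  obtain ⟨φ', h1, h2⟩ := exists_isChange hcd hM hφ hφM hlow
  rw [hc, hd] at h1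
  have hab : a < b := by
    rw [← hc, ← hd]
    exact h1.strictMonoOn ⟨le_rfl, hcd.le⟩ ⟨hcd.le, le_rfl⟩ hcd
  obtain ⟨F, hF0, hF1, hF2⟩ := exists_chain_of_hNorm_lt_top hab hf hfr
  have hS := sobBound_of_chain hr hF1 fun j hj => (hF2 j hj).1
  -- The number of derivatives of `φ` that the composition consumes is at most `⌈r⌉₊`.
  have hfloor : ⌊r⌋₊ + (if Int.fract r = 0 then 0 else 1) ≤ ⌈r⌉₊ := by
    split_ifs with h0
    · exact Nat.floor_le_ceil r
    · have h3 := natFloor_add_fract hr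
      have h4 := lt_of_le_of_ne (Int.fract_nonneg r) (Ne.symm h0)
      have h5 := Nat.le_ceil r
      have h6 : (⌊r⌋₊ : ℝ) < ⌈r⌉₊ := by linarith
      exact_mod_cast h6
  have h3 := H a b c d φ φ' (F 0) (fun _ => 1) _ h1 hba hdc
    (fun R hR => h2.of_le (by omega)) hS (by simpa using bddDerivs_const _ 1)
  have h4 := h3.hNorm_le (ENNReal.mul_ne_top ENNReal.ofReal_ne_top hfr.ne)
  rw [← mul_assoc, ← ENNReal.ofReal_mul (by positivity)] at h4
  refine le_trans (le_of_eq (hNorm_congr fun x hx => ?_)) h4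
  rw [mul_one, hF0 (h1.mapsTo_Icc (Ioo_subset_Icc_self hx))]

/-! ## The natural parameter -/

section NaturalParameter

variable {p : ℕ} {γ : ℝ → EuclideanSpace ℝ (Fin 2)} {a b : ℝ}

theorem IsRegularParam.continuousOn_speed (h : IsRegularParam (p + 1) γ a b) :
    ContinuousOn (fun t => ‖derivWithin γ (Icc a b) t‖) (Icc a b) :=
  (h.contDiffOn.continuousOn_derivWithin (uniqueDiffOn_Icc h.lt) (by simp)).norm

theorem IsRegularParam.hasDerivAt (h : IsRegularParam (p + 1) γ a b) {t : ℝ} (ht : t ∈ Ioo a b) :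
    HasDerivAt γ (derivWithin γ (Icc a b) t) t :=
  ((h.contDiffOn.differentiableOn (by simp)) t
    (Ioo_subset_Icc_self ht)).hasDerivWithinAt.hasDerivAt (Icc_mem_nhds ht.1 ht.2)

theorem IsRegularParam.isPrim_zeta (h : IsRegularParam (p + 1) γ a b) :
    IsPrim a b (zeta γ a b) (fun t => ‖derivWithin γ (Icc a b) t‖) :=
  ⟨h.continuousOn_speed.integrableOn_Icc.mono_set Ioo_subset_Icc_self, fun x _ => by
    simp [zeta]⟩

theorem zeta_left : zeta γ a b a = 0 := by simp [zeta]

/-- The speed has a positive minimum by compactness. This `κ` depends on `γ` and serves only to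
invert `ζ` continuously; it enters no constant of the estimates. -/
theorem IsRegularParam.exists_le_zeta_sub (h : IsRegularParam (p + 1) γ a b) :
    ∃ κ : ℝ, 0 < κ ∧ ∀ x ∈ Icc a b, ∀ y ∈ Icc a b, x ≤ y →
      κ * (y - x) ≤ zeta γ a b y - zeta γ a b x := by
  obtain ⟨t, ht, hmin⟩ := isCompact_Icc.exists_isMinOn (nonempty_Icc.2 h.lt.le)
    h.continuousOn_speed
  refine ⟨_, norm_pos_iff.2 (h.deriv_ne_zero t ht), fun x hx y hy hxy => ?_⟩
  rw [h.isPrim_zeta.sub_eq hx hy, mul_comm, ← smul_eq_mul, ← intervalIntegral.integral_const]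
  exact intervalIntegral.integral_mono_on hxy intervalIntegrable_const
    (h.isPrim_zeta.intervalIntegrable_of_mem hx hy) fun τ hτ =>
      hmin ⟨hx.1.trans hτ.1, hτ.2.trans hy.2⟩

theorem IsRegularParam.strictMonoOn_zeta (h : IsRegularParam (p + 1) γ a b) :
    StrictMonoOn (zeta γ a b) (Icc a b) := by
  obtain ⟨κ, hκ, H⟩ := h.exists_le_zeta_sub
  intro x hx y hy hxy
  have := H x hx y hy hxy.le
  nlinarith

theorem IsRegularParam.edgeLength_pos (h : IsRegularParam (p + 1) γ a b) :
    0 < edgeLength γ a b := by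
  rw [← zeta_left (γ := γ) (a := a) (b := b)]
  exact h.strictMonoOn_zeta ⟨le_rfl, h.lt.le⟩ ⟨h.lt.le, le_rfl⟩ h.lt

theorem IsRegularParam.zeta_mem (h : IsRegularParam (p + 1) γ a b) {t : ℝ} (ht : t ∈ Icc a b) :
    zeta γ a b t ∈ Icc 0 (edgeLength γ a b) := by
  refine ⟨?_, h.strictMonoOn_zeta.monotoneOn ht ⟨h.lt.le, le_rfl⟩ ht.2⟩
  rw [← zeta_left (γ := γ) (a := a) (b := b)]
  exact h.strictMonoOn_zeta.monotoneOn ⟨le_rfl, h.lt.le⟩ ht ht.1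

theorem IsRegularParam.mem_image_zeta (h : IsRegularParam (p + 1) γ a b) {y : ℝ}
    (hy : y ∈ Icc 0 (edgeLength γ a b)) : ∃ t ∈ Icc a b, zeta γ a b t = y := by
  have h1 := intermediate_value_Icc h.lt.le h.isPrim_zeta.continuousOn
  rw [zeta_left] at h1
  exact h1 hy

theorem IsRegularParam.zetaInv_mem (h : IsRegularParam (p + 1) γ a b) {y : ℝ}
    (hy : y ∈ Icc 0 (edgeLength γ a b)) : zetaInv γ a b y ∈ Icc a b :=
  Function.invFunOn_mem (h.mem_image_zeta hy)

theorem IsRegularParam.zeta_zetaInv (h : IsRegularParam (p + 1) γ a b) {y : ℝ}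
    (hy : y ∈ Icc 0 (edgeLength γ a b)) : zeta γ a b (zetaInv γ a b y) = y :=
  Function.invFunOn_eq (h.mem_image_zeta hy)

theorem IsRegularParam.zetaInv_zeta (h : IsRegularParam (p + 1) γ a b) {t : ℝ}
    (ht : t ∈ Icc a b) : zetaInv γ a b (zeta γ a b t) = t :=
  h.strictMonoOn_zeta.injOn (h.zetaInv_mem (h.zeta_mem ht)) ht
    (h.zeta_zetaInv (h.zeta_mem ht))

theorem IsRegularParam.zetaInv_mono (h : IsRegularParam (p + 1) γ a b) :
    MonotoneOn (zetaInv γ a b) (Icc 0 (edgeLength γ a b)) := by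
  intro x hx y hy hxy
  refine (h.strictMonoOn_zeta.le_iff_le (h.zetaInv_mem hx) (h.zetaInv_mem hy)).1 ?_
  rwa [h.zeta_zetaInv hx, h.zeta_zetaInv hy]

theorem IsRegularParam.continuousOn_zetaInv (h : IsRegularParam (p + 1) γ a b) :
    ContinuousOn (zetaInv γ a b) (Icc 0 (edgeLength γ a b)) := by
  obtain ⟨κ, hκ, H⟩ := h.exists_le_zeta_sub
  have key : ∀ x ∈ Icc 0 (edgeLength γ a b), ∀ y ∈ Icc 0 (edgeLength γ a b), x ≤ y →
      |zetaInv γ a b x - zetaInv γ a b y| ≤ κ⁻¹ * |x - y| := by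
    intro x hx y hy hxy
    have h1 := h.zetaInv_mono hx hy hxy
    have h2 := H _ (h.zetaInv_mem hx) _ (h.zetaInv_mem hy) h1
    rw [h.zeta_zetaInv hx, h.zeta_zetaInv hy] at h2
    rw [abs_sub_comm, abs_of_nonneg (by linarith), abs_sub_comm, abs_of_nonneg (by linarith),
      inv_mul_eq_div, le_div_iff₀ hκ]
    linarith
  refine (LipschitzOnWith.of_dist_le_mul (K := ⟨κ⁻¹, by positivity⟩) fun x hx y hy => ?_).continuousOn
  rw [Real.dist_eq, Real.dist_eq]
  rcases le_total x y with hxy | hxy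
  · exact key x hx y hy hxy
  · rw [abs_sub_comm, abs_sub_comm x]
    exact key y hy x hx hxy

theorem IsRegularParam.zetaInv_zero (h : IsRegularParam (p + 1) γ a b) :
    zetaInv γ a b 0 = a := by
  have := h.zetaInv_zeta (t := a) ⟨le_rfl, h.lt.le⟩
  rwa [zeta_left] at this

theorem IsRegularParam.zetaInv_edgeLength (h : IsRegularParam (p + 1) γ a b) :
    zetaInv γ a b (edgeLength γ a b) = b :=
  h.zetaInv_zeta (t := b) ⟨h.lt.le, le_rfl⟩

end NaturalParameter

/-! ## The length of an edge of a star-shaped domain -/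

section Length

variable {E : Set (EuclideanSpace ℝ (Fin 2))} {c : EuclideanSpace ℝ (Fin 2)} {r : ℝ}

/-- Replace `x` by a nearby `x'` in `E`. The point is also on the segment from `x'` to the centre `q
+ (τ⁻¹ - 1)(x - x')`, which stays in the open ball for `x'` close to `x`. -/
theorem mem_of_starConvex_ball (hE : ∀ y ∈ Metric.ball c r, StarConvex ℝ y E)
    {x q : EuclideanSpace ℝ (Fin 2)} (hx : x ∈ closure E) (hq : q ∈ Metric.ball c r)
    {τ : ℝ} (hτ : 0 < τ) (hτ1 : τ ≤ 1) : x + τ • (q - x) ∈ E := by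
  have hcont : Continuous fun x' : EuclideanSpace ℝ (Fin 2) => q + (τ⁻¹ - 1) • (x - x') := by
    fun_prop
  have hopen : IsOpen ((fun x' : EuclideanSpace ℝ (Fin 2) => q + (τ⁻¹ - 1) • (x - x')) ⁻¹'
      Metric.ball c r) := Metric.isOpen_ball.preimage hcont
  obtain ⟨x', hx', hx'E⟩ := mem_closure_iff.1 hx _ hopen (by simpa using hq)
  have h1 := (hE _ hx') hx'E hτ.le (show (0 : ℝ) ≤ 1 - τ by linarith) (by ring)
  convert h1 using 1
  rw [smul_add, smul_smul, mul_sub, mul_inv_cancel₀ hτ.ne']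
  module

/-- For `τ > 0` the point `z` would lie in the open set `E`; for `τ < 0` the point `x` lies between
`z` and `q`, and the same applies with the roles exchanged. -/
theorem eq_zero_of_frontier (hEo : IsOpen E) (hE : ∀ y ∈ Metric.ball c r, StarConvex ℝ y E)
    {x z q : EuclideanSpace ℝ (Fin 2)} (hx : x ∈ frontier E) (hz : z ∈ frontier E)
    (hq : q ∈ Metric.ball c r) {τ : ℝ} (hτ1 : τ ≤ 1) (h : z = x + τ • (q - x)) : τ = 0 := by
  rw [hEo.frontier_eq] at hx hz
  rcases lt_trichotomy τ 0 with h0 | h0 | h0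
  · exfalso
    refine hx.2 ?_
    have h1 : 0 < 1 - τ := by linarith
    have h2 := mem_of_starConvex_ball hE hz.1 hq (τ := -τ / (1 - τ)) (by
      apply div_pos <;> linarith) (by rw [div_le_one h1]; linarith)
    convert h2 using 1
    have e1 : -τ / (1 - τ) = 1 - (1 - τ)⁻¹ := by field_simp; ring
    have e2 : q - z = (1 - τ) • (q - x) := by rw [h]; module
    rw [e2, e1, h, smul_smul, sub_mul, inv_mul_cancel₀ h1.ne']
    module
  · exact h0
  · exact absurd (h ▸ mem_of_starConvex_ball hE hx.1 hq h0 hτ1) hz.2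

/-- The planar cross product. -/
def cross (u v : EuclideanSpace ℝ (Fin 2)) : ℝ := u 0 * v 1 - u 1 * v 0

/-- Divided by `‖v‖`, the cross product is the distance from `c` to the tangent line. If it were
less than `r`, the tangent and hence a nearby secant would meet the ball, so two boundary points
would be aligned with a point of the ball, against `eq_zero_of_frontier`. -/
theorem le_abs_cross {γ : ℝ → EuclideanSpace ℝ (Fin 2)} {a b t : ℝ} {v : EuclideanSpace ℝ (Fin 2)}
    (hEo : IsOpen E) (hE : ∀ y ∈ Metric.ball c r, StarConvex ℝ y E) (hball : Metric.ball c r ⊆ E)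
    (hr : 0 < r)
    (hγE : γ '' Icc a b ⊆ frontier E) (ht : t ∈ Ioo a b) (hv : v ≠ 0) (hγ : HasDerivAt γ v t) :
    r * ‖v‖ ≤ |cross (γ t - c) v| := by
  by_contra! hlt
  have hvn : 0 < ‖v‖ := norm_pos_iff.2 hv
  have hnv : ‖v‖ ^ 2 = v 0 ^ 2 + v 1 ^ 2 := by
    rw [EuclideanSpace.norm_sq_eq, Fin.sum_univ_two, Real.norm_eq_abs, Real.norm_eq_abs, sq_abs,
      sq_abs]
  have hvp : 0 < v 0 ^ 2 + v 1 ^ 2 := by rw [← hnv]; positivity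
  have hx : γ t ∈ frontier E := hγE ⟨t, Ioo_subset_Icc_self ht, rfl⟩
  set u := γ t - c with hu
  -- The parameter of the foot of the perpendicular from `c` to the tangent line.
  set τ : ℝ := -((u 0 * v 0 + u 1 * v 1) / (v 0 ^ 2 + v 1 ^ 2)) with hτ
  have hq : γ t + τ • v ∈ Metric.ball c r := by
    rw [mem_ball_iff_norm, show γ t + τ • v - c = u + τ • v by rw [hu]; abel]
    refine lt_of_pow_lt_pow_left₀ 2 hr.le ?_
    rw [EuclideanSpace.norm_sq_eq, Fin.sum_univ_two, Real.norm_eq_abs, Real.norm_eq_abs, sq_abs,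
      sq_abs]
    simp only [PiLp.add_apply, PiLp.smul_apply, smul_eq_mul]
    have h1 : (u 0 + τ * v 0) ^ 2 + (u 1 + τ * v 1) ^ 2 =
        cross u v ^ 2 / (v 0 ^ 2 + v 1 ^ 2) := by
      rw [hτ, cross]
      field_simp
      ring
    rw [h1, div_lt_iff₀ hvp, ← hnv, ← mul_pow, ← sq_abs (cross u v)]
    exact pow_lt_pow_left₀ hlt (abs_nonneg _) (by norm_num)
  have hτ0 : τ ≠ 0 := by
    intro h0
    rw [h0, zero_smul, add_zero] at hq
    rw [hEo.frontier_eq] at hx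
    exact hx.2 (hball hq)
  have hs := hasDerivAt_iff_tendsto_slope_zero.1 hγ
  -- The corresponding points on the secants converge to the foot, so they enter the ball. Seen from
  -- `γ t`, the point `γ (t + ε)` is at ratio `ε / τ` towards them.
  have hs2 : Filter.Tendsto (fun ε : ℝ => γ t + τ • (ε⁻¹ • (γ (t + ε) - γ t)))
      (nhdsWithin 0 {0}ᶜ) (nhds (γ t + τ • v)) := (hs.const_smul τ).const_add _
  have e1 := hs2.eventually (Metric.isOpen_ball.mem_nhds hq)
  have e2 : ∀ᶠ ε : ℝ in nhdsWithin 0 {0}ᶜ, t + ε ∈ Ioo a b := by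
    refine nhdsWithin_le_nhds ?_
    have : Continuous fun ε : ℝ => t + ε := by fun_prop
    exact this.continuousAt.preimage_mem_nhds (t := Ioo a b)
      (by rw [add_zero]; exact isOpen_Ioo.mem_nhds ht)
  have e3 : ∀ᶠ ε : ℝ in nhdsWithin 0 {0}ᶜ, ε / τ < 1 := by
    refine nhdsWithin_le_nhds ?_
    have : Continuous fun ε : ℝ => ε / τ := by fun_prop
    exact this.continuousAt.preimage_mem_nhds (t := Iio 1)
      (by rw [zero_div]; exact Iio_mem_nhds one_pos)
  obtain ⟨ε, h1, h2, h3, h4⟩ := (e1.and (e2.and (e3.and self_mem_nhdsWithin))).exists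
  have hε : ε ≠ 0 := h4
  refine (div_ne_zero hε hτ0) (eq_zero_of_frontier hEo hE hx
    (hγE ⟨t + ε, Ioo_subset_Icc_self h2, rfl⟩) h1 h3.le ?_)
  rw [add_sub_cancel_left, smul_smul, smul_smul, div_mul_cancel₀ _ hτ0, mul_inv_cancel₀ hε,
    one_smul, add_sub_cancel]

/-- Compare areas: the cone over the edge with vertex `c` has area at least `r ℓ / 2`, as its
Jacobian at height `l` is at least `l r ‖γ'‖`, and it lies in a square of side twice the diameter.
-/
theorem edgeLength_le {p : ℕ} {γ : ℝ → EuclideanSpace ℝ (Fin 2)} {a b : ℝ}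
    (hEo : IsOpen E) (hEb : Bornology.IsBounded E)
    (hE : ∀ y ∈ Metric.ball c r, StarConvex ℝ y E) (hball : Metric.ball c r ⊆ E) (hr : 0 < r)
    (hγ : IsRegularParam (p + 1) γ a b) (hγE : γ '' Icc a b ⊆ frontier E) :
    r * edgeLength γ a b ≤ 8 * Metric.diam E ^ 2 := by
  set h := Metric.diam E with hh
  have hh0 : 0 ≤ h := Metric.diam_nonneg
  have hcE : c ∈ E := hball (Metric.mem_ball_self hr)
  have hcb : c ∈ Metric.ball c r := Metric.mem_ball_self hr
  have hdist : ∀ t ∈ Icc a b, ‖γ t - c‖ ≤ h := by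
    intro t ht
    rw [← dist_eq_norm, hh, ← Metric.diam_closure]
    exact Metric.dist_le_diam_of_mem hEb.closure (frontier_subset_closure (hγE ⟨t, ht, rfl⟩))
      (subset_closure hcE)
  set γ' := fun t => derivWithin γ (Icc a b) t with hγ'
  let Ψ : ℝ × ℝ → ℝ × ℝ := fun z => (z.2 * (γ z.1 - c) 0, z.2 * (γ z.1 - c) 1)
  let A : ℝ × ℝ → (ℝ × ℝ →L[ℝ] ℝ × ℝ) := fun z =>
    (Matrix.toLin (.finTwoProd ℝ) (.finTwoProd ℝ)
      !![z.2 * γ' z.1 0, (γ z.1 - c) 0; z.2 * γ' z.1 1, (γ z.1 - c) 1]).toContinuousLinearMap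
  let Q : Set (ℝ × ℝ) := Ioo a b ×ˢ Ioo 0 1
  have hdet : ∀ z, (A z).det = -(z.2 * cross (γ z.1 - c) (γ' z.1)) := by
    intro z
    simp only [A, LinearMap.det_toContinuousLinearMap, LinearMap.det_toLin,
      Matrix.det_fin_two_of, cross]
    ring
  have hder : ∀ z ∈ Q, HasFDerivWithinAt Ψ (A z) Q z := by
    intro z hz
    have h1 : ∀ i : Fin 2, HasDerivAt (fun t => (γ t - c) i) (γ' z.1 i) z.1 := fun i => by
      have := (EuclideanSpace.proj (𝕜 := ℝ) i).hasFDerivAt.comp_hasDerivAt z.1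
        ((hγ.hasDerivAt hz.1).sub_const c)
      exact this
    have h2 : HasFDerivAt Ψ (A z) z := by
      simp only [A]
      rw [Matrix.toLin_finTwoProd_toContinuousLinearMap]
      convert! HasFDerivAt.prodMk (𝕜 := ℝ)
        (hasFDerivAt_snd.mul ((h1 0).comp_hasFDerivAt z hasFDerivAt_fst))
        (hasFDerivAt_snd.mul ((h1 1).comp_hasFDerivAt z hasFDerivAt_fst)) using 2 <;>
      simp [smul_smul]
    exact h2.hasFDerivWithinAt
  -- Equal images put two boundary points on one ray from `c`; star-shapedness makes them coincide,
  -- and `γ` is injective.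
  have hinj : InjOn Ψ Q := by
    rintro ⟨t, l⟩ ⟨ht, hl⟩ ⟨t', l'⟩ ⟨ht', hl'⟩ heq
    simp only at ht hl ht' hl'
    simp only [Ψ, Prod.mk.injEq] at heq
    have hl'0 : l' ≠ 0 := hl'.1.ne'
    have e : l • (γ t - c) = l' • (γ t' - c) := by
      ext i
      fin_cases i
      · exact heq.1
      · exact heq.2
    have e2 : γ t' = γ t + (1 - l / l') • (c - γ t) := by
      have : γ t' - c = (l / l') • (γ t - c) := by
        rw [div_eq_inv_mul, mul_smul, e, smul_smul, inv_mul_cancel₀ hl'0, one_smul]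
      rw [← sub_add_cancel (γ t') c, this]
      module
    have e3 := eq_zero_of_frontier hEo hE (hγE ⟨t, Ioo_subset_Icc_self ht, rfl⟩)
      (hγE ⟨t', Ioo_subset_Icc_self ht', rfl⟩) hcb
      (by have := div_pos hl.1 hl'.1; linarith) e2
    rw [e3, zero_smul, add_zero] at e2
    have e4 : l = l' := by
      have : l / l' = 1 := by linarith
      rwa [div_eq_one_iff_eq hl'0] at this
    rw [e4, hγ.injOn (Ioo_subset_Icc_self ht') (Ioo_subset_Icc_self ht) e2]
  have hQm : MeasurableSet Q := measurableSet_Ioo.prod measurableSet_Ioo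
  have himg : Ψ '' Q ⊆ Icc (-h) h ×ˢ Icc (-h) h := by
    rintro _ ⟨⟨t, l⟩, ⟨ht, hl⟩, rfl⟩
    simp only at ht hl
    have h1 : ∀ i, |l * (γ t - c) i| ≤ h := fun i => by
      rw [abs_mul, abs_of_pos hl.1]
      have h2 := (PiLp.norm_apply_le (γ t - c) i).trans (hdist t (Ioo_subset_Icc_self ht))
      rw [Real.norm_eq_abs] at h2
      have h3 := abs_nonneg ((γ t - c) i)
      nlinarith [hl.2, hl.1]
    exact ⟨abs_le.1 (h1 0), abs_le.1 (h1 1)⟩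
  have harea : volume (Ψ '' Q) ≤ ENNReal.ofReal (4 * h ^ 2) := by
    refine (measure_mono himg).trans (le_of_eq ?_)
    rw [Measure.volume_eq_prod, Measure.prod_prod, Real.volume_Icc,
      ← ENNReal.ofReal_mul (by linarith)]
    congr 1; ring
  have hfint := lintegral_abs_det_fderiv_eq_addHaar_image volume hQm hder hinj
  have hlow : ENNReal.ofReal (1 / 2 * (r * edgeLength γ a b)) ≤
      ∫⁻ z in Q, ENNReal.ofReal |(A z).det| := by
    have h1 : ∫⁻ z in Q, ENNReal.ofReal (r * ‖γ' z.1‖) * ENNReal.ofReal z.2 ≤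
        ∫⁻ z in Q, ENNReal.ofReal |(A z).det| := by
      refine setLIntegral_mono' hQm fun z hz => ?_
      rw [← ENNReal.ofReal_mul (by positivity), hdet, abs_neg, abs_mul, abs_of_pos hz.2.1, mul_comm]
      refine ENNReal.ofReal_le_ofReal (mul_le_mul_of_nonneg_left ?_ hz.2.1.le)
      exact le_abs_cross hEo hE hball hr hγE hz.1
        (hγ.deriv_ne_zero _ (Ioo_subset_Icc_self hz.1)) (hγ.hasDerivAt hz.1)
    refine le_trans (le_of_eq ?_) h1
    have hsp : IntegrableOn (fun t => r * ‖γ' t‖) (Ioo a b) := hγ.isPrim_zeta.1.const_mul r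
    have hid : IntegrableOn (fun t : ℝ => t) (Ioo 0 1) :=
      (continuous_id.integrableOn_Icc).mono_set Ioo_subset_Icc_self
    rw [Measure.volume_eq_prod, ← Measure.prod_restrict,
      lintegral_prod_mul (f := fun t => ENNReal.ofReal (r * ‖γ' t‖))
        (g := fun l => ENNReal.ofReal l) hsp.aemeasurable.ennreal_ofReal
        hid.aemeasurable.ennreal_ofReal,
      ← ofReal_integral_eq_lintegral_ofReal hsp (ae_of_all _ fun t => by positivity),
      ← ofReal_integral_eq_lintegral_ofReal hid (by
        filter_upwards [ae_restrict_mem measurableSet_Ioo] with x hx using hx.1.le),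
      ← ENNReal.ofReal_mul (setIntegral_nonneg measurableSet_Ioo fun t _ => by positivity),
      integral_const_mul, ← integral_Ioc_eq_integral_Ioo, ← integral_Ioc_eq_integral_Ioo,
      ← intervalIntegral.integral_of_le hγ.lt.le, ← intervalIntegral.integral_of_le zero_le_one,
      integral_id]
    congr 1
    simp only [edgeLength, zeta, hγ']
    ring
  have := hlow.trans (hfint.le.trans harea)
  rw [ENNReal.ofReal_le_ofReal_iff (by positivity)] at this
  linarith

end Length

/-! ## Interpolation on an edge -/

section Edge

variable {γ : ℝ → EuclideanSpace ℝ (Fin 2)} {a b : ℝ}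

theorem gaussLobattoNodes_subset {k : ℕ} (hk : 1 ≤ k) (hab : a ≤ b) :
    gaussLobattoNodes k a b ⊆ Icc a b := by
  obtain ⟨N, -, hN2, hN3⟩ := exists_gaussLobatto_reference k hk
  rw [hN3]
  rintro t ⟨x, hx, rfl⟩
  have := hN2 x hx
  constructor <;> nlinarith [this.1, this.2]

theorem exists_unique_interpolant {k : ℕ} (hk : 1 ≤ k) (hab : a < b) (g : ℝ → ℝ) :
    ∃ q : Polynomial ℝ, q.natDegree ≤ k ∧ (∀ t ∈ gaussLobattoNodes k a b, g t = q.eval t) ∧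
      ∀ q' : Polynomial ℝ, q'.natDegree ≤ k →
        (∀ t ∈ gaussLobattoNodes k a b, g t = q'.eval t) → q' = q := by
  obtain ⟨N, hN1, -, hN3⟩ := exists_gaussLobatto_reference k hk
  have hinj : InjOn (fun x : ℝ => a + (b - a) * x) N := fun x _ y _ h => by
    have hL : b - a ≠ 0 := by linarith
    exact mul_left_cancel₀ hL (add_left_cancel h)
  set q := Lagrange.interpolate N (fun x => a + (b - a) * x) (fun x => g (a + (b - a) * x)) with hq
  refine ⟨q, ?_, ?_, ?_⟩
  · have h1 : q.degree < N.card := Lagrange.degree_interpolate_lt _ hinj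
    rw [hN1] at h1
    by_cases h0 : q = 0
    · simp [h0]
    · exact Nat.lt_succ_iff.1 ((Polynomial.natDegree_lt_iff_degree_lt h0).2 h1)
  · intro t ht
    rw [hN3] at ht
    obtain ⟨x, hx, rfl⟩ := ht
    exact (Lagrange.eval_interpolate_at_node (fun x => g (a + (b - a) * x)) hinj hx).symm
  · intro q' hq' hq'g
    refine Lagrange.eq_interpolate_of_eval_eq _ hinj ?_ fun x hx => (hq'g _ ?_).symm
    · rw [hN1]
      exact Polynomial.degree_le_natDegree.trans_lt (by exact_mod_cast Nat.lt_succ_of_le hq')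
    · rw [hN3]
      exact ⟨x, hx, rfl⟩

theorem exists_gaussLobattoInterpolant {k p : ℕ} (hk : 1 ≤ k) (hγ : IsRegularParam p γ a b)
    (v : EuclideanSpace ℝ (Fin 2) → ℝ) :
    ∃ (q : Polynomial ℝ) (vI : EuclideanSpace ℝ (Fin 2) → ℝ), q.natDegree ≤ k ∧
      (∀ t ∈ gaussLobattoNodes k a b, v (γ t) = q.eval t) ∧
      (∀ t ∈ Icc a b, vI (γ t) = q.eval t) ∧ IsGaussLobattoInterpolant k γ a b v vI ∧
      ∀ w, IsGaussLobattoInterpolant k γ a b v w → EqOn w vI (γ '' Icc a b) := by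
  obtain ⟨q, hq1, hq2, hq3⟩ := exists_unique_interpolant hk hγ.lt (fun t => v (γ t))
  have hvI : ∀ t ∈ Icc a b, q.eval (Function.invFunOn γ (Icc a b) (γ t)) = q.eval t :=
    fun t ht => by rw [hγ.injOn.leftInvOn_invFunOn ht]
  have hsub := gaussLobattoNodes_subset hk hγ.lt.le
  refine ⟨q, fun x => q.eval (Function.invFunOn γ (Icc a b) x), hq1, hq2, hvI,
    ⟨⟨q, hq1, hvI⟩, fun t ht => ?_⟩, ?_⟩
  · change v (γ t) = q.eval (Function.invFunOn γ (Icc a b) (γ t))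
    rw [hvI t (hsub ht)]
    exact hq2 t ht
  · rintro w ⟨⟨q', h1, h2⟩, h3⟩ _ ⟨t, ht, rfl⟩
    have : q' = q := hq3 q' h1 fun t ht => by rw [h3 t ht, h2 t (hsub ht)]
    rw [h2 t ht, this]
    exact (hvI t ht).symm

theorem IsRegularParam.continuousOn_comp_chi {p : ℕ} (hγ : IsRegularParam (p + 1) γ a b)
    {v : EuclideanSpace ℝ (Fin 2) → ℝ} (hv : ContinuousOn v (γ '' Icc a b)) :
    ContinuousOn (v ∘ chi γ a b) (Icc 0 (edgeLength γ a b)) := by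
  have h1 : ContinuousOn (fun y => γ (zetaInv γ a b y)) (Icc 0 (edgeLength γ a b)) :=
    hγ.contDiffOn.continuousOn.comp hγ.continuousOn_zetaInv fun y hy => hγ.zetaInv_mem hy
  exact hv.comp h1 fun y hy => ⟨_, hγ.zetaInv_mem hy, rfl⟩

theorem IsRegularParam.dist_endpoints {E : Set (EuclideanSpace ℝ (Fin 2))} {p : ℕ}
    (hγ : IsRegularParam p γ a b) (hEb : Bornology.IsBounded E)
    (hγE : γ '' Icc a b ⊆ frontier E) : dist (γ a) (γ b) ≤ Metric.diam E := by
  rw [← Metric.diam_closure]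
  exact Metric.dist_le_diam_of_mem hEb.closure
    (frontier_subset_closure (hγE ⟨a, ⟨le_rfl, hγ.lt.le⟩, rfl⟩))
    (frontier_subset_closure (hγE ⟨b, ⟨hγ.lt.le, le_rfl⟩, rfl⟩))

theorem IsRegularParam.zeta_of_affine {p : ℕ} (hγ : IsRegularParam p γ a b)
    {x d : EuclideanSpace ℝ (Fin 2)} (h : ∀ t ∈ Icc a b, γ t = x + t • d) {t : ℝ}
    (ht : t ∈ Icc a b) : zeta γ a b t = ‖d‖ * (t - a) := by
  have h1 : ∀ τ ∈ Icc a b, derivWithin γ (Icc a b) τ = d := by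
    intro τ hτ
    have h2 : HasDerivAt (fun t : ℝ => x + t • d) d τ := by
      simpa using ((hasDerivAt_id τ).smul_const d).const_add x
    exact (h2.hasDerivWithinAt.congr h (h τ hτ)).derivWithin (uniqueDiffOn_Icc hγ.lt τ hτ)
  have h3 : zeta γ a b t = ∫ _ in a..t, ‖d‖ := by
    refine intervalIntegral.integral_congr fun τ hτ => ?_
    rw [uIcc_of_le ht.1] at hτ
    rw [h1 τ ⟨hτ.1, hτ.2.trans ht.2⟩]
  rw [h3, intervalIntegral.integral_const, smul_eq_mul, mul_comm]

/-- The error of the Gauss-Lobatto interpolation on an interval, in the full Sobolev norm. -/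
theorem exists_interpolation_hNorm_estimate (k : ℕ) (hk : 1 ≤ k) (s m : ℝ) (hs : 1 < s)
    (hsk : s ≤ k + 1) (hm : 0 ≤ m) (hms : m ≤ s) (Λ : ℝ) :
    ∃ C : ℝ, 0 ≤ C ∧ ∀ (a b : ℝ), a < b → b - a ≤ Λ → ∀ f : ℝ → ℝ, ContinuousOn f (Icc a b) →
      hNorm s a b f < ⊤ → ∀ q : Polynomial ℝ, q.natDegree ≤ k →
      (∀ t ∈ gaussLobattoNodes k a b, f t = q.eval t) →
      hNorm m a b (fun x => f x - q.eval x) ≤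
        ENNReal.ofReal (C * (b - a) ^ (s - m)) * hNorm s a b f := by
  have hfl := Nat.floor_le hm
  have H : ∀ j : ℕ, ∃ C : ℝ, 0 < C ∧ (j ≤ ⌊m⌋₊ → ∀ (a b : ℝ), a < b → ∀ f : ℝ → ℝ,
      ContinuousOn f (Icc a b) → hNorm s a b f < ⊤ → ∀ q : Polynomial ℝ, q.natDegree ≤ k →
      (∀ t ∈ gaussLobattoNodes k a b, f t = q.eval t) →
      hSeminorm (j : ℝ) a b (fun x => f x - q.eval x) ≤
        ENNReal.ofReal (C * (b - a) ^ (s - j)) * hSeminorm s a b f) := by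
    intro j
    by_cases hj : j ≤ ⌊m⌋₊
    · have hjm : (j : ℝ) ≤ m := le_trans (by exact_mod_cast hj) hfl
      obtain ⟨C, hC, H⟩ := exists_interpolation_estimate k hk s j hs hsk (by positivity)
        (hjm.trans hms)
      exact ⟨C, hC, fun _ => H⟩
    · exact ⟨1, one_pos, fun h => absurd h hj⟩
  choose D hD HD using H
  obtain ⟨D', hD', HD'⟩ := exists_interpolation_estimate k hk s m hs hsk hm hms
  -- A seminorm of order `j` below `m` carries the surplus power `m - j` of the length, absorbed by
  -- means of `Λ`.
  set T := ∑ j ∈ Finset.range (⌊m⌋₊ + 1), D j * |Λ| ^ (m - j) with hT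
  have hT0 : ∀ j ∈ Finset.range (⌊m⌋₊ + 1), 0 ≤ D j * |Λ| ^ (m - j) := fun j _ =>
    mul_nonneg (hD j).le (Real.rpow_nonneg (abs_nonneg _) _)
  have hTn : 0 ≤ T := Finset.sum_nonneg hT0
  refine ⟨(⌊m⌋₊ + 2) * (T + D'), by positivity, ?_⟩
  intro a b hab hΛ f hf hfs q hq hqf
  have hL : 0 < b - a := by linarith
  have hsem : hSeminorm s a b f ≤ hNorm s a b f := hSeminorm_le_hNorm (by linarith)
  rw [mul_assoc, ENNReal.ofReal_mul (by positivity), mul_assoc]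
  refine hNorm_le (fun j hj => ?_) fun _ => ?_
  · refine (HD j hj a b hab f hf hfs q hq hqf).trans (mul_le_mul' (ENNReal.ofReal_le_ofReal ?_) hsem)
    have hjm : (j : ℝ) ≤ m := le_trans (by exact_mod_cast hj) hfl
    have e : (b - a) ^ (s - j) = (b - a) ^ (m - j) * (b - a) ^ (s - m) := by
      rw [← Real.rpow_add hL]; congr 1; ring
    rw [e, ← mul_assoc]
    gcongr
    calc D j * (b - a) ^ (m - j) ≤ D j * |Λ| ^ (m - j) := by
          refine mul_le_mul_of_nonneg_left (Real.rpow_le_rpow hL.le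
            (hΛ.trans (le_abs_self _)) (by linarith)) (hD j).le
      _ ≤ T := Finset.single_le_sum hT0 (Finset.mem_range.2 (Nat.lt_succ_of_le hj))
      _ ≤ T + D' := by linarith
  · refine (HD' a b hab f hf hfs q hq hqf).trans (mul_le_mul' (ENNReal.ofReal_le_ofReal ?_) hsem)
    gcongr
    linarith

theorem abs_sub_le_of_wInftyNorm_le {n : ℕ} {c d M : ℝ} {φ : ℝ → ℝ} (hcd : c < d)
    (hM : 0 ≤ M) (hφ : ContinuousOn φ (Icc c d))
    (h : wInftyNorm (n + 1) c d φ ≤ ENNReal.ofReal M) {x y : ℝ} (hx : x ∈ Icc c d)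
    (hy : y ∈ Icc c d) : |φ x - φ y| ≤ M * |x - y| := by
  obtain ⟨-, φ', h1, h2⟩ := exists_bddDerivs_of_wInftyNorm_le hcd hM hφ h
  rw [h1.sub_eq hy hx, ← Real.norm_eq_abs]
  refine intervalIntegral.norm_integral_le_of_norm_le_const_ae ?_
  have hc : ∀ᵐ t : ℝ, t ≠ c := by simp [ae_iff]
  have hd : ∀ᵐ t : ℝ, t ≠ d := by simp [ae_iff]
  filter_upwards [h2.ae_le, hc, hd] with t ht h3 h4 ht'
  have := (uIcc_subset_Icc hy hx) (uIoc_subset_uIcc ht')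
  exact ht ⟨lt_of_le_of_ne this.1 h3.symm, lt_of_le_of_ne this.2 h4⟩

theorem exists_straight_edge_estimate (k : ℕ) (hk : 1 ≤ k) (s m : ℝ) (hs : 1 < s)
    (hsk : s ≤ k + 1) (hm : 0 ≤ m) (hms : m ≤ s) :
    ∃ C : ℝ, 0 < C ∧
      ∀ (E : Set (EuclideanSpace ℝ (Fin 2))) (γ : ℝ → EuclideanSpace ℝ (Fin 2)) (a b : ℝ),
        Bornology.IsBounded E → IsRegularParam (k + 1) γ a b → IsAffineParam γ a b →
        γ '' Icc a b ⊆ frontier E →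
        ∀ v : EuclideanSpace ℝ (Fin 2) → ℝ, MemHEdge s γ a b v →
          ∃ vI : EuclideanSpace ℝ (Fin 2) → ℝ, IsGaussLobattoInterpolant k γ a b v vI ∧
            (∀ w, IsGaussLobattoInterpolant k γ a b v w → EqOn w vI (γ '' Icc a b)) ∧
            edgeSeminorm m γ a b (v - vI) ≤
              ENNReal.ofReal (C * Metric.diam E ^ (s - m)) * edgeNorm s γ a b v := by
  obtain ⟨C, hC, H⟩ := exists_interpolation_estimate k hk s m hs hsk hm hms
  refine ⟨C, hC, ?_⟩
  intro E γ a b hEb hγ haff hγE v hv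
  obtain ⟨q, vI, hq1, hq2, hq3, hI, hu⟩ := exists_gaussLobattoInterpolant hk hγ v
  refine ⟨vI, hI, hu, ?_⟩
  obtain ⟨x, d, hxd⟩ := haff
  have ha : a ∈ Icc a b := ⟨le_rfl, hγ.lt.le⟩
  have hb : b ∈ Icc a b := ⟨hγ.lt.le, le_rfl⟩
  have hℓ : edgeLength γ a b = ‖d‖ * (b - a) := hγ.zeta_of_affine hxd hb
  have hℓ0 := hγ.edgeLength_pos
  set ℓ := edgeLength γ a b with hℓd
  have hba : 0 < b - a := by linarith [hγ.lt]
  have hd0 : 0 < ‖d‖ := by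
    by_contra h
    have : ‖d‖ = 0 := le_antisymm (not_lt.1 h) (norm_nonneg _)
    rw [hℓ, this, zero_mul] at hℓ0
    exact lt_irrefl _ hℓ0
  have hinv : ∀ y ∈ Icc 0 ℓ, zetaInv γ a b y = a + ‖d‖⁻¹ * y := by
    intro y hy
    have h1 := hγ.zeta_of_affine hxd (hγ.zetaInv_mem hy)
    rw [hγ.zeta_zetaInv hy] at h1
    have h2 : ‖d‖⁻¹ * y = zetaInv γ a b y - a := by
      rw [inv_mul_eq_div, div_eq_iff hd0.ne']
      linarith
    linarith
  -- The interpolating polynomial written in arc length; the affine change of parameter carries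
  -- nodes to nodes, so `q'` interpolates on `(0, ℓ)`.
  let q' : Polynomial ℝ := q.comp (Polynomial.C a + Polynomial.C ‖d‖⁻¹ * Polynomial.X)
  have hq'e : ∀ y, q'.eval y = q.eval (a + ‖d‖⁻¹ * y) := fun y => by simp [q']
  have hq'd : q'.natDegree ≤ k := by
    simp only [q', Polynomial.natDegree_comp]
    rw [add_comm (Polynomial.C a)]
    exact (Nat.mul_le_mul_left _ Polynomial.natDegree_linear_le).trans (by omega)
  have hest := H 0 ℓ hℓ0 (v ∘ chi γ a b) (hγ.continuousOn_comp_chi hv.1) hv.2 q' hq'd (by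
    intro t ht
    have ht' := gaussLobattoNodes_subset hk hℓ0.le ht
    rw [hq'e, ← hinv t ht']
    refine hq2 _ ?_
    obtain ⟨y, rfl, hy⟩ := ht
    refine ⟨y, ?_, hy⟩
    rw [hinv _ ht', hℓ]
    field_simp
    ring)
  have hcongr : edgeSeminorm m γ a b (v - vI) =
      hSeminorm m 0 ℓ (fun y => (v ∘ chi γ a b) y - q'.eval y) := by
    refine hSeminorm_congr fun y hy => ?_
    have hy' := Ioo_subset_Icc_self hy
    simp only [Function.comp_apply, Pi.sub_apply, chi, hq'e]
    rw [hq3 _ (hγ.zetaInv_mem hy'), hinv y hy']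
  rw [hcongr]
  refine hest.trans (mul_le_mul' (ENNReal.ofReal_le_ofReal ?_)
    (hSeminorm_le_hNorm (by linarith)))
  have hle : ℓ ≤ Metric.diam E := by
    refine le_trans (le_of_eq ?_) (hγ.dist_endpoints hEb hγE)
    rw [hxd a ha, hxd b hb, dist_add_left, dist_eq_norm, ← sub_smul, norm_smul, Real.norm_eq_abs,
      abs_sub_comm, abs_of_pos hba, hℓ, mul_comm]
  rw [sub_zero]
  gcongr

theorem exists_curved_edge_estimate (k : ℕ) (hk : 1 ≤ k) (s m : ℝ) (hs : 1 < s)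
    (hsk : s ≤ k + 1) (hm : 0 ≤ m) (hms : m ≤ s) (ρ M : ℝ) (hρ : 0 < ρ) :
    ∃ C : ℝ, 0 < C ∧
      ∀ (E : Set (EuclideanSpace ℝ (Fin 2))) (γ : ℝ → EuclideanSpace ℝ (Fin 2)) (a b : ℝ),
        IsOpen E → Bornology.IsBounded E → IsStarShapedBall ρ E →
        IsRegularParam (k + 1) γ a b → γ '' Icc a b ⊆ frontier E →
        wInftyNorm ⌈s⌉₊ a b (zeta γ a b) ≤ ENNReal.ofReal M →
        wInftyNorm ⌈s⌉₊ 0 (edgeLength γ a b) (zetaInv γ a b) ≤ ENNReal.ofReal M →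
        ∀ v : EuclideanSpace ℝ (Fin 2) → ℝ, MemHEdge s γ a b v →
          ∃ vI : EuclideanSpace ℝ (Fin 2) → ℝ, IsGaussLobattoInterpolant k γ a b v vI ∧
            (∀ w, IsGaussLobattoInterpolant k γ a b v w → EqOn w vI (γ '' Icc a b)) ∧
            edgeSeminorm m γ a b (v - vI) ≤
              ENNReal.ofReal (C * Metric.diam E ^ (s - m)) * edgeNorm s γ a b v := by
  set B := max M 1 with hB
  have hB1 : 1 ≤ B := le_max_right _ _
  have hMB : ENNReal.ofReal M ≤ ENNReal.ofReal B := ENNReal.ofReal_le_ofReal (le_max_left _ _)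
  -- As `s > 1`, two derivatives of `ζ` and `ζ⁻¹` are bounded, so their first derivatives are
  -- continuous.
  obtain ⟨n, hn⟩ : ∃ n, ⌈s⌉₊ = n + 2 := by
    have : 1 < ⌈s⌉₊ := Nat.lt_ceil.2 (by simpa using hs)
    exact ⟨⌈s⌉₊ - 2, by omega⟩
  have hmn : ⌈m⌉₊ ≤ n + 2 := hn ▸ Nat.ceil_mono hms
  obtain ⟨C1, hC1, H1⟩ := exists_hNorm_comp_le s (by linarith) n hn.le B hB1
  obtain ⟨C2, hC2, H2⟩ := exists_interpolation_hNorm_estimate k hk s m hs hsk hm hms (2 * B)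
  obtain ⟨C3, hC3, H3⟩ := exists_hNorm_comp_le m hm n hmn B hB1
  -- `C1` is for the pullback by `ζ`, `C2` for interpolation on `[a, b]`, `C3` for the return by
  -- `ζ⁻¹`; the power comes from the bound of `b - a` by the diameter, and 1 ensures positivity.
  refine ⟨C3 * C2 * C1 * (B * (8 / ρ)) ^ (s - m) + 1, by positivity, ?_⟩
  intro E γ a b hEo hEb hstar hγ hγE hζ hζi v hv
  rw [hn] at hζ hζi
  replace hζ := hζ.trans hMB
  replace hζi := hζi.trans hMB
  obtain ⟨q, vI, hq1, hq2, hq3, hI, hu⟩ := exists_gaussLobattoInterpolant hk hγ v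
  refine ⟨vI, hI, hu, ?_⟩
  have hB0 : 0 ≤ B := by linarith
  have hℓ0 := hγ.edgeLength_pos
  have hζc := hγ.isPrim_zeta.continuousOn
  have hζic := hγ.continuousOn_zetaInv
  set ℓ := edgeLength γ a b with hℓ
  set h := Metric.diam E with hh
  have hab := hγ.lt
  have ha : a ∈ Icc a b := ⟨le_rfl, hab.le⟩
  have hb : b ∈ Icc a b := ⟨hab.le, le_rfl⟩
  have h0 : (0 : ℝ) ∈ Icc 0 ℓ := ⟨le_rfl, hℓ0.le⟩
  have hl : ℓ ∈ Icc 0 ℓ := ⟨hℓ0.le, le_rfl⟩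
  -- The Lipschitz bound of `ζ⁻¹` read as a lower bound for the increments of `ζ`; below, the roles
  -- are exchanged.
  have hlip : ∀ x ∈ Icc a b, ∀ y ∈ Icc a b, x ≤ y →
      y - x ≤ B * (zeta γ a b y - zeta γ a b x) := by
    intro x hx y hy hxy
    have h1 := abs_sub_le_of_wInftyNorm_le hℓ0 hB0 hζic hζi (hγ.zeta_mem hy) (hγ.zeta_mem hx)
    rw [hγ.zetaInv_zeta hx, hγ.zetaInv_zeta hy, abs_of_nonneg (by linarith), abs_of_nonneg
      (by linarith [hγ.strictMonoOn_zeta.monotoneOn hx hy hxy])] at h1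
    exact h1
  have hlipi : ∀ x ∈ Icc 0 ℓ, ∀ y ∈ Icc 0 ℓ, x ≤ y →
      y - x ≤ B * (zetaInv γ a b y - zetaInv γ a b x) := by
    intro x hx y hy hxy
    have h1 := abs_sub_le_of_wInftyNorm_le hab hB0 hζc hζ (hγ.zetaInv_mem hy) (hγ.zetaInv_mem hx)
    rw [hγ.zeta_zetaInv hx, hγ.zeta_zetaInv hy, abs_of_nonneg (by linarith), abs_of_nonneg
      (by linarith [hγ.zetaInv_mono hx hy hxy])] at h1
    exact h1
  have hℓB : ℓ - 0 ≤ 2 * B := by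
    have h1 := (exists_bddDerivs_of_wInftyNorm_le hab hB0 hζc hζ).1 b hb
    have h2 := le_abs_self (zeta γ a b b)
    have h3 : ℓ = zeta γ a b b := rfl
    linarith
  -- The endpoints `a` and `b` are values of `ζ⁻¹`, so its sup norm bounds both.
  have hbaB : b - a ≤ 2 * B := by
    have h1 := (exists_bddDerivs_of_wInftyNorm_le hℓ0 hB0 hζic hζi).1
    have h2 := h1 0 h0
    have h3 := h1 ℓ hl
    rw [hγ.zetaInv_zero] at h2
    rw [hγ.zetaInv_edgeLength] at h3
    linarith [le_abs_self b, neg_abs_le a]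
  set u := v ∘ chi γ a b with hu'
  have huc := hγ.continuousOn_comp_chi hv.1
  have hus : hNorm s 0 ℓ u < ⊤ := hv.2
  have hfc : ContinuousOn (fun t => u (zeta γ a b t)) (Icc a b) :=
    huc.comp hζc fun t ht => hγ.zeta_mem ht
  have e1 := H1 0 ℓ a b (zeta γ a b) u hab zeta_left rfl hℓB hbaB hζc hζ hlip huc hus
  have hfs : hNorm s a b (fun t => u (zeta γ a b t)) < ⊤ :=
    e1.trans_lt (ENNReal.mul_lt_top ENNReal.ofReal_lt_top hus)
  have e2 := H2 a b hab hbaB _ hfc hfs q hq1 fun t ht => by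
    have ht' := gaussLobattoNodes_subset hk hab.le ht
    rw [← hq2 t ht]
    simp only [hu', Function.comp_apply, chi, hγ.zetaInv_zeta ht']
  have e3 := H3 a b 0 ℓ (zetaInv γ a b) (fun t => u (zeta γ a b t) - q.eval t) hℓ0
    hγ.zetaInv_zero hγ.zetaInv_edgeLength hbaB hℓB hζic hζi hlipi
    (hfc.sub q.continuous.continuousOn)
    (e2.trans_lt (ENNReal.mul_lt_top ENNReal.ofReal_lt_top hfs))
  have hcongr : edgeSeminorm m γ a b (v - vI) = hSeminorm m 0 ℓ
      (fun y => u (zeta γ a b (zetaInv γ a b y)) - q.eval (zetaInv γ a b y)) := by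
    refine hSeminorm_congr fun y hy => ?_
    have hy' := Ioo_subset_Icc_self hy
    rw [hγ.zeta_zetaInv hy']
    simp only [hu', Function.comp_apply, Pi.sub_apply, chi]
    rw [hq3 _ (hγ.zetaInv_mem hy')]
  have hh0 : 0 < h := by
    refine lt_of_lt_of_le (dist_pos.2 fun h' => ?_) (hγ.dist_endpoints hEb hγE)
    exact hab.ne (hγ.injOn ha hb h')
  have hlen : b - a ≤ B * (8 / ρ) * h := by
    obtain ⟨c, r, hr, hball, hst⟩ := hstar
    have hr0 : 0 < r := lt_of_lt_of_le (mul_pos hρ hh0) hr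
    have h1 := edgeLength_le hEo hEb hst hball hr0 hγ hγE
    have h2 : ρ * ℓ ≤ 8 * h := by
      have : ρ * h * ℓ ≤ 8 * h ^ 2 := (mul_le_mul_of_nonneg_right hr hℓ0.le).trans h1
      nlinarith
    have h3 : ℓ ≤ 8 / ρ * h := by
      rw [div_mul_eq_mul_div, le_div_iff₀ hρ]
      linarith
    have h4 := hlip a ha b hb hab.le
    rw [zeta_left, sub_zero] at h4
    calc b - a ≤ B * ℓ := h4
      _ ≤ B * (8 / ρ * h) := by gcongr
      _ = _ := by ring
  rw [hcongr]
  refine (hSeminorm_le_hNorm hm).trans (e3.trans ?_)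
  calc ENNReal.ofReal C3 * hNorm m a b (fun t => u (zeta γ a b t) - q.eval t)
      ≤ ENNReal.ofReal C3 * (ENNReal.ofReal (C2 * (b - a) ^ (s - m)) *
        (ENNReal.ofReal C1 * hNorm s 0 ℓ u)) := by
        gcongr
        exact e2.trans (mul_le_mul_right e1 _)
    _ = ENNReal.ofReal (C3 * (C2 * (b - a) ^ (s - m)) * C1) * hNorm s 0 ℓ u := by
        have : 0 ≤ (b - a) ^ (s - m) := Real.rpow_nonneg (by linarith) _
        rw [ENNReal.ofReal_mul (p := C3 * (C2 * (b - a) ^ (s - m))) (by positivity),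
          ENNReal.ofReal_mul (p := C3) hC3]
        simp only [mul_assoc]
    _ ≤ _ := by
        refine mul_le_mul' (ENNReal.ofReal_le_ofReal ?_) le_rfl
        have h1 : (b - a) ^ (s - m) ≤ (B * (8 / ρ)) ^ (s - m) * h ^ (s - m) := by
          rw [← Real.mul_rpow (by positivity) hh0.le]
          exact Real.rpow_le_rpow (by linarith) hlen (by linarith)
        have h2 : 0 ≤ h ^ (s - m) := by positivity
        calc C3 * (C2 * (b - a) ^ (s - m)) * C1
            ≤ C3 * (C2 * ((B * (8 / ρ)) ^ (s - m) * h ^ (s - m))) * C1 := by gcongr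
          _ = C3 * C2 * C1 * (B * (8 / ρ)) ^ (s - m) * h ^ (s - m) := by ring
          _ ≤ _ := by rw [add_mul, one_mul]; linarith

end Edge

end CurvedEdge

/-! ### The estimate on straight and on possibly curved edges. -/

theorem lemma3p2 (k : ℕ) (hk : 1 ≤ k) (s m : ℝ) (hs : 1 < s) (hsk : s ≤ k + 1)
    (hm : 0 ≤ m) (hms : m ≤ s) :
    -- straight edges: the constant depends only on `k`, `s`, `m`
    (∃ C : ℝ, 0 < C ∧
      ∀ (E : Set (EuclideanSpace ℝ (Fin 2))) (γ : ℝ → EuclideanSpace ℝ (Fin 2)) (a b : ℝ),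
        IsOpen E → Bornology.IsBounded E →
        CurvedEdge.IsRegularParam (k + 1) γ a b → CurvedEdge.IsAffineParam γ a b →
        γ '' Set.Icc a b ⊆ frontier E →
        ∀ v : EuclideanSpace ℝ (Fin 2) → ℝ, CurvedEdge.MemHEdge s γ a b v →
          ∃ vI : EuclideanSpace ℝ (Fin 2) → ℝ,
            CurvedEdge.IsGaussLobattoInterpolant k γ a b v vI ∧
            (∀ w, CurvedEdge.IsGaussLobattoInterpolant k γ a b v w →
              Set.EqOn w vI (γ '' Set.Icc a b)) ∧
            CurvedEdge.edgeSeminorm m γ a b (v - vI) ≤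
              ENNReal.ofReal (C * Metric.diam E ^ (s - m)) * CurvedEdge.edgeNorm s γ a b v) ∧
    -- curved edges: the constant depends only on `k`, `s`, `m`, on the shape-regularity constant
    -- `ρ` and on a bound `M` for the norms of the natural parameter and of its inverse
    (∀ ρ M : ℝ, 0 < ρ → ∃ C : ℝ, 0 < C ∧
      ∀ (E : Set (EuclideanSpace ℝ (Fin 2))) (γ : ℝ → EuclideanSpace ℝ (Fin 2)) (a b : ℝ),
        IsOpen E → Bornology.IsBounded E → CurvedEdge.IsStarShapedBall ρ E →
        CurvedEdge.IsRegularParam (k + 1) γ a b →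
        γ '' Set.Icc a b ⊆ frontier E →
        CurvedEdge.wInftyNorm ⌈s⌉₊ a b (CurvedEdge.zeta γ a b) ≤ ENNReal.ofReal M →
        CurvedEdge.wInftyNorm ⌈s⌉₊ 0 (CurvedEdge.edgeLength γ a b) (CurvedEdge.zetaInv γ a b) ≤
          ENNReal.ofReal M →
        ∀ v : EuclideanSpace ℝ (Fin 2) → ℝ, CurvedEdge.MemHEdge s γ a b v →
          ∃ vI : EuclideanSpace ℝ (Fin 2) → ℝ,
            CurvedEdge.IsGaussLobattoInterpolant k γ a b v vI ∧
            (∀ w, CurvedEdge.IsGaussLobattoInterpolant k γ a b v w →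
              Set.EqOn w vI (γ '' Set.Icc a b)) ∧
            CurvedEdge.edgeSeminorm m γ a b (v - vI) ≤
              ENNReal.ofReal (C * Metric.diam E ^ (s - m)) * CurvedEdge.edgeNorm s γ a b v) := by
  refine ⟨?_, fun ρ M hρ => ?_⟩
  · obtain ⟨C, hC, H⟩ := CurvedEdge.exists_straight_edge_estimate k hk s m hs hsk hm hms
    exact ⟨C, hC, fun E γ a b _ hEb hγ haff hγE v hv => H E γ a b hEb hγ haff hγE v hv⟩
  · exact CurvedEdge.exists_curved_edge_estimate k hk s m hs hsk hm hms ρ M hρ
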